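/- Let $\mu>0$ and let $X(t)=B(t)+\mu t$, $t\ge 0$, where $B$ is a standard Brownian motion (with $B(0)=0$ and continuous paths). A *multistage sampling rule* is a sequence $T=(T_1,T_2,\dots)$ of nonnegative random variables such that for every $k\ge 0$ and $t\ge 0$ the variable $T_{k+1}1\{T_1+\cdots+T_k\le t\}$ is measurable with respect to $\sigma(X(s):s\le t)$ (in particular $T_1$ is deterministic). Put $T^k=T_1+\cdots+T_k$, $X_k=X(T^k)$ and, for $a>0$, $M=\inf\{m\ge 1: X(T^m)\ge a\}$. For a function $h:(0,\infty)\to(0,\infty)$ the risk of the rule at $a$ is $$R_h=E(T^M-a/\mu)+h(a)\,E M\in(-\infty,\infty],$$ and $R_h^*(a)$ is the infimum of the risk over all multistage sampling rules. Let $\Phi,\phi$ be the standard normal distribution function and density, $\Delta(z)=\int_z^\infty\Phi(-x)\,dx$, and for $x>0$, $z\in\mathbb R$ let $t(x,z)$ be the unique $t>0$ with $(x-\mu t)/\sqrt t=z$. *Geometric sampling* $\dot\delta_z(a)$ has $T_k=t(a-X_{k-1},z)$ as long as $X_{k-1}<a$ (and $T_k=0$ afterwards). Let $f(x)=(6/\sqrt\mu)\sqrt{x\log(x+1)}$,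 an increasing bijection of $(0,\infty)$. Define samplers recursively for $m\ge1$, where "followed by" means that the process restarted at the end of the stage is sampled if the boundary has not been crossed: - $\delta^o_{1,g}(a)=\dot\delta_{\zeta(a)}(a)$ with $\zeta(x)=-\min(\sqrt{g(x)}/x^{1/4},\,x^{1/7})$; $\delta^o_{m+1,g}(a)$ has first stage $t\big(a,\sqrt{\log(a/g(a)^2+1)}\big)$, followed by $\delta^o_{m,\,g\circ f^{-1}}(a-X_1)$. - $\delta^+_{1,z}(a)$ has first stage $t(a,z)$, followed by $\dot\delta_{\nu(a-X_1)}(a-X_1)$ with $\nu(x)=-\sqrt{\log(x+1)}$; $\delta^+_{m+1,z}(a)$ has first stage $t\big(a,\sqrt{(1-2^{-m})\log(a+1)}\big)$, followed by $\delta^+_{m,z}(a-X_1)$. Let $h_0(x)=x$, $h_m(x)=x^{(1/2)^m}(\log x)^{1/2-(1/2)^m}$ for $m\ge1$, and $$\kappa_m=\mu^{-2+(1/2)^m}\prod_{i=1}^{m-1}\big[(1/2)^{m-1-i}-(1/2)^{m-1}\big]^{(1/2)^{i+1}}.$$ For $m\ge 1$ let $\mathcal B_m^o$ be the set of $h:(0,\infty)\to(0,\infty)$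 with $h_m(x)=o(h(x))$ and $h(x)=o(h_{m-1}(x))$ as $x\to\infty$, and $\mathcal B_m^+$ the set of $h:(0,\infty)\to(0,\infty)$ for which $\lim_{x\to\infty}h(x)/h_m(x)$ exists in $(0,\infty)$. **Theorem.** Let $m\ge1$. (i) If $h\in\mathcal B_m^o$, then $R_h^*(a)\sim m\,h(a)$ as $a\to\infty$. Moreover, let $g\in\mathcal B_m^o$ satisfy $g\le h$ near $\infty$ and, if $m\ge 2$, let $g$ be measurable and nondecreasing near $\infty$. Then $\delta^o_{m,g}(a)$ is a multistage sampling rule for every $a>0$, and its risk satisfies $$R_h(\delta^o_{m,g}(a))\sim m\,h(a)\sim R_h^*(a)\qquad(a\to\infty).$$ In particular this holds for $\delta^o_{m,h}$ (take $g=h$) if $m=1$, or if $h$ is measurable and nondecreasing near $\infty$. For every $h\in\mathcal B_m^o$ there is a nondecreasing $g\in\mathcal B_m^o$ with $g\le h$ near $\infty$. (ii) If $h\in\mathcal B_m^+$, then there is exactly one $z^*\in\mathbb R$ with $$\frac{\phi(z^*)}{1-\Phi(z^*)}=\lim_{x\to\infty}\frac{\kappa_m h_m(x)}{h(x)},$$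 $\delta^+_{m,z^*}(a)$ is a multistage sampling rule for every $a>0$, and as $a\to\infty$ $$R_h(\delta^+_{m,z^*}(a))\sim\Big[m+\Phi(z^*)+\Delta(z^*)\frac{\phi(z^*)}{1-\Phi(z^*)}\Big]h(a)\sim R_h^*(a).$$ -/

import Mathlib

open Set Filter Topology MeasureTheory ProbabilityTheory Asymptotics
open scoped NNReal ENNReal

namespace MultistageSampling

noncomputable section

/-! ### Normal distribution, stage sizes, critical functions -/

/-- The standard normal distribution function. -/
def stdCdf (z : ℝ) : ℝ := cdf (gaussianReal 0 1) z

/-- The standard normal density. -/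
def stdPdf (z : ℝ) : ℝ := gaussianPDFReal 0 1 z

/-- `Δ(z) = ∫_z^∞ Φ(-x) dx`. -/
def Del (z : ℝ) : ℝ := ∫ x in Ioi z, stdCdf (-x)

/-- `t(x, z)`, the size of a stage that starts at distance `x > 0` from the boundary and ends
across it with probability `Φ(-z)`. For `x > 0` the real number under `toNNReal` is positive. -/
def stageSize (μ x z : ℝ) : ℝ≥0 :=
  (x / μ - (z * √(4 * x * μ + z ^ 2) - z ^ 2) / (2 * μ ^ 2)).toNNReal

/-- For `x > 0`, `t(x, z)` is the unique solution `t > 0` of `(x - μ t) / √t = z`. -/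
theorem stageSize_spec {μ x : ℝ} (hμ : 0 < μ) (hx : 0 < x) (z : ℝ) (t : ℝ≥0) (ht : 0 < t) :
    (x - μ * t) / √(t : ℝ) = z ↔ t = stageSize μ x z := by
  have hD : 0 ≤ 4 * x * μ + z ^ 2 := by positivity
  have hd := Real.sq_sqrt hD
  have hd0 := Real.sqrt_nonneg (4 * x * μ + z ^ 2)
  set d := √(4 * x * μ + z ^ 2) with hdd
  have hxm : 0 < x * μ := by positivity
  have hdz : z < d := by
    by_contra hc
    push Not at hc
    nlinarith
  have hdz' : -z < d := by
    by_contra hc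
    push Not at hc
    nlinarith
  have hsq : x / μ - (z * d - z ^ 2) / (2 * μ ^ 2) = ((d - z) / (2 * μ)) ^ 2 := by
    field_simp
    nlinarith
  have hval : (stageSize μ x z : ℝ) = ((d - z) / (2 * μ)) ^ 2 := by
    unfold stageSize
    rw [← hdd, hsq]
    exact Real.coe_toNNReal _ (sq_nonneg _)
  have ht' : (0 : ℝ) < t := by exact_mod_cast ht
  have hs := Real.sq_sqrt ht'.le
  have hs0 := Real.sqrt_pos.2 ht'
  set s := √(t : ℝ) with hss
  rw [div_eq_iff hs0.ne', ← NNReal.coe_inj, hval, ← hs]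
  constructor
  · intro h
    have h2 : (2 * μ * s + z) ^ 2 = d ^ 2 := by rw [hd]; nlinarith
    have h3 : 2 * μ * s + z = d := by
      rcases sq_eq_sq_iff_eq_or_eq_neg.1 h2 with h4 | h4
      · exact h4
      · exfalso
        have : 0 < μ * s := by positivity
        linarith
    have : s = (d - z) / (2 * μ) := by
      rw [eq_div_iff (by positivity)]; linarith
    rw [this]
  · intro h
    have h1 : 0 ≤ (d - z) / (2 * μ) := div_nonneg (by linarith) (by positivity)
    have h2 : s = (d - z) / (2 * μ) := (sq_eq_sq₀ hs0.le h1).1 h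
    rw [eq_div_iff (by positivity)] at h2
    have h3 : d = 2 * μ * s + z := by linarith
    rw [h3] at hd
    nlinarith

/-- The critical functions: `h_0(x) = x` and, for `m ≥ 1`,
`h_m(x) = x^((1/2)^m) (log x)^(1/2 - (1/2)^m)`. -/
def crit : ℕ → ℝ → ℝ
  | 0, x => x
  | m + 1, x => x ^ ((1 / 2 : ℝ) ^ (m + 1)) * Real.log x ^ (1 / 2 - (1 / 2 : ℝ) ^ (m + 1))

/-- `κ_m(μ) = μ^(-2 + (1/2)^m) ∏_{i=1}^{m-1} [(1/2)^(m-1-i) - (1/2)^(m-1)]^((1/2)^(i+1))`. -/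
def kap (μ : ℝ) (m : ℕ) : ℝ :=
  μ ^ (-2 + (1 / 2 : ℝ) ^ m) *
    ∏ i ∈ Finset.Icc 1 (m - 1),
      ((1 / 2 : ℝ) ^ (m - 1 - i) - (1 / 2 : ℝ) ^ (m - 1)) ^ ((1 / 2 : ℝ) ^ (i + 1))

/-- The `m`-th critical band: positive functions `h` on `(0, ∞)` (values elsewhere are
irrelevant) with `h_m ≪ h ≪ h_{m-1}` at infinity. -/
def bandO (m : ℕ) : Set (ℝ → ℝ) :=
  {h | (∀ x, 0 < x → 0 < h x) ∧ crit m =o[atTop] h ∧ h =o[atTop] crit (m - 1)}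

/-- The boundary between bands `m` and `m + 1`: positive functions `h` on `(0, ∞)` such that
`h / h_m` has a limit in `(0, ∞)`. -/
def bandPlus (m : ℕ) : Set (ℝ → ℝ) :=
  {h | (∀ x, 0 < x → 0 < h x) ∧ ∃ Q : ℝ, 0 < Q ∧ Tendsto (fun x => h x / crit m x) atTop (𝓝 Q)}

/-! ### Sampling rules and their risk -/

section Rules

variable {Ω : Type*}

/-- Brownian motion with drift `μ` and unit variance, driven by a standard Brownian motion `B`. -/
def drifted (μ : ℝ) (B : ℝ≥0 → Ω → ℝ) : ℝ≥0 → Ω → ℝ := fun t ω => B t ω + μ * t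

/-- The σ-algebra generated by `X s`, `s ≤ t`. -/
abbrev past (X : ℝ≥0 → Ω → ℝ) (t : ℝ≥0) : MeasurableSpace Ω :=
  ⨆ s ≤ t, MeasurableSpace.comap (X s) inferInstance

/-- `T^k`, the time at which the first `k` stages end; `T i` is the size of stage `i + 1`. -/
def endTime (T : ℕ → Ω → ℝ≥0) (k : ℕ) (ω : Ω) : ℝ≥0 := ∑ i ∈ Finset.range k, T i ω

/-- A multistage sampling rule: for every `k ≥ 0` and every `t`, the random variable
`T_{k+1} 1{T_1 + ... + T_k ≤ t}` is determined by `X s`, `s ≤ t`. -/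
def IsSamplingRule (X : ℝ≥0 → Ω → ℝ) (T : ℕ → Ω → ℝ≥0) : Prop :=
  ∀ (k : ℕ) (t : ℝ≥0), Measurable[past X t] (indicator {ω | endTime T k ω ≤ t} (T k))

/-- `M = inf {m ≥ 1 : X(T^m) ≥ a}`, with `inf ∅ = ∞`. -/
def numStages (X : ℝ≥0 → Ω → ℝ) (a : ℝ) (T : ℕ → Ω → ℝ≥0) (ω : Ω) : ℕ∞ :=
  ⨅ (m : ℕ) (_ : 1 ≤ m ∧ a ≤ X (endTime T m ω) ω), (m : ℕ∞)

open Classical in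
/-- The total sampling time `T^M`, the sum of the sizes of the first `M` stages. -/
def totalTime (X : ℝ≥0 → Ω → ℝ) (a : ℝ) (T : ℕ → Ω → ℝ≥0) (ω : Ω) : ℝ≥0∞ :=
  ∑' k : ℕ, if (k : ℕ∞) < numStages X a T ω then (T k ω : ℝ≥0∞) else 0

/-- The risk `E(T - a/μ) + c E M` of a rule at distance `a` from the boundary, `c` being the cost
per stage. The expectations are taken in `[0, ∞]`, so the risk is `∞` if one of them is. -/
def risk [MeasurableSpace Ω] (P : Measure Ω) (X : ℝ≥0 → Ω → ℝ) (μ c a : ℝ)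
    (T : ℕ → Ω → ℝ≥0) : EReal :=
  (((∫⁻ ω, totalTime X a T ω ∂P : ℝ≥0∞) : EReal) - ((a / μ : ℝ) : EReal)) +
    ((ENNReal.ofReal c * ∫⁻ ω, (numStages X a T ω : ℝ≥0∞) ∂P : ℝ≥0∞) : EReal)

/-- The optimal risk, the infimum of the risk over all multistage sampling rules. -/
def optRisk [MeasurableSpace Ω] (P : Measure Ω) (X : ℝ≥0 → Ω → ℝ) (μ c a : ℝ) : EReal :=
  ⨅ (T : ℕ → Ω → ℝ≥0) (_ : IsSamplingRule X T), risk P X μ c a T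

end Rules

/-! ### The samplers

A concrete sampler is given by its stage sizes as a function of the distance `a` to the boundary
and of the path `x` (started at `0`) that is being observed. All stages after the boundary has been
crossed have size `0`. -/

/-- The path observed after time `s`, restarted at `0`. -/
def shiftPath (x : ℝ≥0 → ℝ) (s : ℝ≥0) : ℝ≥0 → ℝ := fun u => x (s + u) - x s

/-- First stage of size `s`, followed (if necessary) by the sampler `next`, applied to the
remaining distance `a - X_1`. -/
def firstThen (s : ℝ≥0) (next : ℝ → (ℝ≥0 → ℝ) → ℕ → ℝ≥0) (a : ℝ) (x : ℝ≥0 → ℝ) (k : ℕ) : ℝ≥0 :=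
  if 0 < a then
    match k with
    | 0 => s
    | k + 1 => next (a - x s) (shiftPath x s) k
  else 0

/-- Geometric sampling: every stage has size `t(remaining distance, z)`, until the boundary is
crossed. The number `geoSampler μ z k a x` is the size of stage `k + 1`. -/
def geoSampler (μ z : ℝ) : ℕ → ℝ → (ℝ≥0 → ℝ) → ℝ≥0
  | 0, a, _ => if 0 < a then stageSize μ a z else 0
  | k + 1, a, x =>
    if 0 < a then
      geoSampler μ z k (a - x (stageSize μ a z)) (shiftPath x (stageSize μ a z))
    else 0

/-- `f(x) = (6 / √μ) √(x log (x + 1))`. -/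
def fFun (μ x : ℝ) : ℝ := 6 / √μ * √(x * Real.log (x + 1))

/-- The inverse of the increasing bijection `f` of `(0, ∞)`. -/
def fInv (μ : ℝ) : ℝ → ℝ := Function.invFunOn (fFun μ) (Ioi 0)

/-- `ζ(x) = -(√h(x) / x^(1/4) ∧ x^(1/7))`. -/
def zetaFun (h : ℝ → ℝ) (x : ℝ) : ℝ :=
  -(min (√(h x) / x ^ (1 / 4 : ℝ)) (x ^ (1 / 7 : ℝ)))

/-- The sampler `δ^o_{m,h}`, for `m ≥ 1` (with a dummy value at `m = 0`). -/
def samplerO (μ : ℝ) : ℕ → (ℝ → ℝ) → ℝ → (ℝ≥0 → ℝ) → ℕ → ℝ≥0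
  | 0, _ => fun _ _ _ => 0
  | 1, h => fun a x k => geoSampler μ (zetaFun h a) k a x
  | m + 2, h => fun a =>
      firstThen (stageSize μ a (√(Real.log (a / h a ^ 2 + 1))))
        (samplerO μ (m + 1) (h ∘ fInv μ)) a

/-- `ν(x) = -√(log (x + 1))`. -/
def nuFun (x : ℝ) : ℝ := -√(Real.log (x + 1))

/-- The sampler `δ^+_{m,z}`, for `m ≥ 1` (with a dummy value at `m = 0`). -/
def samplerPlus (μ : ℝ) : ℕ → ℝ → ℝ → (ℝ≥0 → ℝ) → ℕ → ℝ≥0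
  | 0, _ => fun _ _ _ => 0
  | 1, z => fun a =>
      firstThen (stageSize μ a z) (fun y x k => geoSampler μ (nuFun y) k y x) a
  | m + 2, z => fun a =>
      firstThen (stageSize μ a (√((1 - (1 / 2 : ℝ) ^ (m + 1)) * Real.log (a + 1))))
        (samplerPlus μ (m + 1) z) a

/-- The stage sizes obtained when a sampler `δ` is applied to the process `X` at distance `a`. -/
def applied {Ω : Type*} (δ : ℝ → (ℝ≥0 → ℝ) → ℕ → ℝ≥0) (a : ℝ) (X : ℝ≥0 → Ω → ℝ) :
    ℕ → Ω → ℝ≥0 :=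
  fun k ω => δ a (fun s => X s ω) k

end

end MultistageSampling

open MultistageSampling

/-! For a stage of length `t` begun at distance `x`, Wald's identity reads `E (x - X t)⁺ + μ t = x +
E (X t - x)⁺` (`kernelAt_ofReal_add`). Divided by `μ` and summed over the stages, it turns the
sampling time into `a / μ` plus the overshoot divided by `μ`. So the risk is the value of a Markov
decision problem in the remaining distance: each stage costs `c + overshoot / μ`, and the game goes
on at the new distance as long as that is positive. The strong Markov property
(`lintegral_strongMarkov`) justifies the reduction for arbitrary rules. A function that is below the
right side of the dynamic programming inequality for every `t` bounds all rules from below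
(`le_stageCost`); a function above it for the stages actually chosen bounds a given sampler from
above (`IsPolicy.stageCost_le`).

What remains is asymptotic analysis of one stage. A stage with crossing parameter `z` small compared
with `√x` has `√t ~ √(x / μ)`, overshoot `√t Δ(z)`, and fails to cross with probability `Φ(z)`. If
`c` is comparable with `√x`, then overshoot and the cost of a second stage compete: with `c = Q √x`
the total is about `c (1 + Φ(z) + κ_1 Δ(z) / Q)`, and this is least where the hazard rate of the
normal law equals `κ_1 / Q` (`stageValue_min`). If `c` is of the smaller order `h_{m+1}(x)`, a
parameter noticeably below `√((1 - 2^(-m)) log x)` produces an overshoot that is too expensive. With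
a parameter near that value the stage almost certainly stops short, at a distance close to `√((1 -
2^(-m)) x log x / μ)`. At that distance `h_m` is a constant times `h_{m+1}(x)` (`tendsto_crit_div`),
so one stage moves the problem down one level, and `kap_succ` shows that `κ_m` absorbs exactly this
constant.

The lower bound is an induction along this mechanism: `lowerFun_one` is the competition at level
one, and `lowerFun_succ` the dichotomy between overshooting and leaving a large distance. The upper
bound follows the same induction through `eventually_stageStep_le`, which shows that atypical
remaining distances contribute only `o(c)`. It ends with geometric sampling, controlled by the
explicit supersolution of `geoBound_super`. Inside a band the competition degenerates: the lower
bound is applied with `Φ(z)` near `1`, and the samplers use parameters that make every overshoot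
negligible against `c` while still needing only `m` stages with high probability. -/

namespace MultistageSampling

noncomputable section

/-! ### Random times, observable events and the strong Markov property. -/

section StrongMarkov

variable {Ω : Type*}

/-- The events observable at a random time `σ`. -/
@[reducible] def pastAt (X : ℝ≥0 → Ω → ℝ) (σ : Ω → ℝ≥0)
    (hσ : ∀ t, MeasurableSet[past X t] {ω | σ ω ≤ t}) : MeasurableSpace Ω where
  MeasurableSet' A := ∀ t, MeasurableSet[past X t] (A ∩ {ω | σ ω ≤ t})
  measurableSet_empty t := by simp
  measurableSet_compl A hA t := by
    have : Aᶜ ∩ {ω | σ ω ≤ t} = {ω | σ ω ≤ t} \ (A ∩ {ω | σ ω ≤ t}) := by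
      ext ω; simp only [mem_inter_iff, mem_compl_iff, Set.mem_sdiff]; tauto
    rw [this]
    exact (hσ t).diff (hA t)
  measurableSet_iUnion A hA t := by
    rw [iUnion_inter]
    exact MeasurableSet.iUnion fun i => hA i t

theorem past_mono (X : ℝ≥0 → Ω → ℝ) {s t : ℝ≥0} (h : s ≤ t) : past X s ≤ past X t :=
  biSup_mono fun _ hr => hr.trans h

theorem past_le [mΩ : MeasurableSpace Ω] {X : ℝ≥0 → Ω → ℝ} (hX : ∀ t, Measurable (X t))
    (t : ℝ≥0) : past X t ≤ mΩ :=
  iSup₂_le fun s _ => (hX s).comap_le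

theorem measurable_past (X : ℝ≥0 → Ω → ℝ) {s t : ℝ≥0} (h : s ≤ t) :
    Measurable[past X t] (X s) := by
  have : MeasurableSpace.comap (X s) inferInstance ≤ past X t :=
    le_iSup₂_of_le (f := fun s (_ : s ≤ t) => MeasurableSpace.comap (X s) inferInstance) s h le_rfl
  exact Measurable.mono (comap_measurable (X s)) this le_rfl

theorem measurable_pastAt_self {X : ℝ≥0 → Ω → ℝ} {σ : Ω → ℝ≥0}
    (hσ : ∀ t, MeasurableSet[past X t] {ω | σ ω ≤ t}) : Measurable[pastAt X σ hσ] σ := by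
  let _ := pastAt X σ hσ
  refine measurable_of_Iic fun s => ?_
  intro t
  have : σ ⁻¹' Iic s ∩ {ω | σ ω ≤ t} = {ω | σ ω ≤ min s t} := by
    ext ω; simp
  rw [this]
  exact past_mono X (min_le_right s t) _ (hσ _)

theorem pastAt_le [mΩ : MeasurableSpace Ω] {X : ℝ≥0 → Ω → ℝ} (hX : ∀ t, Measurable (X t))
    {σ : Ω → ℝ≥0} (hσ : ∀ t, MeasurableSet[past X t] {ω | σ ω ≤ t}) : pastAt X σ hσ ≤ mΩ := by
  intro A hA
  have : A = ⋃ n : ℕ, A ∩ {ω | σ ω ≤ n} := by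
    rw [← inter_iUnion]
    refine (inter_eq_left.2 fun ω _ => ?_).symm
    obtain ⟨n, hn⟩ := exists_nat_ge (σ ω)
    exact mem_iUnion.2 ⟨n, hn⟩
  rw [this]
  exact MeasurableSet.iUnion fun n => past_le hX _ _ (hA n)

theorem pastAt_mono {X : ℝ≥0 → Ω → ℝ} {σ τ : Ω → ℝ≥0} (h : σ ≤ τ)
    (hσ : ∀ t, MeasurableSet[past X t] {ω | σ ω ≤ t})
    (hτ : ∀ t, MeasurableSet[past X t] {ω | τ ω ≤ t}) : pastAt X σ hσ ≤ pastAt X τ hτ := by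
  intro A hA t
  have : A ∩ {ω | τ ω ≤ t} = (A ∩ {ω | σ ω ≤ t}) ∩ {ω | τ ω ≤ t} := by
    ext ω
    simp only [mem_inter_iff, mem_ofPred_eq]
    constructor
    · rintro ⟨h1, h2⟩; exact ⟨⟨h1, (h ω).trans h2⟩, h2⟩
    · rintro ⟨⟨h1, _⟩, h2⟩; exact ⟨h1, h2⟩
  rw [this]
  exact (hA t).inter (hτ t)

/-- A function is observable at `σ` iff its restrictions to `σ ≤ t` are observable at `t`. -/
theorem measurable_pastAt_of_indicator {E : Type*} [MeasurableSpace E] [Zero E]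
    {X : ℝ≥0 → Ω → ℝ} {σ : Ω → ℝ≥0}
    (hσ : ∀ t, MeasurableSet[past X t] {ω | σ ω ≤ t}) {V : Ω → E}
    (hV : ∀ t, Measurable[past X t] (indicator {ω | σ ω ≤ t} V)) :
    Measurable[pastAt X σ hσ] V := by
  intro S hS t
  have : V ⁻¹' S ∩ {ω | σ ω ≤ t} = (indicator {ω | σ ω ≤ t} V) ⁻¹' S ∩ {ω | σ ω ≤ t} := by
    ext ω
    simp only [mem_inter_iff, mem_preimage, mem_ofPred_eq, and_congr_left_iff]
    intro h
    rw [indicator_of_mem (show ω ∈ {ω | σ ω ≤ t} from h)]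
  rw [this]
  exact (hV t hS).inter (hσ t)

theorem indicator_measurable_of_pastAt {E : Type*} [MeasurableSpace E] [Zero E]
    {X : ℝ≥0 → Ω → ℝ} {σ : Ω → ℝ≥0}
    (hσ : ∀ t, MeasurableSet[past X t] {ω | σ ω ≤ t}) {V : Ω → E}
    (hV : Measurable[pastAt X σ hσ] V) (t : ℝ≥0) :
    Measurable[past X t] (indicator {ω | σ ω ≤ t} V) := by
  classical
  let _ := past X t
  intro S hS
  rw [indicator_preimage, Set.ite]
  refine MeasurableSet.union (hV hS t) (MeasurableSet.diff ?_ (hσ t))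
  by_cases h0 : (0 : E) ∈ S
  · have : (fun _ : Ω => (0 : E)) ⁻¹' S = univ := by ext; simp [h0]
    exact this ▸ MeasurableSet.univ
  · have : (fun _ : Ω => (0 : E)) ⁻¹' S = ∅ := by ext; simp [h0]
    exact this ▸ MeasurableSet.empty

theorem measurable_past_min {X : ℝ≥0 → Ω → ℝ} {σ : Ω → ℝ≥0}
    (hσ : ∀ t, MeasurableSet[past X t] {ω | σ ω ≤ t}) (t : ℝ≥0) :
    Measurable[past X t] (fun ω => min (σ ω) t) := by
  let _ := past X t
  refine measurable_of_Iic fun s => ?_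
  by_cases h : t ≤ s
  · have : (fun ω => min (σ ω) t) ⁻¹' Iic s = univ := by ext; simp [h]
    rw [this]; exact MeasurableSet.univ
  · have : (fun ω => min (σ ω) t) ⁻¹' Iic s = {ω | σ ω ≤ s} := by ext; simp [h]
    rw [this]; exact past_mono X (not_le.1 h).le _ (hσ s)

/-- The value of a continuous process at a stopping time is observable at that time. -/
theorem measurable_pastAt_eval {X : ℝ≥0 → Ω → ℝ} (hc : ∀ ω, Continuous fun t => X t ω)
    {σ : Ω → ℝ≥0} (hσ : ∀ t, MeasurableSet[past X t] {ω | σ ω ≤ t}) :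
    Measurable[pastAt X σ hσ] (fun ω => X (σ ω) ω) := by
  intro S hS t
  -- On `σ ≤ t` the time may be capped at `t`; the capped process is jointly measurable with respect
  -- to the past at `t`, by path continuity.
  have h1 : Measurable[past X t] (fun ω => X (min (σ ω) t) ω) := by
    let _ := past X t
    have h2 : Measurable (fun p : ℝ≥0 × Ω => X (min p.1 t) p.2) := by
      have := measurable_uncurry_of_continuous_of_measurable (u := fun s ω => X (min s t) ω)
        (fun ω => (hc ω).comp (continuous_id.min continuous_const))
        (fun s => measurable_past X (min_le_right s t))
      exact this
    have h3 := h2.comp ((measurable_past_min hσ t).prodMk measurable_id)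
    simpa [Function.comp_def] using h3
  have : (fun ω => X (σ ω) ω) ⁻¹' S ∩ {ω | σ ω ≤ t}
      = (fun ω => X (min (σ ω) t) ω) ⁻¹' S ∩ {ω | σ ω ≤ t} := by
    ext ω
    simp only [mem_inter_iff, mem_preimage, mem_ofPred_eq, and_congr_left_iff]
    intro h
    rw [min_eq_left h]
  rw [this]
  exact (h1 hS).inter (hσ t)

theorem stopping_add {X : ℝ≥0 → Ω → ℝ} {σ τ : Ω → ℝ≥0}
    (hσ : ∀ t, MeasurableSet[past X t] {ω | σ ω ≤ t}) (hτ : Measurable[pastAt X σ hσ] τ) (t : ℝ≥0) :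
    MeasurableSet[past X t] {ω | σ ω + τ ω ≤ t} := by
  have h1 : Measurable[pastAt X σ hσ] (fun ω => σ ω + τ ω) :=
    Measurable.add (measurable_pastAt_self hσ) hτ
  have h2 := h1 (measurableSet_Iic (a := t)) t
  convert h2 using 1
  ext ω
  simp only [mem_ofPred_eq, mem_inter_iff, mem_preimage, mem_Iic]
  exact ⟨fun h => ⟨h, le_self_add.trans h⟩, fun h => h.1⟩

/-- `s` rounded up to a multiple of `1 / (n + 1)`. -/
def roundUp (n : ℕ) (s : ℝ≥0) : ℝ≥0 := (⌈s * (n + 1)⌉₊ : ℝ≥0) / (n + 1)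

theorem tendsto_roundUp (s : ℝ≥0) : Tendsto (fun n => roundUp n s) atTop (𝓝 s) := by
  have h1 : Tendsto (fun n : ℕ => s + 1 / ((n : ℝ≥0) + 1)) atTop (𝓝 s) := by
    simpa using tendsto_const_nhds.add (tendsto_one_div_add_atTop_nhds_zero_nat (𝕜 := ℝ≥0))
  refine tendsto_of_tendsto_of_tendsto_of_le_of_le tendsto_const_nhds h1 (fun n => ?_) fun n => ?_
  · simp only [roundUp]
    rw [le_div_iff₀ (by positivity)]
    exact Nat.le_ceil _
  · simp only [roundUp]
    rw [div_le_iff₀ (by positivity), add_mul, one_div, inv_mul_cancel₀ (by positivity)]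
    exact (Nat.ceil_lt_add_one (by positivity)).le

theorem measurable_roundUp (n : ℕ) : Measurable (roundUp n) := by
  unfold roundUp
  fun_prop

theorem past_drifted_le (μ : ℝ) (B : ℝ≥0 → Ω → ℝ) (t : ℝ≥0) :
    past (drifted μ B) t ≤
      MeasurableSpace.comap (fun ω (s : Set.Iic t) => B s ω) inferInstance := by
  refine iSup₂_le fun s hs => ?_
  rw [← measurable_iff_comap_le]
  have h1 : Measurable[MeasurableSpace.comap (fun ω (s : Set.Iic t) => B s ω) inferInstance]
      (fun ω (s : Set.Iic t) => B s ω) := comap_measurable _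
  have h2 := (measurable_pi_apply (⟨s, hs⟩ : Set.Iic t)).comp h1
  exact h2.add_const (μ * s)

variable [MeasurableSpace Ω] {P : Measure Ω} {B : ℝ≥0 → Ω → ℝ}

/-- At a deterministic time the increment is independent of the past. Its law is written as that of
`√u` times a standard normal variable, so that `u` can later be random and pass to limits inside the
integrand. -/
theorem lintegral_increment (hB : IsPreBrownianReal B P) (hmeas : ∀ t, Measurable (B t)) (μ : ℝ)
    {s : ℝ≥0} {A : Set Ω} (hA : MeasurableSet[past (drifted μ B) s] A) (u : ℝ≥0)
    {g : ℝ → ℝ≥0∞} (hg : Measurable g) :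
    ∫⁻ ω in A, g (B (s + u) ω - B s ω) ∂P
      = ∫⁻ _ in A, ∫⁻ y, g (√(u : ℝ) * y) ∂(gaussianReal 0 1) ∂P := by
  have hX : ∀ t, Measurable (drifted μ B t) := fun t => (hmeas t).add_const _
  have hA' := past_le hX s _ hA
  have hind := hB.indepFun_shift s
  have hY : Measurable (fun ω => B (s + u) ω - B s ω) := (hmeas _).sub (hmeas _)
  have hind2 : Indep (past (drifted μ B) s)
      (MeasurableSpace.comap (fun ω => B (s + u) ω - B s ω) inferInstance) P := by
    have h1 := (hind.comp (measurable_pi_apply u) measurable_id).symm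
    exact indep_of_indep_of_le_left h1 (past_drifted_le μ B s)
  have hlaw : HasLaw (fun ω => B (s + u) ω - B s ω) (gaussianReal 0 u) P :=
    (hB.shift s).hasLaw_eval u
  have h1 : ∫⁻ ω, A.indicator (fun _ => (1 : ℝ≥0∞)) ω * g (B (s + u) ω - B s ω) ∂P
      = (∫⁻ ω, A.indicator (fun _ => (1 : ℝ≥0∞)) ω ∂P) * ∫⁻ ω, g (B (s + u) ω - B s ω) ∂P := by
    refine lintegral_mul_eq_lintegral_mul_lintegral_of_independent_measurableSpace
      (past_le hX s) hY.comap_le hind2 (measurable_const.indicator hA) ?_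
    exact hg.comp (comap_measurable _)
  have h2 : ∫⁻ ω, g (B (s + u) ω - B s ω) ∂P = ∫⁻ y, g (√(u : ℝ) * y) ∂(gaussianReal 0 1) := by
    have h3 : ∫⁻ ω, g (B (s + u) ω - B s ω) ∂P = ∫⁻ y, g y ∂(gaussianReal 0 u) := by
      rw [← hlaw.map_eq, lintegral_map hg hY]
    have h4 : gaussianReal 0 u = (gaussianReal 0 1).map (fun y => √(u : ℝ) * y) := by
      rw [gaussianReal_map_const_mul]
      congr 1
      · simp
      · ext; simp [Real.sq_sqrt]
    rw [h3, h4, lintegral_map hg (by fun_prop)]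
  rw [lintegral_const, Measure.restrict_apply_univ, mul_comm, ← h2]
  have h5 : (∫⁻ ω, A.indicator (fun _ => (1 : ℝ≥0∞)) ω ∂P) = P A := by
    rw [lintegral_indicator hA']; simp
  rw [← h5, ← h1, ← lintegral_indicator hA']
  refine lintegral_congr fun ω => ?_
  by_cases h : ω ∈ A <;> simp [h]

/-- After rounding, the two times take countably many values. On each piece both are deterministic,
and `lintegral_increment` applies. -/
theorem lintegral_increment_roundUp (hB : IsPreBrownianReal B P) (hmeas : ∀ t, Measurable (B t))
    (μ : ℝ) {σ τ : Ω → ℝ≥0} (hσ : ∀ t, MeasurableSet[past (drifted μ B) t] {ω | σ ω ≤ t})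
    (hτ : Measurable[pastAt (drifted μ B) σ hσ] τ) {A : Set Ω}
    (hA : MeasurableSet[pastAt (drifted μ B) σ hσ] A) (n : ℕ) {g : ℝ → ℝ≥0∞} (hg : Measurable g) :
    ∫⁻ ω in A, g (B (roundUp n (σ ω) + roundUp n (τ ω)) ω - B (roundUp n (σ ω)) ω) ∂P
      = ∫⁻ ω in A, ∫⁻ y, g (√(roundUp n (τ ω) : ℝ) * y) ∂(gaussianReal 0 1) ∂P := by
  have hX : ∀ t, Measurable (drifted μ B t) := fun t => (hmeas t).add_const _
  let S : ℕ × ℕ → Set Ω := fun p =>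
    A ∩ ((fun ω => ⌈σ ω * (n + 1)⌉₊) ⁻¹' {p.1} ∩ (fun ω => ⌈τ ω * (n + 1)⌉₊) ⁻¹' {p.2})
  have hceil : Measurable (fun s : ℝ≥0 => ⌈s * (n + 1)⌉₊) := by fun_prop
  have hSm : ∀ p, MeasurableSet[pastAt (drifted μ B) σ hσ] (S p) := fun p =>
    hA.inter (((hceil.comp (measurable_pastAt_self hσ)) (measurableSet_singleton _)).inter
      ((hceil.comp hτ) (measurableSet_singleton _)))
  have hSm' : ∀ p, MeasurableSet (S p) := fun p => pastAt_le hX hσ _ (hSm p)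
  have hdisj : Pairwise (Function.onFun Disjoint S) := by
    intro p q hpq
    refine Set.disjoint_left.2 fun ω h1 h2 => hpq ?_
    obtain ⟨_, h1a, h1b⟩ := h1
    obtain ⟨_, h2a, h2b⟩ := h2
    simp only [mem_preimage, mem_singleton_iff] at h1a h1b h2a h2b
    exact Prod.ext (h1a.symm.trans h2a) (h1b.symm.trans h2b)
  have hU : A = ⋃ p, S p := by
    ext ω
    simp [S]
  rw [hU, lintegral_iUnion hSm' hdisj, lintegral_iUnion hSm' hdisj]
  congr 1
  ext p
  -- Rounding up, and not down, is essential here: on `S p` the time `σ` has already occurred by the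
  -- lattice time.
  have hmem : MeasurableSet[past (drifted μ B) ((p.1 : ℝ≥0) / (n + 1))] (S p) := by
    have h1 := hSm p ((p.1 : ℝ≥0) / (n + 1))
    rwa [inter_eq_left.2] at h1
    intro ω hω
    have : ⌈σ ω * (n + 1)⌉₊ = p.1 := hω.2.1
    simp only [mem_ofPred_eq]
    rw [le_div_iff₀ (by positivity), ← this]
    exact Nat.le_ceil _
  have hr : ∀ ω ∈ S p, roundUp n (σ ω) = (p.1 : ℝ≥0) / (n + 1) ∧
      roundUp n (τ ω) = (p.2 : ℝ≥0) / (n + 1) := by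
    intro ω hω
    have h1 : ⌈σ ω * (n + 1)⌉₊ = p.1 := hω.2.1
    have h2 : ⌈τ ω * (n + 1)⌉₊ = p.2 := hω.2.2
    exact ⟨by rw [roundUp, h1], by rw [roundUp, h2]⟩
  have e1 : ∫⁻ ω in S p, g (B (roundUp n (σ ω) + roundUp n (τ ω)) ω - B (roundUp n (σ ω)) ω) ∂P
      = ∫⁻ ω in S p, g (B ((p.1 : ℝ≥0) / (n + 1) + (p.2 : ℝ≥0) / (n + 1)) ω
          - B ((p.1 : ℝ≥0) / (n + 1)) ω) ∂P :=
    setLIntegral_congr_fun (hSm' p) fun ω hω => by simp only [(hr ω hω).1, (hr ω hω).2]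
  have e2 : ∫⁻ ω in S p, ∫⁻ y, g (√(roundUp n (τ ω) : ℝ) * y) ∂(gaussianReal 0 1) ∂P
      = ∫⁻ _ in S p, ∫⁻ y, g (√(((p.2 : ℝ≥0) / (n + 1) : ℝ≥0) : ℝ) * y) ∂(gaussianReal 0 1) ∂P :=
    setLIntegral_congr_fun (hSm' p) fun ω hω => by simp only [(hr ω hω).2]
  rw [e1, e2]
  exact lintegral_increment hB hmeas μ hmem _ hg

/-- The lattice identity passes to the limit by dominated convergence on both sides, since `g` is
bounded and continuous and so are the paths. -/
theorem lintegral_increment_cont (hB : IsPreBrownianReal B P) (hmeas : ∀ t, Measurable (B t))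
    (hcont : ∀ ω, Continuous fun t => B t ω)
    (μ : ℝ) {σ τ : Ω → ℝ≥0} (hσ : ∀ t, MeasurableSet[past (drifted μ B) t] {ω | σ ω ≤ t})
    (hτ : Measurable[pastAt (drifted μ B) σ hσ] τ) {A : Set Ω}
    (hA : MeasurableSet[pastAt (drifted μ B) σ hσ] A) (g : BoundedContinuousFunction ℝ ℝ≥0) :
    ∫⁻ ω in A, g (B (σ ω + τ ω) ω - B (σ ω) ω) ∂P
      = ∫⁻ ω in A, ∫⁻ y, g (√(τ ω : ℝ) * y) ∂(gaussianReal 0 1) ∂P := by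
  have hP : IsProbabilityMeasure P := hB.isGaussianProcess.isProbabilityMeasure
  have hX : ∀ t, Measurable (drifted μ B t) := fun t => (hmeas t).add_const _
  have hσm : Measurable σ := (measurable_pastAt_self hσ).mono (pastAt_le hX hσ) le_rfl
  have hτm : Measurable τ := hτ.mono (pastAt_le hX hσ) le_rfl
  have hgm : Measurable (fun y => (g y : ℝ≥0∞)) :=
    (ENNReal.continuous_coe.comp g.continuous).measurable
  obtain ⟨K, hK⟩ : ∃ K : ℝ≥0, ∀ y, g y ≤ K := ⟨_, fun y => BoundedContinuousFunction.NNReal.upper_bound g y⟩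
  have hBm : Measurable (fun p : ℝ≥0 × Ω => B p.1 p.2) :=
    measurable_uncurry_of_continuous_of_measurable (u := B) hcont hmeas
  have hBρ : ∀ ρ : Ω → ℝ≥0, Measurable ρ → Measurable fun ω => B (ρ ω) ω := fun ρ hρ =>
    hBm.comp (hρ.prodMk measurable_id)
  have key := fun n => lintegral_increment_roundUp hB hmeas μ hσ hτ hA n hgm
  have hL : Tendsto (fun n => ∫⁻ ω in A,
      g (B (roundUp n (σ ω) + roundUp n (τ ω)) ω - B (roundUp n (σ ω)) ω) ∂P) atTop
      (𝓝 (∫⁻ ω in A, g (B (σ ω + τ ω) ω - B (σ ω) ω) ∂P)) := by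
    refine tendsto_lintegral_of_dominated_convergence (fun _ => (K : ℝ≥0∞)) (fun n => ?_)
      (fun n => ae_of_all _ fun ω => ENNReal.coe_le_coe.2 (hK _)) ?_ (ae_of_all _ fun ω => ?_)
    · have h1 := (measurable_roundUp n).comp hσm
      have h2 := (measurable_roundUp n).comp hτm
      exact hgm.comp ((hBρ _ (h1.add h2)).sub (hBρ _ h1))
    · simp [ENNReal.mul_eq_top]
    · have h1 := tendsto_roundUp (σ ω)
      have h2 := tendsto_roundUp (τ ω)
      have h3 := ((hcont ω).tendsto _).comp (h1.add h2)
      have h4 := ((hcont ω).tendsto _).comp h1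
      exact ((ENNReal.continuous_coe.comp g.continuous).tendsto _).comp (h3.sub h4)
  have hR : Tendsto (fun n => ∫⁻ ω in A,
      ∫⁻ y, g (√(roundUp n (τ ω) : ℝ) * y) ∂(gaussianReal 0 1) ∂P) atTop
      (𝓝 (∫⁻ ω in A, ∫⁻ y, g (√(τ ω : ℝ) * y) ∂(gaussianReal 0 1) ∂P)) := by
    refine tendsto_lintegral_of_dominated_convergence (fun _ => (K : ℝ≥0∞)) (fun n => ?_)
      (fun n => ae_of_all _ fun ω => ?_) ?_ (ae_of_all _ fun ω => ?_)
    · have h2 := (measurable_roundUp n).comp hτm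
      have : Measurable (fun p : Ω × ℝ => (g (√(roundUp n (τ p.1) : ℝ) * p.2) : ℝ≥0∞)) := by
        refine hgm.comp (Measurable.mul ?_ measurable_snd)
        exact Real.continuous_sqrt.measurable.comp
          (measurable_coe_nnreal_real.comp (h2.comp measurable_fst))
      exact this.lintegral_prod_right'
    · refine (lintegral_mono (g := fun _ => (K : ℝ≥0∞)) fun y => ENNReal.coe_le_coe.2 (hK _)).trans ?_
      simp
    · simp [ENNReal.mul_eq_top]
    · refine tendsto_lintegral_of_dominated_convergence (fun _ => (K : ℝ≥0∞)) (fun n => ?_)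
        (fun n => ae_of_all _ fun y => ENNReal.coe_le_coe.2 (hK _)) (by simp) (ae_of_all _ fun y => ?_)
      · exact hgm.comp (measurable_const.mul measurable_id)
      · have h1 : Tendsto (fun n => √(roundUp n (τ ω) : ℝ) * y) atTop (𝓝 (√(τ ω : ℝ) * y)) :=
          (((Real.continuous_sqrt.comp NNReal.continuous_coe).tendsto _).comp
            (tendsto_roundUp (τ ω))).mul_const y
        exact ((ENNReal.continuous_coe.comp g.continuous).tendsto _).comp h1
  exact tendsto_nhds_unique hL (by simpa only [key] using hR)

/-- The strong Markov property of Brownian motion, for one increment. -/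
theorem lintegral_strongMarkov (hB : IsPreBrownianReal B P) (hmeas : ∀ t, Measurable (B t))
    (hcont : ∀ ω, Continuous fun t => B t ω)
    (μ : ℝ) {σ : Ω → ℝ≥0} (hσ : ∀ t, MeasurableSet[past (drifted μ B) t] {ω | σ ω ≤ t})
    {E : Type*} [MeasurableSpace E] {V : Ω → E} (hV : Measurable[pastAt (drifted μ B) σ hσ] V)
    {τ : E → ℝ≥0} (hτ : Measurable τ) {ψ : E × ℝ → ℝ≥0∞} (hψ : Measurable ψ) :
    ∫⁻ ω, ψ (V ω, B (σ ω + τ (V ω)) ω - B (σ ω) ω) ∂P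
      = ∫⁻ ω, ∫⁻ y, ψ (V ω, √(τ (V ω) : ℝ) * y) ∂(gaussianReal 0 1) ∂P := by
  have hP : IsProbabilityMeasure P := hB.isGaussianProcess.isProbabilityMeasure
  have hX : ∀ t, Measurable (drifted μ B t) := fun t => (hmeas t).add_const _
  have hσm : Measurable σ := (measurable_pastAt_self hσ).mono (pastAt_le hX hσ) le_rfl
  have hVm : Measurable V := hV.mono (pastAt_le hX hσ) le_rfl
  have hBm : Measurable (fun p : ℝ≥0 × Ω => B p.1 p.2) :=
    measurable_uncurry_of_continuous_of_measurable (u := B) hcont hmeas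
  have hBρ : ∀ ρ : Ω → ℝ≥0, Measurable ρ → Measurable fun ω => B (ρ ω) ω := fun ρ hρ =>
    hBm.comp (hρ.prodMk measurable_id)
  have hΔ : Measurable (fun ω => B (σ ω + τ (V ω)) ω - B (σ ω) ω) :=
    (hBρ _ (hσm.add (hτ.comp hVm))).sub (hBρ _ hσm)
  have hsc : Measurable (fun p : Ω × ℝ => √(τ (V p.1) : ℝ) * p.2) :=
    (Real.continuous_sqrt.measurable.comp
      (measurable_coe_nnreal_real.comp ((hτ.comp hVm).comp measurable_fst))).mul measurable_snd
  have hm1 : Measurable (fun ω => (V ω, B (σ ω + τ (V ω)) ω - B (σ ω) ω)) := hVm.prodMk hΔ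
  have hm2 : Measurable (fun p : Ω × ℝ => (V p.1, √(τ (V p.1) : ℝ) * p.2)) :=
    (hVm.comp measurable_fst).prodMk hsc
  -- It suffices to compare the two joint laws on rectangles `C ×ˢ S`: the first side is absorbed
  -- into the conditioning event `V ⁻¹' C`, and the second is handled by testing finite measures
  -- against bounded continuous functions.
  have hmain : P.map (fun ω => (V ω, B (σ ω + τ (V ω)) ω - B (σ ω) ω))
      = (P.prod (gaussianReal 0 1)).map (fun p : Ω × ℝ => (V p.1, √(τ (V p.1) : ℝ) * p.2)) := by
    have : IsFiniteMeasure (P.map (fun ω => (V ω, B (σ ω + τ (V ω)) ω - B (σ ω) ω))) :=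
      Measure.isFiniteMeasure_map _ _
    refine Measure.ext_prod fun {C S} hC hS => ?_
    have hA : MeasurableSet[pastAt (drifted μ B) σ hσ] (V ⁻¹' C) := hV hC
    have hA' : MeasurableSet (V ⁻¹' C) := hVm hC
    have h1 : (P.restrict (V ⁻¹' C)).map (fun ω => B (σ ω + τ (V ω)) ω - B (σ ω) ω)
        = ((P.restrict (V ⁻¹' C)).prod (gaussianReal 0 1)).map
          (fun p : Ω × ℝ => √(τ (V p.1) : ℝ) * p.2) := by
      have : IsFiniteMeasure ((P.restrict (V ⁻¹' C)).map
        (fun ω => B (σ ω + τ (V ω)) ω - B (σ ω) ω)) := Measure.isFiniteMeasure_map _ _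
      have : IsFiniteMeasure (((P.restrict (V ⁻¹' C)).prod (gaussianReal 0 1)).map
          (fun p : Ω × ℝ => √(τ (V p.1) : ℝ) * p.2)) := Measure.isFiniteMeasure_map _ _
      refine ext_of_forall_lintegral_eq_of_IsFiniteMeasure fun g => ?_
      have hgm : Measurable (fun y => (g y : ℝ≥0∞)) :=
        (ENNReal.continuous_coe.comp g.continuous).measurable
      have hpr := lintegral_prod (μ := P.restrict (V ⁻¹' C)) (ν := gaussianReal 0 1) _
        (hgm.comp hsc).aemeasurable
      simp only [Function.comp_apply] at hpr
      rw [lintegral_map hgm hΔ, lintegral_map hgm hsc, hpr]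
      exact lintegral_increment_cont hB hmeas hcont μ hσ (hτ.comp hV) hA g
    have h2 := congrArg (fun m => m S) h1
    simp only [Measure.map_apply hΔ hS, Measure.map_apply hsc hS] at h2
    rw [Measure.map_apply hm1 (hC.prod hS), Measure.map_apply hm2 (hC.prod hS)]
    rw [Measure.restrict_apply (hΔ hS)] at h2
    have h3 : (P.restrict (V ⁻¹' C)).prod (gaussianReal 0 1)
        = (P.prod (gaussianReal 0 1)).restrict ((V ⁻¹' C) ×ˢ univ) := by
      rw [← Measure.prod_restrict, Measure.restrict_univ]
    rw [h3, Measure.restrict_apply (hsc hS)] at h2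
    convert h2 using 2
    · ext ω; simp [and_comm]
    · ext p; simp [and_comm]
  calc ∫⁻ ω, ψ (V ω, B (σ ω + τ (V ω)) ω - B (σ ω) ω) ∂P
      = ∫⁻ q, ψ q ∂(P.map (fun ω => (V ω, B (σ ω + τ (V ω)) ω - B (σ ω) ω))) :=
        (lintegral_map hψ hm1).symm
    _ = _ := by
        have hpr := lintegral_prod (μ := P) (ν := gaussianReal 0 1) _ (hψ.comp hm2).aemeasurable
        simp only [Function.comp_apply] at hpr
        rw [hmain, lintegral_map hψ hm2, hpr]

end StrongMarkov


/-! ### The chain of distances to the boundary, and the risk as a sum over stages. -/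

section Chain

variable {Ω : Type*}

/-- The distance to the boundary after `k` stages. -/
def distAt (X : ℝ≥0 → Ω → ℝ) (a : ℝ) (T : ℕ → Ω → ℝ≥0) (k : ℕ) (ω : Ω) : ℝ :=
  a - X (endTime T k ω) ω

/-- The event that the boundary has not been crossed in the first `k` stages. -/
def alive (X : ℝ≥0 → Ω → ℝ) (a : ℝ) (T : ℕ → Ω → ℝ≥0) (k : ℕ) : Set Ω :=
  {ω | ∀ j ≤ k, 0 < distAt X a T j ω}

theorem alive_succ (X : ℝ≥0 → Ω → ℝ) (a : ℝ) (T : ℕ → Ω → ℝ≥0) (k : ℕ) :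
    alive X a T (k + 1) = alive X a T k ∩ {ω | 0 < distAt X a T (k + 1) ω} := by
  ext ω
  simp only [alive, mem_ofPred_eq, mem_inter_iff]
  refine ⟨fun h => ⟨fun j hj => h j (by omega), h _ le_rfl⟩, fun h j hj => ?_⟩
  rcases Nat.lt_or_ge j (k + 1) with h1 | h1
  · exact h.1 j (by omega)
  · rw [show j = k + 1 by omega]; exact h.2

theorem endTime_succ (T : ℕ → Ω → ℝ≥0) (k : ℕ) (ω : Ω) :
    endTime T (k + 1) ω = endTime T k ω + T k ω := Finset.sum_range_succ _ _

theorem endTime_mono (T : ℕ → Ω → ℝ≥0) {j k : ℕ} (h : j ≤ k) : endTime T j ≤ endTime T k :=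
  fun _ => Finset.sum_le_sum_of_subset (by simpa using h)

section Rule

variable {X : ℝ≥0 → Ω → ℝ} {T : ℕ → Ω → ℝ≥0}

theorem IsSamplingRule.stopping (hT : IsSamplingRule X T) (k : ℕ) (t : ℝ≥0) :
    MeasurableSet[past X t] {ω | endTime T k ω ≤ t} := by
  induction k generalizing t with
  | zero =>
    have : {ω | endTime T 0 ω ≤ t} = univ := by ext; simp [endTime]
    rw [this]; exact MeasurableSet.univ
  | succ k ih =>
    simp_rw [endTime_succ]
    exact stopping_add ih (measurable_pastAt_of_indicator ih (hT k)) t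

/-- The events observable when `k` stages have been completed. -/
abbrev IsSamplingRule.known (hT : IsSamplingRule X T) (k : ℕ) : MeasurableSpace Ω :=
  pastAt X (endTime T k) (hT.stopping k)

theorem IsSamplingRule.measurable_stage (hT : IsSamplingRule X T) (k : ℕ) :
    Measurable[hT.known k] (T k) :=
  measurable_pastAt_of_indicator (hT.stopping k) (hT k)

theorem IsSamplingRule.known_mono (hT : IsSamplingRule X T) {j k : ℕ} (h : j ≤ k) :
    hT.known j ≤ hT.known k :=
  pastAt_mono (endTime_mono T h) _ _

theorem IsSamplingRule.measurable_distAt (hT : IsSamplingRule X T)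
    (hc : ∀ ω, Continuous fun t => X t ω) (a : ℝ) {j k : ℕ} (h : j ≤ k) :
    Measurable[hT.known k] (distAt X a T j) :=
  ((measurable_pastAt_eval hc (hT.stopping j)).const_sub a).mono (hT.known_mono h) le_rfl

theorem IsSamplingRule.measurableSet_alive (hT : IsSamplingRule X T)
    (hc : ∀ ω, Continuous fun t => X t ω) (a : ℝ) (k : ℕ) :
    MeasurableSet[hT.known k] (alive X a T k) := by
  have : alive X a T k = ⋂ j : ℕ, ⋂ _ : j ≤ k, distAt X a T j ⁻¹' Ioi 0 := by
    ext; simp [alive]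
  rw [this]
  let _ := hT.known k
  exact MeasurableSet.iInter fun j => MeasurableSet.iInter fun h =>
    hT.measurable_distAt hc a h measurableSet_Ioi

end Rule

theorem continuous_drifted {B : ℝ≥0 → Ω → ℝ} (hcont : ∀ ω, Continuous fun t => B t ω) (μ : ℝ)
    (ω : Ω) : Continuous fun t => drifted μ B t ω :=
  (hcont ω).add (continuous_const.mul NNReal.continuous_coe)

/-- The infimum in `numStages` starts at `1`, while `alive` also asks for `j = 0`; the two agree
because the process starts at `0 < a`. -/
theorem lt_numStages {X : ℝ≥0 → Ω → ℝ} {a : ℝ} (ha : 0 < a) (h0 : ∀ ω, X 0 ω = 0)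
    (T : ℕ → Ω → ℝ≥0) (k : ℕ) (ω : Ω) :
    (k : ℕ∞) < numStages X a T ω ↔ ω ∈ alive X a T k := by
  rw [← ENat.add_one_le_iff (ENat.natCast_ne_top k), numStages]
  simp only [le_iInf_iff, alive, mem_ofPred_eq, distAt, sub_pos]
  constructor
  · intro h j hj
    rcases Nat.eq_zero_or_pos j with rfl | hj0
    · simpa [endTime, h0] using ha
    · by_contra hc
      have := h j ⟨hj0, not_lt.1 hc⟩
      norm_cast at this
      omega
  · rintro h j ⟨_, hj⟩
    by_contra hc
    have h1 : j ≤ k := by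
      by_contra h2
      exact hc (by norm_cast; omega)
    exact absurd (h j h1) (not_lt.2 hj)

theorem coe_eq_tsum (n : ℕ∞) [∀ k : ℕ, Decidable ((k : ℕ∞) < n)] :
    (n : ℝ≥0∞) = ∑' k : ℕ, if (k : ℕ∞) < n then 1 else 0 := by
  cases n with
  | top => simp
  | coe n =>
    rw [tsum_eq_sum (s := Finset.range n) (fun k hk => by simpa using hk)]
    rw [Finset.sum_congr rfl (g := fun _ => 1) (fun k hk => by simpa using hk)]
    simp

theorem alive_zero {X : ℝ≥0 → Ω → ℝ} {a : ℝ} (ha : 0 < a) (h0 : ∀ ω, X 0 ω = 0)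
    (T : ℕ → Ω → ℝ≥0) : alive X a T 0 = univ := by
  ext ω
  simp [alive, distAt, endTime, h0, ha]

theorem distAt_zero {X : ℝ≥0 → Ω → ℝ} {a : ℝ} (h0 : ∀ ω, X 0 ω = 0)
    (T : ℕ → Ω → ℝ≥0) (ω : Ω) : distAt X a T 0 ω = a := by
  simp [distAt, endTime, h0]

variable [MeasurableSpace Ω]

theorem measurable_drifted {B : ℝ≥0 → Ω → ℝ} (hmeas : ∀ t, Measurable (B t)) (μ : ℝ) (t : ℝ≥0) :
    Measurable (drifted μ B t) := (hmeas t).add_const _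

/-- Conditional law of the next distance to the boundary. -/
theorem lintegral_next {P : Measure Ω} {B : ℝ≥0 → Ω → ℝ} (hB : IsPreBrownianReal B P)
    (hmeas : ∀ t, Measurable (B t)) (hcont : ∀ ω, Continuous fun t => B t ω) {μ : ℝ}
    {T : ℕ → Ω → ℝ≥0} (hT : IsSamplingRule (drifted μ B) T) (a : ℝ) (k : ℕ) {A : Set Ω}
    (hA : MeasurableSet[hT.known k] A) {Z : Ω → ℝ} (hZ : Measurable[hT.known k] Z)
    {ψ : ℝ × ℝ → ℝ≥0∞} (hψ : Measurable ψ) :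
    ∫⁻ ω in A, ψ (Z ω, distAt (drifted μ B) a T (k + 1) ω) ∂P
      = ∫⁻ ω in A, ∫⁻ y, ψ (Z ω, distAt (drifted μ B) a T k ω - μ * T k ω - √(T k ω : ℝ) * y)
          ∂(gaussianReal 0 1) ∂P := by
  have hc := continuous_drifted hcont μ
  have hA' := pastAt_le (measurable_drifted hmeas μ) (hT.stopping k) _ hA
  -- The indicator of `A` is carried along as a coordinate, so that the unrestricted strong Markov
  -- identity yields the one over `A`.
  let V : Ω → ℝ≥0∞ × ℝ × ℝ × ℝ≥0 := fun ω =>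
    (A.indicator 1 ω, Z ω, distAt (drifted μ B) a T k ω, T k ω)
  have hV : Measurable[hT.known k] V := by
    let _ := hT.known k
    exact Measurable.prodMk (measurable_one.indicator hA)
      (hZ.prodMk ((hT.measurable_distAt hc a le_rfl).prodMk (hT.measurable_stage k)))
  let Ψ : (ℝ≥0∞ × ℝ × ℝ × ℝ≥0) × ℝ → ℝ≥0∞ := fun p =>
    p.1.1 * ψ (p.1.2.1, p.1.2.2.1 - μ * p.1.2.2.2 - p.2)
  have hΨ : Measurable Ψ := by
    refine Measurable.mul (by fun_prop) (hψ.comp ?_)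
    fun_prop
  have key := lintegral_strongMarkov hB hmeas hcont μ (hT.stopping k) hV
    (τ := fun p => p.2.2.2) (by fun_prop) hΨ
  rw [← lintegral_indicator hA', ← lintegral_indicator hA']
  convert key using 1
  · refine lintegral_congr fun ω => ?_
    have e : distAt (drifted μ B) a T (k + 1) ω = distAt (drifted μ B) a T k ω - μ * T k ω
        - (B (endTime T k ω + T k ω) ω - B (endTime T k ω) ω) := by
      simp only [distAt, endTime_succ, drifted]
      push_cast
      ring
    by_cases h : ω ∈ A <;> simp [V, Ψ, h, e]
  · refine lintegral_congr fun ω => ?_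
    by_cases h : ω ∈ A <;> simp [V, Ψ, h]

/-- The expected total cost `E (T + c M)` of a rule, the sum over its stages. -/
def stageCost (P : Measure Ω) (X : ℝ≥0 → Ω → ℝ) (c a : ℝ) (T : ℕ → Ω → ℝ≥0) : ℝ≥0∞ :=
  ∑' k, ∫⁻ ω in alive X a T k, ((T k ω : ℝ≥0∞) + ENNReal.ofReal c) ∂P

/-- Both `T^M` and `M` are sums over `k` of nonnegative terms living on `alive k`, so Tonelli's
theorem exchanges sum and expectation without any integrability. -/
theorem risk_eq {P : Measure Ω} {B : ℝ≥0 → Ω → ℝ}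
    (hmeas : ∀ t, Measurable (B t)) (hcont : ∀ ω, Continuous fun t => B t ω)
    (hzero : ∀ ω, B 0 ω = 0) {μ : ℝ}
    {T : ℕ → Ω → ℝ≥0} (hT : IsSamplingRule (drifted μ B) T) {a : ℝ} (ha : 0 < a) (c : ℝ) :
    risk P (drifted μ B) μ c a T
      = (stageCost P (drifted μ B) c a T : EReal) - ((a / μ : ℝ) : EReal) := by
  classical
  have h0 : ∀ ω, drifted μ B 0 ω = 0 := fun ω => by simp [drifted, hzero]
  have hle := fun k => pastAt_le (measurable_drifted hmeas μ) (hT.stopping k)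
  have hAm : ∀ k, MeasurableSet (alive (drifted μ B) a T k) := fun k =>
    hle k _ (hT.measurableSet_alive (continuous_drifted hcont μ) a k)
  have hTm : ∀ k, Measurable (fun ω => (T k ω : ℝ≥0∞)) := fun k =>
    measurable_coe_nnreal_ennreal.comp ((hT.measurable_stage k).mono (hle k) le_rfl)
  have e1 : ∫⁻ ω, totalTime (drifted μ B) a T ω ∂P
      = ∑' k, ∫⁻ ω in alive (drifted μ B) a T k, (T k ω : ℝ≥0∞) ∂P := by
    have : ∀ ω, totalTime (drifted μ B) a T ω
        = ∑' k, (alive (drifted μ B) a T k).indicator (fun ω => (T k ω : ℝ≥0∞)) ω := by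
      intro ω
      simp only [totalTime, lt_numStages ha h0, indicator_apply]
    simp_rw [this]
    rw [lintegral_tsum fun k => ((hTm k).indicator (hAm k)).aemeasurable]
    exact tsum_congr fun k => lintegral_indicator (hAm k) _
  have e2 : ∫⁻ ω, (numStages (drifted μ B) a T ω : ℝ≥0∞) ∂P
      = ∑' k, ∫⁻ _ in alive (drifted μ B) a T k, 1 ∂P := by
    have : ∀ ω, (numStages (drifted μ B) a T ω : ℝ≥0∞)
        = ∑' k, (alive (drifted μ B) a T k).indicator (fun _ => (1 : ℝ≥0∞)) ω := by
      intro ω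
      rw [coe_eq_tsum]
      simp only [lt_numStages ha h0, indicator_apply]
    simp_rw [this]
    rw [lintegral_tsum fun k => (measurable_const.indicator (hAm k)).aemeasurable]
    exact tsum_congr fun k => lintegral_indicator (hAm k) _
  have e3 : stageCost P (drifted μ B) c a T = ∫⁻ ω, totalTime (drifted μ B) a T ω ∂P
      + ENNReal.ofReal c * ∫⁻ ω, (numStages (drifted μ B) a T ω : ℝ≥0∞) ∂P := by
    rw [e1, e2, stageCost, ← ENNReal.tsum_mul_left, ← ENNReal.tsum_add]
    refine tsum_congr fun k => ?_
    rw [lintegral_add_left (hTm k)]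
    simp
  rw [risk, e3, EReal.coe_ennreal_add, sub_eq_add_neg, sub_eq_add_neg, add_right_comm]

end Chain

/-! ### Wald's identity and verification of bounds for the cost. -/

section Verification

/-- The expectation of `v (x - X t)` on the event `X t < x`. -/
def kernelAt (μ : ℝ) (v : ℝ → ℝ≥0∞) (x : ℝ) (t : ℝ≥0) : ℝ≥0∞ :=
  ∫⁻ y, (Ioi 0).indicator v (x - μ * t - √(t : ℝ) * y) ∂(gaussianReal 0 1)

/-- The expectation of `(X t - x)⁺`. -/
def overshoot (μ x : ℝ) (t : ℝ≥0) : ℝ≥0∞ :=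
  ∫⁻ y, ENNReal.ofReal (√(t : ℝ) * y + μ * t - x) ∂(gaussianReal 0 1)

theorem integrable_id_gaussian : Integrable (fun y : ℝ => y) (gaussianReal 0 1) := by
  simpa [Function.id_def] using (memLp_id_gaussianReal (μ := 0) (v := 1) 1).integrable (by norm_num)

theorem integrable_sq_gaussian : Integrable (fun y : ℝ => y ^ 2) (gaussianReal 0 1) := by
  have := (memLp_id_gaussianReal (μ := 0) (v := 1) 2).integrable_sq
  simpa using this

theorem integral_sq_gaussian : ∫ y, y ^ 2 ∂(gaussianReal 0 1) = 1 := by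
  have h := variance_id_gaussianReal (μ := 0) (v := 1)
  rw [variance_eq_sub (by simpa using memLp_id_gaussianReal (μ := 0) (v := 1) 2)] at h
  simpa [integral_id_gaussianReal] using h

theorem kernelAt_congr {v w : ℝ → ℝ≥0∞} (h : ∀ x, 0 < x → v x = w x) (μ x : ℝ) (t : ℝ≥0) :
    kernelAt μ v x t = kernelAt μ w x t := by
  refine lintegral_congr fun y => ?_
  by_cases hy : x - μ * t - √(t : ℝ) * y ∈ Ioi 0
  · simp only [indicator_of_mem hy]; exact h _ hy
  · simp only [indicator_of_notMem hy]

theorem kernelAt_mono {v w : ℝ → ℝ≥0∞} (h : ∀ x, 0 < x → v x ≤ w x) (μ x : ℝ) (t : ℝ≥0) :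
    kernelAt μ v x t ≤ kernelAt μ w x t := by
  refine lintegral_mono fun y => ?_
  by_cases hy : x - μ * t - √(t : ℝ) * y ∈ Ioi 0
  · simp only [indicator_of_mem hy]; exact h _ hy
  · simp only [indicator_of_notMem hy, le_refl]

theorem kernelAt_add {v w : ℝ → ℝ≥0∞} (hv : Measurable v) (μ x : ℝ) (t : ℝ≥0) :
    kernelAt μ (fun x => v x + w x) x t = kernelAt μ v x t + kernelAt μ w x t := by
  unfold kernelAt
  rw [← lintegral_add_left]
  · refine lintegral_congr fun y => ?_
    rw [indicator_add]
  · exact (hv.indicator measurableSet_Ioi).comp (by fun_prop)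

theorem kernelAt_const_mul {v : ℝ → ℝ≥0∞} (hv : Measurable v) (r : ℝ≥0∞) (μ x : ℝ) (t : ℝ≥0) :
    kernelAt μ (fun x => r * v x) x t = r * kernelAt μ v x t := by
  unfold kernelAt
  rw [← lintegral_const_mul]
  · refine lintegral_congr fun y => ?_
    by_cases h : x - μ * t - √(t : ℝ) * y ∈ Ioi 0
    · simp only [indicator_of_mem h]
    · simp only [indicator_of_notMem h, mul_zero]
  · exact (hv.indicator measurableSet_Ioi).comp (by fun_prop)

theorem kernelAt_ofReal (μ x : ℝ) (t : ℝ≥0) :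
    kernelAt μ ENNReal.ofReal x t
      = ∫⁻ y, ENNReal.ofReal (x - μ * t - √(t : ℝ) * y) ∂(gaussianReal 0 1) := by
  refine lintegral_congr fun y => ?_
  by_cases h : x - μ * t - √(t : ℝ) * y ∈ Ioi 0
  · simp only [indicator_of_mem h]
  · rw [indicator_of_notMem h, ENNReal.ofReal_of_nonpos (not_lt.1 h)]

/-- The expected distance that remains, `E (x - X t)⁺ = x - μ t + E (X t - x)⁺`. -/
theorem kernelAt_ofReal_add {μ x : ℝ} (hμ : 0 < μ) (hx : 0 ≤ x) (t : ℝ≥0) :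
    kernelAt μ ENNReal.ofReal x t + ENNReal.ofReal μ * t
      = ENNReal.ofReal x + overshoot μ x t := by
  have hi : Integrable (fun y : ℝ => x - μ * t - √(t : ℝ) * y) (gaussianReal 0 1) :=
    (integrable_const _).sub (integrable_id_gaussian.const_mul _)
  have hi2 : Integrable (fun y : ℝ => √(t : ℝ) * y + μ * t - x) (gaussianReal 0 1) := by
    refine hi.neg.congr (ae_of_all _ fun y => ?_)
    simp only [Pi.neg_apply]; ring
  have h1 : kernelAt μ ENNReal.ofReal x t
      = ENNReal.ofReal (∫ y, max (x - μ * t - √(t : ℝ) * y) 0 ∂(gaussianReal 0 1)) := by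
    rw [kernelAt_ofReal, ofReal_integral_eq_lintegral_ofReal hi.pos_part
      (ae_of_all _ fun y => le_max_right _ _)]
    simp [ENNReal.ofReal_max]
  have h2 : overshoot μ x t
      = ENNReal.ofReal (∫ y, max (√(t : ℝ) * y + μ * t - x) 0 ∂(gaussianReal 0 1)) := by
    rw [overshoot, ofReal_integral_eq_lintegral_ofReal hi2.pos_part
      (ae_of_all _ fun y => le_max_right _ _)]
    simp [ENNReal.ofReal_max]
  -- The positive parts of `u` and `-u` differ by `u`, whose mean is `x - μ t`.
  have h3 : (∫ y, max (x - μ * t - √(t : ℝ) * y) 0 ∂(gaussianReal 0 1))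
      - ∫ y, max (√(t : ℝ) * y + μ * t - x) 0 ∂(gaussianReal 0 1) = x - μ * t := by
    rw [← integral_sub hi.pos_part hi2.pos_part]
    have : ∀ y : ℝ, max (x - μ * t - √(t : ℝ) * y) 0 - max (√(t : ℝ) * y + μ * t - x) 0
        = (x - μ * t) - √(t : ℝ) * y := by
      intro y
      rcases le_total (x - μ * t - √(t : ℝ) * y) 0 with h | h
      · rw [max_eq_right h, max_eq_left (by linarith)]; ring
      · rw [max_eq_left h, max_eq_right (by linarith)]; ring
    simp_rw [this]
    rw [integral_sub (integrable_const _) (integrable_id_gaussian.const_mul _),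
      integral_const_mul, integral_id_gaussianReal]
    simp
  have h4 : 0 ≤ ∫ y, max (x - μ * t - √(t : ℝ) * y) 0 ∂(gaussianReal 0 1) :=
    integral_nonneg fun y => le_max_right _ _
  have h5 : 0 ≤ ∫ y, max (√(t : ℝ) * y + μ * t - x) 0 ∂(gaussianReal 0 1) :=
    integral_nonneg fun y => le_max_right _ _
  rw [h1, h2, ← ENNReal.ofReal_coe_nnreal, ← ENNReal.ofReal_mul hμ.le,
    ← ENNReal.ofReal_add h4 (by positivity), ← ENNReal.ofReal_add hx h5]
  congr 1
  linarith

/-- Where the remaining distance is positive the drift only reduces it. Without drift the second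
moment is `x² + t`, so second moments grow at most by the sampling time. -/
theorem kernelAt_sq_le {μ x : ℝ} (hμ : 0 < μ) (t : ℝ≥0) :
    kernelAt μ (fun y => ENNReal.ofReal (y ^ 2)) x t ≤ ENNReal.ofReal (x ^ 2) + t := by
  have hi : Integrable (fun y : ℝ => (x - √(t : ℝ) * y) ^ 2) (gaussianReal 0 1) := by
    have := ((integrable_const (x ^ 2)).sub (integrable_id_gaussian.const_mul (2 * x * √(t : ℝ)))).add
      (integrable_sq_gaussian.const_mul (√(t : ℝ) ^ 2))
    refine this.congr (ae_of_all _ fun y => ?_)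
    simp only [Pi.add_apply, Pi.sub_apply]; ring
  have h1 : ∫ y, (x - √(t : ℝ) * y) ^ 2 ∂(gaussianReal 0 1) = x ^ 2 + t := by
    have : ∀ y : ℝ, (x - √(t : ℝ) * y) ^ 2 = (x ^ 2 - (2 * x * √(t : ℝ)) * y) + t * y ^ 2 := by
      intro y
      rw [sub_sq, mul_pow, Real.sq_sqrt t.coe_nonneg]; ring
    simp_rw [this]
    have i1 : Integrable (fun y : ℝ => x ^ 2 - (2 * x * √(t : ℝ)) * y) (gaussianReal 0 1) :=
      (integrable_const _).sub (integrable_id_gaussian.const_mul _)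
    rw [integral_add i1 (integrable_sq_gaussian.const_mul _), integral_sub (integrable_const _)
      (integrable_id_gaussian.const_mul _), integral_const_mul, integral_const_mul,
      integral_id_gaussianReal, integral_sq_gaussian]
    simp
  calc kernelAt μ (fun y => ENNReal.ofReal (y ^ 2)) x t
      ≤ ∫⁻ y, ENNReal.ofReal ((x - √(t : ℝ) * y) ^ 2) ∂(gaussianReal 0 1) := by
        refine lintegral_mono fun y => ?_
        by_cases h : x - μ * t - √(t : ℝ) * y ∈ Ioi 0
        · simp only [indicator_of_mem h]
          refine ENNReal.ofReal_le_ofReal (pow_le_pow_left₀ (le_of_lt h) ?_ 2)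
          have : 0 ≤ μ * t := by positivity
          linarith
        · simp only [indicator_of_notMem h, zero_le]
    _ = ENNReal.ofReal (x ^ 2 + t) := by
        rw [← h1, ofReal_integral_eq_lintegral_ofReal hi (ae_of_all _ fun y => sq_nonneg _)]
    _ = _ := by
        rw [ENNReal.ofReal_add (sq_nonneg _) t.coe_nonneg, ENNReal.ofReal_coe_nnreal]

/-- Functions `L` such that `x / μ + L x` bounds the expected cost of every rule from below, as can
be seen from the first `n` stages. -/
def LowerBound (μ c : ℝ) : ℕ → Set (ℝ → ℝ≥0∞)
  | 0 => {0}
  | n + 1 => {L | Measurable L ∧ ∃ L' ∈ LowerBound μ c n, ∀ x, 0 < x → ∀ t : ℝ≥0,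
      L x ≤ ENNReal.ofReal c + (ENNReal.ofReal μ)⁻¹ * overshoot μ x t + kernelAt μ L' x t}

variable {Ω : Type*} [MeasurableSpace Ω] {P : Measure Ω} {B : ℝ≥0 → Ω → ℝ}

theorem lintegral_alive_succ (hB : IsPreBrownianReal B P)
    (hmeas : ∀ t, Measurable (B t)) (hcont : ∀ ω, Continuous fun t => B t ω) {μ : ℝ}
    {T : ℕ → Ω → ℝ≥0} (hT : IsSamplingRule (drifted μ B) T) (a : ℝ) (k : ℕ)
    {Z : Ω → ℝ} (hZ : Measurable[hT.known k] Z)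
    {ψ : ℝ → ℝ → ℝ≥0∞} (hψ : Measurable (Function.uncurry ψ)) :
    ∫⁻ ω in alive (drifted μ B) a T (k + 1), ψ (Z ω) (distAt (drifted μ B) a T (k + 1) ω) ∂P
      = ∫⁻ ω in alive (drifted μ B) a T k,
          kernelAt μ (ψ (Z ω)) (distAt (drifted μ B) a T k ω) (T k ω) ∂P := by
  have hc := continuous_drifted hcont μ
  have hle := fun k => pastAt_le (measurable_drifted hmeas μ) (hT.stopping k)
  have hD : Measurable (distAt (drifted μ B) a T (k + 1)) :=
    (hT.measurable_distAt hc a le_rfl).mono (hle _) le_rfl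
  have hψ' : Measurable (fun p : ℝ × ℝ => (Ioi (0 : ℝ)).indicator (ψ p.1) p.2) := by
    have : (fun p : ℝ × ℝ => (Ioi (0 : ℝ)).indicator (ψ p.1) p.2)
        = (Prod.snd ⁻¹' Ioi (0 : ℝ)).indicator (Function.uncurry ψ) := by
      ext p
      by_cases h : 0 < p.2 <;> simp [indicator, h, Function.uncurry]
    rw [this]
    exact hψ.indicator (measurable_snd measurableSet_Ioi)
  have key := lintegral_next hB hmeas hcont hT a k (hT.measurableSet_alive hc a k) hZ hψ'
  rw [alive_succ]
  have hS : MeasurableSet {ω | 0 < distAt (drifted μ B) a T (k + 1) ω} := hD measurableSet_Ioi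
  rw [inter_comm, ← setLIntegral_indicator hS]
  refine Eq.trans ?_ key
  refine lintegral_congr fun ω => ?_
  by_cases h : 0 < distAt (drifted μ B) a T (k + 1) ω
  · rw [indicator_of_mem (show ω ∈ {ω | 0 < distAt (drifted μ B) a T (k + 1) ω} from h),
      indicator_of_mem (show _ ∈ Ioi (0 : ℝ) from h)]
  · rw [indicator_of_notMem (show ω ∉ {ω | 0 < distAt (drifted μ B) a T (k + 1) ω} from h),
      indicator_of_notMem (show _ ∉ Ioi (0 : ℝ) from h)]

/-- If every stage cost is covered by the decrease of the potential `V`, the expected total cost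
is at most the initial potential. -/
theorem stageCost_le {X : ℝ≥0 → Ω → ℝ} {c a : ℝ} {T : ℕ → Ω → ℝ≥0} (V : ℕ → Ω → ℝ≥0∞)
    (h : ∀ k, ∫⁻ ω in alive X a T k, ((T k ω : ℝ≥0∞) + ENNReal.ofReal c) ∂P
        + ∫⁻ ω in alive X a T (k + 1), V (k + 1) ω ∂P ≤ ∫⁻ ω in alive X a T k, V k ω ∂P) :
    stageCost P X c a T ≤ ∫⁻ ω in alive X a T 0, V 0 ω ∂P := by
  refine ENNReal.tsum_le_of_sum_range_le fun n => ?_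
  suffices ∑ k ∈ Finset.range n, ∫⁻ ω in alive X a T k, ((T k ω : ℝ≥0∞) + ENNReal.ofReal c) ∂P
      + ∫⁻ ω in alive X a T n, V n ω ∂P ≤ ∫⁻ ω in alive X a T 0, V 0 ω ∂P from
    le_self_add.trans this
  induction n with
  | zero => simp
  | succ n ih =>
    rw [Finset.sum_range_succ, add_assoc]
    exact (add_le_add le_rfl (h n)).trans ih

/-- Telescoping in this direction leaves a remainder at stage `n`, which cannot be discarded as in
`stageCost_le` and has to be shown to vanish. -/
theorem le_sum_add {X : ℝ≥0 → Ω → ℝ} {c a : ℝ} {T : ℕ → Ω → ℝ≥0} (V : ℕ → Ω → ℝ≥0∞)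
    (h : ∀ k, ∫⁻ ω in alive X a T k, V k ω ∂P
      ≤ ∫⁻ ω in alive X a T k, ((T k ω : ℝ≥0∞) + ENNReal.ofReal c) ∂P
        + ∫⁻ ω in alive X a T (k + 1), V (k + 1) ω ∂P) (n : ℕ) :
    ∫⁻ ω in alive X a T 0, V 0 ω ∂P ≤ stageCost P X c a T + ∫⁻ ω in alive X a T n, V n ω ∂P := by
  suffices ∫⁻ ω in alive X a T 0, V 0 ω ∂P ≤
      ∑ k ∈ Finset.range n, ∫⁻ ω in alive X a T k, ((T k ω : ℝ≥0∞) + ENNReal.ofReal c) ∂P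
      + ∫⁻ ω in alive X a T n, V n ω ∂P from
    this.trans (add_le_add (ENNReal.sum_le_tsum _) le_rfl)
  induction n with
  | zero => simp
  | succ n ih =>
    rw [Finset.sum_range_succ, add_assoc]
    exact ih.trans (add_le_add le_rfl (h n))

/-- The potential is `x / μ` plus the current lower bound; by Wald's identity it decreases in each
stage by at most the cost of the stage. After `n` stages only the part `x / μ` is left. If the total
cost is finite, then the mean remaining distance tends to `0`: its second moment stays bounded while
the probability of continuing vanishes. -/
theorem le_stageCost (hB : IsPreBrownianReal B P)
    (hmeas : ∀ t, Measurable (B t)) (hcont : ∀ ω, Continuous fun t => B t ω)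
    (hzero : ∀ ω, B 0 ω = 0) {μ : ℝ} (hμ : 0 < μ)
    {T : ℕ → Ω → ℝ≥0} (hT : IsSamplingRule (drifted μ B) T) {a c : ℝ} (ha : 0 < a) (hc0 : 0 < c)
    {n : ℕ} {L : ℝ → ℝ≥0∞} (hL : L ∈ LowerBound μ c n) :
    ENNReal.ofReal (a / μ) + L a ≤ stageCost P (drifted μ B) c a T := by
  have hP : IsProbabilityMeasure P := hB.isGaussianProcess.isProbabilityMeasure
  have hc := continuous_drifted hcont μ
  have h0 : ∀ ω, drifted μ B 0 ω = 0 := fun ω => by simp [drifted, hzero]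
  have hle := fun k => pastAt_le (measurable_drifted hmeas μ) (hT.stopping k)
  have hAm : ∀ k, MeasurableSet (alive (drifted μ B) a T k) := fun k =>
    hle k _ (hT.measurableSet_alive hc a k)
  have hTm : ∀ k, Measurable (fun ω => (T k ω : ℝ≥0∞)) := fun k =>
    measurable_coe_nnreal_ennreal.comp ((hT.measurable_stage k).mono (hle k) le_rfl)
  have hZ : ∀ k, Measurable[hT.known k] (fun _ : Ω => (0 : ℝ)) := fun k => measurable_const
  have hDm : ∀ k, Measurable (distAt (drifted μ B) a T k) := fun k =>
    (hT.measurable_distAt hc a le_rfl).mono (hle _) le_rfl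
  rcases eq_or_ne (stageCost P (drifted μ B) c a T) ⊤ with htop | htop
  · rw [htop]; exact le_top
  -- The nested existentials in `LowerBound` are unrolled into one sequence of functions, extended
  -- by `0` from index `n` on.
  obtain ⟨l, hl0, hln, hlm, hl⟩ : ∃ l : ℕ → ℝ → ℝ≥0∞, l 0 = L ∧ (∀ k, n ≤ k → l k = 0) ∧
      (∀ k, Measurable (l k)) ∧ ∀ k x, 0 < x → ∀ t : ℝ≥0, l k x ≤ ENNReal.ofReal c
        + (ENNReal.ofReal μ)⁻¹ * overshoot μ x t + kernelAt μ (l (k + 1)) x t := by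
    clear htop
    induction n generalizing L with
    | zero =>
      exact ⟨fun _ => 0, (show L = 0 from hL).symm, fun _ _ => rfl, fun _ => measurable_zero,
        fun k x _ t => by simp⟩
    | succ n ih =>
      obtain ⟨hm, L', hL', hstep⟩ := hL
      obtain ⟨l, hl0, hln, hlm, hl⟩ := ih hL'
      refine ⟨fun k => Nat.casesOn k L l, rfl, fun k hk => ?_, fun k => ?_, fun k => ?_⟩
      · cases k with
        | zero => omega
        | succ k => exact hln k (by omega)
      · cases k with
        | zero => exact hm
        | succ k => exact hlm k
      · cases k with
        | zero => simpa [hl0] using hstep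
        | succ k => exact hl k
  have hμ' : ENNReal.ofReal μ ≠ 0 := by simpa using hμ
  have hstep : ∀ k x, 0 < x → ∀ t : ℝ≥0, (ENNReal.ofReal μ)⁻¹ * ENNReal.ofReal x + l k x
      ≤ (t + ENNReal.ofReal c)
        + kernelAt μ (fun y => (ENNReal.ofReal μ)⁻¹ * ENNReal.ofReal y + l (k + 1) y) x t := by
    intro k x hx t
    rw [kernelAt_add (by fun_prop), kernelAt_const_mul ENNReal.measurable_ofReal]
    have h1 := congrArg (fun r => (ENNReal.ofReal μ)⁻¹ * r) (kernelAt_ofReal_add hμ hx.le t)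
    simp only [mul_add, ← mul_assoc, ENNReal.inv_mul_cancel hμ' ENNReal.ofReal_ne_top,
      one_mul] at h1
    calc (ENNReal.ofReal μ)⁻¹ * ENNReal.ofReal x + l k x
        ≤ (ENNReal.ofReal μ)⁻¹ * ENNReal.ofReal x + (ENNReal.ofReal c
          + (ENNReal.ofReal μ)⁻¹ * overshoot μ x t + kernelAt μ (l (k + 1)) x t) :=
          add_le_add le_rfl (hl k x hx t)
      _ = ((ENNReal.ofReal μ)⁻¹ * ENNReal.ofReal x + (ENNReal.ofReal μ)⁻¹ * overshoot μ x t)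
          + (ENNReal.ofReal c + kernelAt μ (l (k + 1)) x t) := by ring
      _ = _ := by rw [← h1]; ring
      _ ≤ _ := le_rfl
  let V : ℕ → Ω → ℝ≥0∞ := fun k ω =>
    (ENNReal.ofReal μ)⁻¹ * ENNReal.ofReal (distAt (drifted μ B) a T k ω)
      + l k (distAt (drifted μ B) a T k ω)
  have hV := le_sum_add (P := P) (X := drifted μ B) (c := c) (a := a) (T := T) V (fun k => by
    have h1 := lintegral_alive_succ hB hmeas hcont hT a k (hZ k)
      (ψ := fun _ y => (ENNReal.ofReal μ)⁻¹ * ENNReal.ofReal y + l (k + 1) y)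
      (by
        have := hlm (k + 1)
        show Measurable (fun p : ℝ × ℝ => (ENNReal.ofReal μ)⁻¹ * ENNReal.ofReal p.2 + l (k + 1) p.2)
        fun_prop)
    rw [h1, ← lintegral_add_left ((hTm k).add_const _)]
    exact setLIntegral_mono' (hAm k) fun ω hω => hstep k _ (hω k le_rfl) _)
  have h2 : ∫⁻ ω in alive (drifted μ B) a T 0, V 0 ω ∂P = ENNReal.ofReal (a / μ) + L a := by
    rw [alive_zero ha h0]
    simp only [V, distAt_zero h0, hl0]
    simp only [Measure.restrict_univ, lintegral_const, measure_univ, mul_one]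
    rw [ENNReal.ofReal_div_of_pos hμ, div_eq_mul_inv, mul_comm]
  rw [h2] at hV
  -- the remaining distance vanishes in the mean
  set J := stageCost P (drifted μ B) c a T with hJ
  have hsq : ∀ N, ∫⁻ ω in alive (drifted μ B) a T N,
      ENNReal.ofReal (distAt (drifted μ B) a T N ω ^ 2) ∂P ≤ ENNReal.ofReal (a ^ 2) + J := by
    intro N
    suffices ∫⁻ ω in alive (drifted μ B) a T N,
      ENNReal.ofReal (distAt (drifted μ B) a T N ω ^ 2) ∂P ≤ ENNReal.ofReal (a ^ 2) +
        ∑ k ∈ Finset.range N, ∫⁻ ω in alive (drifted μ B) a T k,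
          ((T k ω : ℝ≥0∞) + ENNReal.ofReal c) ∂P from
      this.trans (add_le_add le_rfl (ENNReal.sum_le_tsum _))
    induction N with
    | zero =>
      rw [alive_zero ha h0]
      simp [distAt_zero h0]
    | succ N ih =>
      rw [lintegral_alive_succ hB hmeas hcont hT a N (hZ N)
        (ψ := fun _ y => ENNReal.ofReal (y ^ 2)) (by
          show Measurable (fun p : ℝ × ℝ => ENNReal.ofReal (p.2 ^ 2)); fun_prop),
        Finset.sum_range_succ, ← add_assoc]
      refine le_trans ?_ (add_le_add ih (lintegral_mono fun ω => le_self_add))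
      rw [← lintegral_add_right _ (hTm N)]
      exact lintegral_mono fun ω => kernelAt_sq_le hμ _
  -- A positive cost per stage and a finite total cost make the probabilities of continuing
  -- summable.
  have hprob : Tendsto (fun N => P (alive (drifted μ B) a T N)) atTop (𝓝 0) := by
    refine ENNReal.tendsto_atTop_zero_of_tsum_ne_top fun h => htop ?_
    have h3 : ENNReal.ofReal c * ∑' N, P (alive (drifted μ B) a T N) ≤ J := by
      rw [← ENNReal.tsum_mul_left]
      refine ENNReal.tsum_le_tsum fun k => ?_
      refine le_trans ?_ (lintegral_mono fun ω => le_add_self)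
      simp
    rw [h, ENNReal.mul_top (by simpa using hc0)] at h3
    exact top_le_iff.1 h3
  have hKtop : ENNReal.ofReal (a ^ 2) + J ≠ ⊤ := ENNReal.add_ne_top.2 ⟨ENNReal.ofReal_ne_top, htop⟩
  set K := ENNReal.ofReal (a ^ 2) + J with hK
  -- The inequality `d ≤ r d² + 1 / r` trades the mean for the bounded second moment; `r` is chosen
  -- small first, then `N` large.
  have hmean : ∀ (r : ℝ), 0 < r → ∀ N, ∫⁻ ω in alive (drifted μ B) a T N,
      ENNReal.ofReal (distAt (drifted μ B) a T N ω) ∂P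
        ≤ ENNReal.ofReal r * K + ENNReal.ofReal r⁻¹ * P (alive (drifted μ B) a T N) := by
    intro r hr N
    calc ∫⁻ ω in alive (drifted μ B) a T N, ENNReal.ofReal (distAt (drifted μ B) a T N ω) ∂P
        ≤ ∫⁻ ω in alive (drifted μ B) a T N, (ENNReal.ofReal r *
          ENNReal.ofReal (distAt (drifted μ B) a T N ω ^ 2) + ENNReal.ofReal r⁻¹) ∂P := by
          refine lintegral_mono fun ω => ?_
          rw [← ENNReal.ofReal_mul hr.le, ← ENNReal.ofReal_add (by positivity) (by positivity)]
          refine ENNReal.ofReal_le_ofReal ?_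
          set d := distAt (drifted μ B) a T N ω
          have : d * r ≤ (r * d) ^ 2 + 1 := by nlinarith [sq_nonneg (r * d - 1)]
          calc d = d * r * r⁻¹ := by field_simp
            _ ≤ ((r * d) ^ 2 + 1) * r⁻¹ := by gcongr
            _ = _ := by field_simp
      _ ≤ _ := by
          rw [lintegral_add_right _ measurable_const, lintegral_const_mul _ (by
            have := hDm N; fun_prop)]
          simp only [lintegral_const, Measure.restrict_apply_univ]
          gcongr
          exact hsq N
  have hlim : Tendsto (fun N => ∫⁻ ω in alive (drifted μ B) a T N,
      ENNReal.ofReal (distAt (drifted μ B) a T N ω) ∂P) atTop (𝓝 0) := by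
    rw [ENNReal.tendsto_atTop_zero]
    intro ε hε
    obtain ⟨r, hr, hrK⟩ : ∃ r : ℝ, 0 < r ∧ ENNReal.ofReal r * K ≤ ε / 2 := by
      have : Tendsto (fun r : ℝ => ENNReal.ofReal r * K) (𝓝[>] 0) (𝓝 0) := by
        have h5 : Tendsto (fun r : ℝ => ENNReal.ofReal r * K) (𝓝 0) (𝓝 (ENNReal.ofReal 0 * K)) :=
          ENNReal.Tendsto.mul_const (ENNReal.continuous_ofReal.tendsto 0) (Or.inr hKtop)
        simp only [ENNReal.ofReal_zero, zero_mul] at h5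
        exact h5.mono_left nhdsWithin_le_nhds
      have h6 := this.eventually (ge_mem_nhds (ENNReal.half_pos hε.ne'))
      obtain ⟨r, h7, h8⟩ := (h6.and self_mem_nhdsWithin).exists
      exact ⟨r, h8, h7⟩
    have h9 : Tendsto (fun N => ENNReal.ofReal r⁻¹ * P (alive (drifted μ B) a T N)) atTop (𝓝 0) := by
      have := ENNReal.Tendsto.const_mul (a := ENNReal.ofReal r⁻¹) hprob (Or.inr ENNReal.ofReal_ne_top)
      simpa using this
    obtain ⟨N0, hN0⟩ := (ENNReal.tendsto_atTop_zero.1 h9) (ε / 2) (ENNReal.half_pos hε.ne')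
    refine ⟨N0, fun N hN => (hmean r hr N).trans ?_⟩
    exact (add_le_add hrK (hN0 N hN)).trans_eq (ENNReal.add_halves ε)
  have hfin : Tendsto (fun N => J + (ENNReal.ofReal μ)⁻¹ * ∫⁻ ω in alive (drifted μ B) a T N,
      ENNReal.ofReal (distAt (drifted μ B) a T N ω) ∂P) atTop (𝓝 (J + (ENNReal.ofReal μ)⁻¹ * 0)) :=
    tendsto_const_nhds.add (ENNReal.Tendsto.const_mul hlim
      (Or.inr (ENNReal.inv_ne_top.2 hμ')))
  rw [mul_zero, add_zero] at hfin
  refine ge_of_tendsto hfin ?_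
  filter_upwards [eventually_ge_atTop n] with N hN
  refine (hV N).trans (add_le_add le_rfl ?_)
  simp only [V, hln N hN, Pi.zero_apply, add_zero]
  rw [lintegral_const_mul _ (by have := hDm N; fun_prop)]

end Verification


/-! ### The normal distribution: the excess function `Del` and the hazard rate. -/

section Normal

theorem stdPdf_eq (z : ℝ) : stdPdf z = (√(2 * Real.pi))⁻¹ * Real.exp (-z ^ 2 / 2) := by
  simp [stdPdf, gaussianPDFReal]

theorem stdPdf_pos (z : ℝ) : 0 < stdPdf z := gaussianPDFReal_pos _ _ _ one_ne_zero

theorem continuous_stdPdf : Continuous stdPdf := by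
  rw [show stdPdf = fun z => (√(2 * Real.pi))⁻¹ * Real.exp (-z ^ 2 / 2) from funext stdPdf_eq]
  fun_prop

theorem hasDerivAt_stdPdf (z : ℝ) : HasDerivAt stdPdf (-z * stdPdf z) z := by
  rw [show stdPdf = fun z => (√(2 * Real.pi))⁻¹ * Real.exp (-z ^ 2 / 2) from funext stdPdf_eq]
  have h1 : HasDerivAt (fun z : ℝ => -z ^ 2 / 2) (-z) z := by
    refine (((hasDerivAt_pow 2 z).neg).div_const 2).congr_deriv ?_
    norm_num
    ring
  refine ((h1.exp).const_mul ((√(2 * Real.pi))⁻¹)).congr_deriv ?_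
  ring

theorem integrable_stdPdf : Integrable stdPdf := integrable_gaussianPDFReal 0 1

theorem gaussian_apply (s : Set ℝ) : (gaussianReal 0 1) s = ∫⁻ x in s, ENNReal.ofReal (stdPdf x) := by
  rw [gaussianReal_apply 0 one_ne_zero]; rfl

theorem gaussian_real_apply (s : Set ℝ) : (gaussianReal 0 1).real s = ∫ x in s, stdPdf x := by
  rw [measureReal_def, gaussian_apply, integral_eq_lintegral_of_nonneg_ae
    (ae_of_all _ fun x => (stdPdf_pos x).le) integrable_stdPdf.aestronglyMeasurable.restrict]

theorem stdCdf_eq (z : ℝ) : stdCdf z = (gaussianReal 0 1).real (Iic z) := by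
  rw [stdCdf, cdf_eq_real]

theorem stdCdf_neg_eq (z : ℝ) : stdCdf (-z) = (gaussianReal 0 1).real (Ici z) := by
  have h : (gaussianReal 0 1).map (fun x => -x) = gaussianReal 0 1 := by
    rw [gaussianReal_map_neg, neg_zero]
  rw [stdCdf_eq]
  conv_lhs => rw [← h]
  rw [map_measureReal_apply measurable_neg measurableSet_Iic]
  congr 1
  ext x; simp

theorem gaussian_Iio (z : ℝ) : (gaussianReal 0 1) (Iio z) = (gaussianReal 0 1) (Iic z) := by
  have := nullSingletonClass_gaussianReal (μ := 0) (v := 1) one_ne_zero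
  exact measure_congr Iio_ae_eq_Iic

theorem stdCdf_neg (z : ℝ) : stdCdf (-z) = 1 - stdCdf z := by
  rw [stdCdf_neg_eq, stdCdf_eq, ← compl_Iio, probReal_compl_eq_one_sub measurableSet_Iio]
  congr 1
  rw [measureReal_def, measureReal_def, gaussian_Iio]

theorem hasDerivAt_stdCdf (z : ℝ) : HasDerivAt stdCdf (stdPdf z) z := by
  have e : stdCdf = fun z => ∫ x in Iic z, stdPdf x := by
    ext z; rw [stdCdf_eq, gaussian_real_apply]
  have e2 : stdCdf = fun z => stdCdf 0 + ∫ x in (0 : ℝ)..z, stdPdf x := by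
    ext w
    rw [e]
    simp only
    rw [← intervalIntegral.integral_Iic_sub_Iic integrable_stdPdf.integrableOn
      integrable_stdPdf.integrableOn]
    ring
  rw [e2]
  exact (intervalIntegral.integral_hasDerivAt_right (integrable_stdPdf.intervalIntegrable)
    continuous_stdPdf.stronglyMeasurable.stronglyMeasurableAtFilter
    continuous_stdPdf.continuousAt).const_add _

theorem continuous_stdCdf : Continuous stdCdf :=
  continuous_iff_continuousAt.2 fun z => (hasDerivAt_stdCdf z).continuousAt

theorem stdCdf_nonneg (z : ℝ) : 0 ≤ stdCdf z := by rw [stdCdf_eq]; exact measureReal_nonneg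

theorem stdCdf_strictMono : StrictMono stdCdf :=
  strictMono_of_deriv_pos fun z => by rw [(hasDerivAt_stdCdf z).deriv]; exact stdPdf_pos z

theorem stdCdf_pos (z : ℝ) : 0 < stdCdf z :=
  (stdCdf_nonneg (z - 1)).trans_lt (stdCdf_strictMono (by linarith))

theorem stdCdf_lt_one (z : ℝ) : stdCdf z < 1 := by
  have := stdCdf_pos (-z); rw [stdCdf_neg] at this; linarith

theorem tendsto_stdCdf_atTop : Tendsto stdCdf atTop (𝓝 1) := tendsto_cdf_atTop _

theorem tendsto_stdCdf_atBot : Tendsto stdCdf atBot (𝓝 0) := tendsto_cdf_atBot _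

theorem stdCdf_zero : stdCdf 0 = 1 / 2 := by
  have := stdCdf_neg 0
  rw [neg_zero] at this; linarith

/-- `Δ(z) = E (Z - z)⁺`. -/
theorem lintegral_excess (z : ℝ) :
    ∫⁻ y, ENNReal.ofReal (y - z) ∂(gaussianReal 0 1) = ENNReal.ofReal (Del z) := by
  have h1 : ∫⁻ y, ENNReal.ofReal (y - z) ∂(gaussianReal 0 1)
      = ∫⁻ x in Ioi z, ENNReal.ofReal (stdCdf (-x)) := by
    have e1 : ∀ y : ℝ, ENNReal.ofReal (y - z) = ∫⁻ x in Ioi z, (Iic y).indicator 1 x := by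
      intro y
      rw [lintegral_indicator_one measurableSet_Iic, Measure.restrict_apply measurableSet_Iic,
        inter_comm, Ioi_inter_Iic, Real.volume_Ioc]
    have e2 : ∀ x : ℝ, ENNReal.ofReal (stdCdf (-x))
        = ∫⁻ y, (Iic y).indicator 1 x ∂(gaussianReal 0 1) := by
      intro x
      rw [stdCdf_neg_eq, ofReal_measureReal, ← lintegral_indicator_one measurableSet_Ici]
      refine lintegral_congr fun y => ?_
      simp [indicator]
    simp_rw [e1, e2]
    rw [lintegral_lintegral_swap]
    have : (Function.uncurry fun (y x : ℝ) => (Iic y).indicator (1 : ℝ → ℝ≥0∞) x)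
        = {p : ℝ × ℝ | p.2 ≤ p.1}.indicator 1 := by
      ext p; simp [indicator, Function.uncurry]
    rw [this]
    exact (measurable_one.indicator
      (measurableSet_le measurable_snd measurable_fst)).aemeasurable
  have hfin : ∫⁻ y, ENNReal.ofReal (y - z) ∂(gaussianReal 0 1) ≠ ⊤ := by
    have := ((integrable_id_gaussian.sub (integrable_const z)).lintegral_lt_top).ne
    exact this
  rw [Del, integral_eq_lintegral_of_nonneg_ae (ae_of_all _ fun x => stdCdf_nonneg _)
    ((continuous_stdCdf.comp continuous_neg).aestronglyMeasurable.restrict), ← h1,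
    ENNReal.ofReal_toReal hfin]

theorem Del_nonneg (z : ℝ) : 0 ≤ Del z := integral_nonneg fun _ => stdCdf_nonneg _

theorem Del_antitone : Antitone Del := by
  intro z w h
  rw [← ENNReal.ofReal_le_ofReal_iff (Del_nonneg z), ← lintegral_excess, ← lintegral_excess]
  exact lintegral_mono fun y => ENNReal.ofReal_le_ofReal (by linarith)

/-- A Chernoff bound: `z (y - z) ≤ exp (z y - z²)`, and the normal exponential moment is `exp (z² /
2)`. The factor `1 / z` is what later makes overshoots negligible at the critical parameters. -/
theorem Del_le_exp {z : ℝ} (hz : 0 < z) : Del z ≤ Real.exp (-z ^ 2 / 2) / z := by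
  rw [← ENNReal.ofReal_le_ofReal_iff (by positivity), ← lintegral_excess]
  have hi : Integrable (fun y : ℝ => Real.exp (z * y)) (gaussianReal 0 1) :=
    integrable_exp_mul_gaussianReal z
  have hm : ∫ y, Real.exp (z * y) ∂(gaussianReal 0 1) = Real.exp (z ^ 2 / 2) := by
    have := congrFun (mgf_id_gaussianReal (μ := 0) (v := 1)) z
    simpa [mgf] using this
  calc ∫⁻ y, ENNReal.ofReal (y - z) ∂(gaussianReal 0 1)
      ≤ ∫⁻ y, ENNReal.ofReal (Real.exp (z * y) * (Real.exp (-z ^ 2) / z)) ∂(gaussianReal 0 1) := by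
        refine lintegral_mono fun y => ENNReal.ofReal_le_ofReal ?_
        rw [mul_div_assoc', ← Real.exp_add, le_div_iff₀ hz]
        have := Real.add_one_le_exp (z * y + -z ^ 2)
        nlinarith
    _ = ENNReal.ofReal (Real.exp (z ^ 2 / 2) * (Real.exp (-z ^ 2) / z)) := by
        rw [← hm, ← integral_mul_const, ofReal_integral_eq_lintegral_ofReal (hi.mul_const _)
          (ae_of_all _ fun y => by positivity)]
    _ = _ := by
        rw [mul_div_assoc', ← Real.exp_add]
        congr 3; ring

/-- On `[z + 1, z + 2]` the excess is at least `1` and the density is at least its value at `z + 2`.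
The shift by `2` does no harm for `z` of order `√(log x)`, as there is a factor to spare in the
exponent. -/
theorem exp_le_Del {z : ℝ} (hz : 0 ≤ z) : (√(2 * Real.pi))⁻¹ * Real.exp (-(z + 2) ^ 2 / 2) ≤ Del z := by
  rw [← ENNReal.ofReal_le_ofReal_iff (Del_nonneg z), ← lintegral_excess]
  have h1 : ENNReal.ofReal ((√(2 * Real.pi))⁻¹ * Real.exp (-(z + 2) ^ 2 / 2))
      ≤ (gaussianReal 0 1) (Icc (z + 1) (z + 2)) := by
    rw [gaussian_apply]
    calc ENNReal.ofReal ((√(2 * Real.pi))⁻¹ * Real.exp (-(z + 2) ^ 2 / 2))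
        = ∫⁻ _ in Icc (z + 1) (z + 2),
          ENNReal.ofReal ((√(2 * Real.pi))⁻¹ * Real.exp (-(z + 2) ^ 2 / 2)) := by
          rw [lintegral_const, Measure.restrict_apply_univ, Real.volume_Icc]
          norm_num
      _ ≤ _ := by
          refine setLIntegral_mono' measurableSet_Icc fun x hx => ENNReal.ofReal_le_ofReal ?_
          rw [stdPdf_eq]
          have : x ^ 2 ≤ (z + 2) ^ 2 := pow_le_pow_left₀ (by linarith [hx.1]) hx.2 2
          gcongr
  refine h1.trans ?_
  rw [← lintegral_indicator_one measurableSet_Icc]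
  refine lintegral_mono fun y => ?_
  by_cases hy : y ∈ Icc (z + 1) (z + 2)
  · rw [indicator_of_mem hy, Pi.one_apply, ENNReal.one_le_ofReal]
    linarith [hy.1]
  · rw [indicator_of_notMem hy]; exact zero_le

theorem Del_pos (z : ℝ) : 0 < Del z := by
  refine lt_of_lt_of_le ?_ ((exp_le_Del (le_max_right z 0)).trans (Del_antitone (le_max_left z 0)))
  positivity

theorem Del_le_abs (z : ℝ) : Del z ≤ |z| + 1 := by
  rw [← ENNReal.ofReal_le_ofReal_iff (by positivity), ← lintegral_excess]
  have hi : Integrable (fun y : ℝ => |z| + (1 + y ^ 2) / 2) (gaussianReal 0 1) :=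
    (integrable_const _).add (((integrable_const 1).add integrable_sq_gaussian).div_const 2)
  have hm : ∫ y, (|z| + (1 + y ^ 2) / 2) ∂(gaussianReal 0 1) = |z| + 1 := by
    have i1 : Integrable (fun y : ℝ => (1 + y ^ 2) / 2) (gaussianReal 0 1) :=
      ((integrable_const 1).add integrable_sq_gaussian).div_const 2
    rw [integral_add (integrable_const _) i1, integral_div,
      integral_add (integrable_const _) integrable_sq_gaussian, integral_sq_gaussian]
    simp
  rw [← hm, ofReal_integral_eq_lintegral_ofReal hi (ae_of_all _ fun y => by positivity)]
  refine lintegral_mono fun y => ENNReal.ofReal_le_ofReal ?_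
  have := neg_abs_le z
  nlinarith [sq_nonneg (y - 1)]

theorem hasDerivAt_Del (z : ℝ) : HasDerivAt Del (-stdCdf (-z)) z := by
  have hc : Continuous fun x => stdCdf (-x) := continuous_stdCdf.comp continuous_neg
  -- A non-integrable tail would make `Del z` equal to the default value `0`, but `Del` is positive.
  have hint : ∀ z, IntegrableOn (fun x => stdCdf (-x)) (Ioi z) := fun z => by
    by_contra h
    have := Del_pos z
    rw [Del, integral_undef h] at this
    exact lt_irrefl _ this
  have e : Del = fun z => Del 0 - ∫ x in (0 : ℝ)..z, stdCdf (-x) := by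
    ext w
    have := intervalIntegral.integral_interval_add_Ioi (hint 0) (hint w)
    simp only [Del]
    linarith
  rw [e]
  exact (intervalIntegral.integral_hasDerivAt_right (hc.intervalIntegrable _ _)
    hc.stronglyMeasurable.stronglyMeasurableAtFilter hc.continuousAt).const_sub _

theorem tendsto_Del_atTop : Tendsto Del atTop (𝓝 0) := by
  refine squeeze_zero' (Eventually.of_forall Del_nonneg)
    (g := fun z => z⁻¹) ?_ tendsto_inv_atTop_zero
  filter_upwards [eventually_gt_atTop 0] with z hz
  refine (Del_le_exp hz).trans ?_
  rw [← one_div]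
  gcongr
  rw [Real.exp_le_one_iff]
  nlinarith [sq_nonneg z]

/-- `Δ(z) = φ(z) - z Φ(-z)`. -/
theorem Del_eq (z : ℝ) : Del z = stdPdf z - z * stdCdf (-z) := by
  -- `G` has derivative zero and tends to `0` at infinity; the latter needs `z Φ(-z) → 0`, obtained
  -- from a Markov inequality at `z / 2`.
  let G : ℝ → ℝ := fun z => Del z - (stdPdf z - z * stdCdf (-z))
  have hG : ∀ z, HasDerivAt G 0 z := by
    intro z
    have h1 : HasDerivAt (fun z => stdCdf (-z)) (-stdPdf (-z)) z := by
      have := (hasDerivAt_stdCdf (-z)).comp z (hasDerivAt_neg z)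
      simpa [Function.comp_def] using this
    have h2 := (hasDerivAt_Del z).sub ((hasDerivAt_stdPdf z).sub ((hasDerivAt_id z).mul h1))
    refine h2.congr_deriv ?_
    have : stdPdf (-z) = stdPdf z := by simp [stdPdf_eq]
    simp [this]
  have hconst : ∀ w, G w = G z := fun w =>
    is_const_of_deriv_eq_zero (fun x => (hG x).differentiableAt) (fun x => (hG x).deriv) w z
  have hmul : Tendsto (fun z => z * stdCdf (-z)) atTop (𝓝 0) := by
    refine squeeze_zero' (g := fun z => 2 * Del (z / 2)) ?_ ?_ ?_
    · filter_upwards [eventually_ge_atTop 0] with z hz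
      exact mul_nonneg hz (stdCdf_nonneg _)
    · filter_upwards [eventually_ge_atTop 0] with z hz
      have h3 : z / 2 * stdCdf (-z) ≤ Del (z / 2) := by
        rw [← ENNReal.ofReal_le_ofReal_iff (Del_nonneg _), ← lintegral_excess,
          ENNReal.ofReal_mul (by positivity), stdCdf_neg_eq, ofReal_measureReal,
          ← lintegral_indicator_const measurableSet_Ici]
        refine lintegral_mono fun y => ?_
        by_cases hy : y ∈ Ici z
        · rw [indicator_of_mem hy]
          have : z ≤ y := hy
          exact ENNReal.ofReal_le_ofReal (by linarith)
        · rw [indicator_of_notMem hy]; exact zero_le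
      linarith
    · have := (tendsto_Del_atTop.comp (tendsto_id.atTop_div_const (r := (2 : ℝ)) (by norm_num))).const_mul 2
      simpa [Function.comp_def] using this
  have hpdf : Tendsto stdPdf atTop (𝓝 0) := by
    have h4 : Tendsto (fun z : ℝ => Real.exp (-z ^ 2 / 2)) atTop (𝓝 0) := by
      refine Real.tendsto_exp_atBot.comp ?_
      have := (tendsto_pow_atTop (α := ℝ) (n := 2) (by norm_num)).atTop_div_const (r := 2) (by norm_num)
      refine (tendsto_neg_atTop_atBot.comp this).congr fun z => ?_
      simp only [Function.comp_apply]; ring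
    rw [show stdPdf = fun z => (√(2 * Real.pi))⁻¹ * Real.exp (-z ^ 2 / 2) from funext stdPdf_eq]
    simpa using h4.const_mul (√(2 * Real.pi))⁻¹
  have hlim : Tendsto G atTop (𝓝 0) := by
    have := tendsto_Del_atTop.sub (hpdf.sub hmul)
    simpa using this
  have : G z = 0 := by
    refine tendsto_nhds_unique ?_ hlim
    rw [show G = fun _ => G z from funext hconst]
    exact tendsto_const_nhds
  simp only [G] at this
  linarith

/-- The hazard rate of the normal distribution. -/
def hazard (z : ℝ) : ℝ := stdPdf z / (1 - stdCdf z)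

/-- Positivity of the right side is the Mills ratio inequality. With `hasDerivAt_hazard` it shows
that the hazard rate increases, whence the uniqueness of `z^*`. -/
theorem hazard_sub (z : ℝ) : hazard z - z = Del z / (1 - stdCdf z) := by
  have h : 1 - stdCdf z ≠ 0 := by have := stdCdf_lt_one z; linarith
  rw [hazard, Del_eq, stdCdf_neg]
  field_simp

theorem hazard_pos (z : ℝ) : 0 < hazard z :=
  div_pos (stdPdf_pos z) (by have := stdCdf_lt_one z; linarith)

theorem hasDerivAt_hazard (z : ℝ) : HasDerivAt hazard (hazard z * (hazard z - z)) z := by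
  have h : 1 - stdCdf z ≠ 0 := by have := stdCdf_lt_one z; linarith
  refine ((hasDerivAt_stdPdf z).div ((hasDerivAt_stdCdf z).const_sub 1) h).congr_deriv ?_
  rw [hazard]
  field_simp
  ring

theorem hazard_strictMono : StrictMono hazard :=
  strictMono_of_deriv_pos fun z => by
    rw [(hasDerivAt_hazard z).deriv, hazard_sub]
    exact mul_pos (hazard_pos z) (div_pos (Del_pos z) (by have := stdCdf_lt_one z; linarith))

/-- By continuity: the hazard rate is below `r` far to the left, where the density is small, and at
least `r` at the point `r` itself, by `hazard_sub`. -/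
theorem exists_hazard_eq {r : ℝ} (hr : 0 < r) : ∃ z, hazard z = r := by
  have hc : Continuous hazard :=
    continuous_iff_continuousAt.2 fun z => (hasDerivAt_hazard z).continuousAt
  have hpdf : ∀ z, stdPdf z ≤ Real.exp (-z ^ 2 / 2) := fun z => by
    rw [stdPdf_eq]
    refine mul_le_of_le_one_left (Real.exp_pos _).le (inv_le_one_of_one_le₀ ?_)
    rw [Real.one_le_sqrt]
    have := Real.pi_gt_three; linarith
  have h1 : ∃ z, hazard z ≤ r := by
    have h2 : Tendsto (fun z : ℝ => 2 * Real.exp (-z ^ 2 / 2)) atTop (𝓝 0) := by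
      have h4 : Tendsto (fun z : ℝ => Real.exp (-z ^ 2 / 2)) atTop (𝓝 0) := by
        refine Real.tendsto_exp_atBot.comp ?_
        have := (tendsto_pow_atTop (α := ℝ) (n := 2) (by norm_num)).atTop_div_const (r := 2) (by norm_num)
        refine (tendsto_neg_atTop_atBot.comp this).congr fun z => ?_
        simp only [Function.comp_apply]; ring
      simpa using h4.const_mul 2
    obtain ⟨w, hw, hw0⟩ := ((h2.eventually (ge_mem_nhds hr)).and (eventually_ge_atTop 0)).exists
    refine ⟨-w, le_trans ?_ hw⟩
    have h3 : stdCdf (-w) ≤ 1 / 2 := by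
      rw [← stdCdf_zero]; exact stdCdf_strictMono.monotone (by linarith)
    have h5 := hpdf (-w)
    rw [neg_sq] at h5
    rw [hazard, div_le_iff₀ (by linarith)]
    nlinarith [Real.exp_pos (-w ^ 2 / 2)]
  obtain ⟨z1, hz1⟩ := h1
  have h6 : r ≤ hazard r := by
    have := hazard_sub r
    have h7 : 0 ≤ Del r / (1 - stdCdf r) :=
      div_nonneg (Del_nonneg r) (by have := stdCdf_lt_one r; linarith)
    linarith
  exact mem_range_of_exists_le_of_exists_ge hc ⟨z1, hz1⟩ ⟨r, h6⟩

/-- The optimal `z` for the cost ratio `r` is the point where the hazard rate is `r`. -/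
theorem stageValue_min {r z : ℝ} (hz : hazard z = r) (w : ℝ) :
    stdCdf z + r * Del z ≤ stdCdf w + r * Del w := by
  -- The derivative has the sign of `hazard w - r`, hence is negative to the left of `z` and
  -- positive to the right.
  have hd : ∀ w, HasDerivAt (fun w => stdCdf w + r * Del w)
      ((1 - stdCdf w) * (hazard w - r)) w := by
    intro w
    have h : 1 - stdCdf w ≠ 0 := by have := stdCdf_lt_one w; linarith
    refine ((hasDerivAt_stdCdf w).add ((hasDerivAt_Del w).const_mul r)).congr_deriv ?_
    rw [hazard, stdCdf_neg]
    field_simp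
    ring
  have hcont : Continuous fun w => stdCdf w + r * Del w :=
    continuous_iff_continuousAt.2 fun w => (hd w).continuousAt
  rcases le_total z w with h | h
  · refine monotoneOn_of_deriv_nonneg (convex_Ici z) hcont.continuousOn
      (fun x _ => (hd x).differentiableAt.differentiableWithinAt) (fun x hx => ?_)
      self_mem_Ici h h
    rw [interior_Ici] at hx
    rw [(hd x).deriv, ← hz]
    exact mul_nonneg (by have := stdCdf_lt_one x; linarith)
      (by have := hazard_strictMono (show z < x from hx); linarith)
  · refine antitoneOn_of_deriv_nonpos (convex_Iic z) hcont.continuousOn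
      (fun x _ => (hd x).differentiableAt.differentiableWithinAt) (fun x hx => ?_)
      h self_mem_Iic h
    rw [interior_Iic] at hx
    rw [(hd x).deriv, ← hz]
    exact mul_nonpos_of_nonneg_of_nonpos (by have := stdCdf_lt_one x; linarith)
      (by have := hazard_strictMono (show x < z from hx); linarith)

end Normal

/-! ### Size, overshoot and remaining distance of a single stage. -/

section Stage

/-- The square root of `stageSize μ x z`. -/
def stageRoot (μ x z : ℝ) : ℝ := (√(4 * x * μ + z ^ 2) - z) / (2 * μ)

variable {μ x : ℝ}

theorem stageRoot_nonneg (hμ : 0 < μ) (hx : 0 ≤ x) (z : ℝ) : 0 ≤ stageRoot μ x z := by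
  refine div_nonneg (sub_nonneg.2 ?_) (by positivity)
  refine Real.le_sqrt_of_sq_le ?_
  have : 0 ≤ x * μ := by positivity
  linarith

/-- This is `(x - μ t) / √t = z` with `√t = stageRoot μ x z`, cleared of denominators. The estimates
for a stage use it in place of the explicit formula. -/
theorem stageRoot_quadratic (hμ : 0 < μ) (hx : 0 ≤ x) (z : ℝ) :
    μ * stageRoot μ x z ^ 2 + z * stageRoot μ x z = x := by
  have hd := Real.sq_sqrt (show 0 ≤ 4 * x * μ + z ^ 2 by positivity)
  rw [stageRoot]
  generalize √(4 * x * μ + z ^ 2) = d at hd ⊢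
  field_simp
  nlinarith

theorem stageRoot_pos (hμ : 0 < μ) (hx : 0 < x) (z : ℝ) : 0 < stageRoot μ x z := by
  refine (stageRoot_nonneg hμ hx.le z).lt_of_ne fun h => ?_
  have := stageRoot_quadratic hμ hx.le z
  rw [← h] at this
  simp at this
  linarith

theorem stageSize_eq (hμ : 0 < μ) (hx : 0 ≤ x) (z : ℝ) :
    (stageSize μ x z : ℝ) = stageRoot μ x z ^ 2 := by
  have hd := Real.sq_sqrt (show 0 ≤ 4 * x * μ + z ^ 2 by positivity)
  have : x / μ - (z * √(4 * x * μ + z ^ 2) - z ^ 2) / (2 * μ ^ 2) = stageRoot μ x z ^ 2 := by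
    rw [stageRoot]
    generalize √(4 * x * μ + z ^ 2) = d at hd ⊢
    field_simp
    nlinarith
  rw [stageSize, this, Real.coe_toNNReal _ (sq_nonneg _)]

theorem sqrt_stageSize (hμ : 0 < μ) (hx : 0 ≤ x) (z : ℝ) :
    √(stageSize μ x z : ℝ) = stageRoot μ x z := by
  rw [stageSize_eq hμ hx, Real.sqrt_sq (stageRoot_nonneg hμ hx z)]

theorem overshoot_eq (t : ℝ≥0) (ht : 0 < t) :
    overshoot μ x t = ENNReal.ofReal (√(t : ℝ) * Del ((x - μ * t) / √(t : ℝ))) := by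
  have hs : 0 < √(t : ℝ) := Real.sqrt_pos.2 (by exact_mod_cast ht)
  rw [ENNReal.ofReal_mul hs.le, ← lintegral_excess, ← lintegral_const_mul _ (by fun_prop)]
  refine lintegral_congr fun y => ?_
  rw [← ENNReal.ofReal_mul hs.le]
  congr 1
  field_simp
  ring

theorem overshoot_stageSize (hμ : 0 < μ) (hx : 0 < x) (z : ℝ) :
    overshoot μ x (stageSize μ x z) = ENNReal.ofReal (stageRoot μ x z * Del z) := by
  have hr := stageRoot_pos hμ hx z
  have ht : 0 < stageSize μ x z := by
    rw [← NNReal.coe_pos, stageSize_eq hμ hx.le]; positivity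
  rw [overshoot_eq _ ht, sqrt_stageSize hμ hx.le, stageSize_eq hμ hx.le]
  congr 3
  rw [div_eq_iff hr.ne']
  have := stageRoot_quadratic hμ hx.le z
  linarith

/-- By the quadratic equation `x - μ t = √t z`, so the remaining distance is simply `√t (z - y)`. -/
theorem kernelAt_stageSize (hμ : 0 < μ) (hx : 0 ≤ x) (z : ℝ) (v : ℝ → ℝ≥0∞) :
    kernelAt μ v x (stageSize μ x z)
      = ∫⁻ y, (Ioi 0).indicator v (stageRoot μ x z * (z - y)) ∂(gaussianReal 0 1) := by
  refine lintegral_congr fun y => ?_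
  rw [sqrt_stageSize hμ hx, stageSize_eq hμ hx]
  congr 1
  have := stageRoot_quadratic hμ hx z
  linarith

theorem stageRoot_le (hμ : 0 < μ) (hx : 0 ≤ x) {z : ℝ} (hz : 0 ≤ z) : stageRoot μ x z ≤ √(x / μ) := by
  have h1 := stageRoot_quadratic hμ hx z
  have h2 := stageRoot_nonneg hμ hx z
  refine Real.le_sqrt_of_sq_le ?_
  rw [le_div_iff₀ hμ]
  nlinarith [mul_nonneg hz h2]

theorem stageRoot_le_abs (hμ : 0 < μ) (hx : 0 ≤ x) (z : ℝ) :
    stageRoot μ x z ≤ √(x / μ) + |z| / μ := by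
  have h1 := stageRoot_quadratic hμ hx z
  have h2 := stageRoot_nonneg hμ hx z
  have h3 := Real.sq_sqrt (show 0 ≤ x / μ by positivity)
  have h4 := Real.sqrt_nonneg (x / μ)
  set s := stageRoot μ x z
  set r := √(x / μ)
  rw [eq_div_iff hμ.ne'] at h3
  by_contra hc
  push Not at hc
  have h5 : 0 ≤ |z| / μ := by positivity
  have h6 : |z| = |z| / μ * μ := by field_simp
  set b := |z| / μ
  have h7 : -z * s ≤ b * μ * s := by
    rw [← h6]; exact mul_le_mul_of_nonneg_right (neg_le_abs z) h2
  have h8 : μ * (s ^ 2 - b * s) ≤ μ * r ^ 2 := by nlinarith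
  have h9 : s ^ 2 - b * s ≤ r ^ 2 := le_of_mul_le_mul_left h8 hμ
  nlinarith

theorem stageRoot_antitone (hμ : 0 < μ) (hx : 0 < x) : Antitone (stageRoot μ x) := by
  intro z w hzw
  have h1 := stageRoot_quadratic hμ hx.le z
  have h2 := stageRoot_quadratic hμ hx.le w
  have h3 := stageRoot_pos hμ hx z
  have h4 := stageRoot_pos hμ hx w
  by_contra hc
  push Not at hc
  set s := stageRoot μ x z
  set r := stageRoot μ x w
  have h5 : μ * s + z = x / s := by rw [eq_div_iff h3.ne']; linarith
  have h6 : μ * r + w = x / r := by rw [eq_div_iff h4.ne']; linarith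
  have h7 : x / r < x / s := div_lt_div_of_pos_left hx h3 hc
  nlinarith

end Stage


/-! ### Samplers as policies that depend on the current distance only. -/

section Policies

/-- Prepend an element to a sequence. -/
def consSeq {α : Type*} (a : α) (s : ℕ → α) : ℕ → α
  | 0 => a
  | k + 1 => s k

/-- The distance to the boundary after `k` stages of the sampler `δ`. -/
def pathDist (δ : ℝ → (ℝ≥0 → ℝ) → ℕ → ℝ≥0) (a : ℝ) (x : ℝ≥0 → ℝ) (k : ℕ) : ℝ :=
  a - x (∑ i ∈ Finset.range k, δ a x i)

/-- The sampler uses the crossing parameters `zf k (D_k)` in the stages `k < n`, where `D_k` is the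
distance to the boundary, and `zf n (D_n)` from then on. -/
def IsPolicy (μ : ℝ) (n : ℕ) (zf : ℕ → ℝ → ℝ) (δ : ℝ → (ℝ≥0 → ℝ) → ℕ → ℝ≥0) : Prop :=
  ∀ (a : ℝ) (x : ℝ≥0 → ℝ), x 0 = 0 → ∀ k, δ a x k =
    if 0 < pathDist δ a x k then
      stageSize μ (pathDist δ a x k) (zf (min k n) (pathDist δ a x (min k n))) else 0

theorem pathDist_zero (δ : ℝ → (ℝ≥0 → ℝ) → ℕ → ℝ≥0) (a : ℝ) {x : ℝ≥0 → ℝ} (hx : x 0 = 0) :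
    pathDist δ a x 0 = a := by simp [pathDist, hx]

theorem geoSampler_eq (μ z : ℝ) (k : ℕ) (a : ℝ) (x : ℝ≥0 → ℝ) (hx : x 0 = 0) :
    geoSampler μ z k a x =
      if 0 < pathDist (fun a x k => geoSampler μ z k a x) a x k then
        stageSize μ (pathDist (fun a x k => geoSampler μ z k a x) a x k) z else 0 := by
  induction k generalizing a x with
  | zero => rw [pathDist_zero _ a hx]; rfl
  | succ k ih =>
    by_cases ha : 0 < a
    · have e : pathDist (fun a x k => geoSampler μ z k a x) a x (k + 1)
          = pathDist (fun a x k => geoSampler μ z k a x) (a - x (stageSize μ a z))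
            (shiftPath x (stageSize μ a z)) k := by
        simp only [pathDist, shiftPath]
        rw [Finset.sum_range_succ']
        simp only [geoSampler, if_pos ha]
        rw [add_comm (stageSize μ a z)]
        ring
      rw [e, ← ih _ _ (by simp [shiftPath]), geoSampler, if_pos ha]
    · have h0 : ∀ i, geoSampler μ z i a x = 0 := by
        intro i; cases i <;> simp [geoSampler, ha]
      simp [pathDist, h0, hx, ha]

theorem isPolicy_geoSampler (μ : ℝ) (ζ : ℝ → ℝ) :
    IsPolicy μ 0 (fun _ => ζ) (fun a x k => geoSampler μ (ζ a) k a x) := by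
  intro a x hx k
  have := geoSampler_eq μ (ζ a) k a x hx
  simp only [Nat.min_zero, pathDist_zero _ a hx]
  exact this

theorem IsPolicy.firstThen {μ : ℝ} {n : ℕ} {zf : ℕ → ℝ → ℝ}
    {next : ℝ → (ℝ≥0 → ℝ) → ℕ → ℝ≥0} (h : IsPolicy μ n zf next) (z : ℝ → ℝ) :
    IsPolicy μ (n + 1) (consSeq z zf)
      (fun a => MultistageSampling.firstThen (stageSize μ a (z a)) next a) := by
  intro a x hx k
  set δ : ℝ → (ℝ≥0 → ℝ) → ℕ → ℝ≥0 :=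
    fun a => MultistageSampling.firstThen (stageSize μ a (z a)) next a with hδ
  by_cases ha : 0 < a
  · have hs : ∀ k, δ a x (k + 1)
        = next (a - x (stageSize μ a (z a))) (shiftPath x (stageSize μ a (z a))) k := by
      intro k; simp [δ, MultistageSampling.firstThen, ha]
    have hz : δ a x 0 = stageSize μ a (z a) := by simp [δ, MultistageSampling.firstThen, ha]
    have e : ∀ k, pathDist δ a x (k + 1) = pathDist next (a - x (stageSize μ a (z a)))
        (shiftPath x (stageSize μ a (z a))) k := by
      intro k
      simp only [pathDist, shiftPath]
      rw [Finset.sum_range_succ']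
      simp only [hs, hz]
      rw [add_comm (stageSize μ a (z a))]
      ring
    cases k with
    | zero => simp [pathDist_zero _ a hx, ha, hz, consSeq]
    | succ k =>
      rw [hs, h _ _ (by simp [shiftPath]) k, Nat.add_min_add_right, e, e]
      rfl
  · have h0 : ∀ i, δ a x i = 0 := by
      intro i; simp [δ, MultistageSampling.firstThen, ha]
    have hd : ∀ i, pathDist δ a x i = a := by intro i; simp [pathDist, h0, hx]
    rw [h0, hd, if_neg ha]

/-- The crossing parameters of `samplerO μ (m + 1) g`. -/
def paramsO (μ : ℝ) : ℕ → (ℝ → ℝ) → ℕ → ℝ → ℝ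
  | 0, g => fun _ => zetaFun g
  | m + 1, g => consSeq (fun a => √(Real.log (a / g a ^ 2 + 1))) (paramsO μ m (g ∘ fInv μ))

/-- The crossing parameters of `samplerPlus μ (m + 1) z`. -/
def paramsPlus : ℕ → ℝ → ℕ → ℝ → ℝ
  | 0, z => consSeq (fun _ => z) (fun _ => nuFun)
  | m + 1, z => consSeq (fun a => √((1 - (1 / 2 : ℝ) ^ (m + 1)) * Real.log (a + 1)))
      (paramsPlus m z)

theorem isPolicy_samplerO (μ : ℝ) (m : ℕ) (g : ℝ → ℝ) :
    IsPolicy μ m (paramsO μ m g) (samplerO μ (m + 1) g) := by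
  induction m generalizing g with
  | zero => exact isPolicy_geoSampler μ (zetaFun g)
  | succ m ih => exact (ih (g ∘ fInv μ)).firstThen _

theorem isPolicy_samplerPlus (μ : ℝ) (m : ℕ) (z : ℝ) :
    IsPolicy μ (m + 1) (paramsPlus m z) (samplerPlus μ (m + 1) z) := by
  induction m with
  | zero => exact (isPolicy_geoSampler μ nuFun).firstThen fun _ => z
  | succ m ih => exact ih.firstThen _

theorem IsPolicy.pathDist_pos {μ : ℝ} {n : ℕ} {zf : ℕ → ℝ → ℝ}
    {δ : ℝ → (ℝ≥0 → ℝ) → ℕ → ℝ≥0} (h : IsPolicy μ n zf δ) {a : ℝ} {x : ℝ≥0 → ℝ} (hx : x 0 = 0)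
    {j k : ℕ} (hjk : j ≤ k) (hk : 0 < pathDist δ a x k) : 0 < pathDist δ a x j := by
  by_contra hj
  have : ∀ i, j ≤ i → pathDist δ a x i = pathDist δ a x j := by
    intro i hi
    induction i, hi using Nat.le_induction with
    | base => rfl
    | succ i _ ih =>
      have h0 : δ a x i = 0 := by rw [h a x hx i, if_neg (by rw [ih]; exact hj)]
      rw [← ih]
      simp [pathDist, Finset.sum_range_succ, h0]
  rw [this k hjk] at hk
  exact hj hk

/-- Parameters are used only at positive distances, so they may be replaced by their extensions by
zero. This is needed because regularity is only available on `(0, ∞)`. -/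
theorem IsPolicy.congr {μ : ℝ} {n : ℕ} {zf zf' : ℕ → ℝ → ℝ}
    {δ : ℝ → (ℝ≥0 → ℝ) → ℕ → ℝ≥0} (h : IsPolicy μ n zf δ)
    (he : ∀ i x, 0 < x → zf i x = zf' i x) : IsPolicy μ n zf' δ := by
  intro a x hx k
  rw [h a x hx k]
  split_ifs with hk
  · rw [he _ _ (h.pathDist_pos hx (min_le_left k n) hk)]
  · rfl

theorem measurable_stageSize (μ : ℝ) : Measurable (fun p : ℝ × ℝ => stageSize μ p.1 p.2) := by
  unfold stageSize
  exact Measurable.real_toNNReal (by fun_prop)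

variable {Ω : Type*} {X : ℝ≥0 → Ω → ℝ}

/-- Induction on the stage: a stage size is a measurable function of the distances at the ends of
earlier stages, so it is known when the stage begins, and the next end time is again a stopping
time. -/
theorem IsPolicy.isSamplingRule {μ : ℝ} {n : ℕ} {zf : ℕ → ℝ → ℝ}
    {δ : ℝ → (ℝ≥0 → ℝ) → ℕ → ℝ≥0} (h : IsPolicy μ n zf δ)
    (hzf : ∀ i, 1 ≤ i → i ≤ n → Measurable (zf i))
    (hc : ∀ ω, Continuous fun t => X t ω) (h0 : ∀ ω, X 0 ω = 0) (a : ℝ) :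
    IsSamplingRule X (applied δ a X) := by
  set T := applied δ a X with hT
  have hstage : ∀ k (hs : ∀ j ≤ k, ∀ t, MeasurableSet[past X t] {ω | endTime T j ω ≤ t}),
      Measurable[pastAt X (endTime T k) (hs k le_rfl)] (T k) := by
    intro k hs
    have hD : ∀ j (hj : j ≤ k), Measurable[pastAt X (endTime T k) (hs k le_rfl)]
        (distAt X a T j) := fun j hj =>
      ((measurable_pastAt_eval hc (hs j hj)).const_sub a).mono
        (pastAt_mono (endTime_mono T hj) _ _) le_rfl
    have e : T k = fun ω => if 0 < distAt X a T k ω then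
        stageSize μ (distAt X a T k ω) (zf (min k n) (distAt X a T (min k n) ω)) else 0 := by
      ext ω
      exact congrArg NNReal.toReal (h a (fun s => X s ω) (h0 ω) k)
    have hz : Measurable[pastAt X (endTime T k) (hs k le_rfl)]
        (fun ω => zf (min k n) (distAt X a T (min k n) ω)) := by
      -- The first distance is the constant `a`, so the parameter used there needs no measurability.
      -- This is why the sampler for the first band imposes none on `g`.
      rcases Nat.eq_zero_or_pos (min k n) with hi | hi
      · rw [hi]
        simp only [distAt_zero h0]
        exact measurable_const
      · exact (hzf _ hi (min_le_right k n)).comp (hD _ (min_le_left k n))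
    rw [e]
    let _ := pastAt X (endTime T k) (hs k le_rfl)
    exact Measurable.ite ((hD k le_rfl) measurableSet_Ioi)
      ((measurable_stageSize μ).comp ((hD k le_rfl).prodMk hz)) measurable_const
  have hend : ∀ k, ∀ j ≤ k, ∀ t, MeasurableSet[past X t] {ω | endTime T j ω ≤ t} := by
    intro k
    induction k with
    | zero =>
      intro j hj t
      obtain rfl : j = 0 := by omega
      have : {ω | endTime T 0 ω ≤ t} = univ := by ext; simp [endTime]
      rw [this]; exact MeasurableSet.univ
    | succ k ih =>
      intro j hj t
      rcases Nat.lt_or_ge j (k + 1) with h1 | h1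
      · exact ih j (by omega) t
      · obtain rfl : j = k + 1 := by omega
        simp_rw [endTime_succ]
        exact stopping_add _ (hstage k ih) t
  intro k t
  exact indicator_measurable_of_pastAt _ (hstage k (hend k)) t

end Policies

/-! ### Upper bounds for geometric sampling and for general policies. -/

section UpperBound

/-- The constants in the bound for geometric sampling. -/
def rootConst (μ : ℝ) : ℝ := 1 / √μ + 1 / μ

def geoConst (μ : ℝ) : ℝ := 2 * rootConst μ / μ

def geoConst' (μ : ℝ) : ℝ :=
  2 * (rootConst μ / μ + geoConst μ / 2 + geoConst μ * rootConst μ / 2)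

/-- A bound for the expected cost of geometric sampling, without the time `x / μ`. -/
def geoBound (μ c x z : ℝ) : ℝ :=
  c / (1 - stdCdf z) + (geoConst μ * √x + geoConst' μ * (|z| + 1)) * (|z| + 1)

theorem rootConst_pos {μ : ℝ} (hμ : 0 < μ) : 0 < rootConst μ := by
  unfold rootConst; positivity

theorem geoConst_pos {μ : ℝ} (hμ : 0 < μ) : 0 < geoConst μ := by
  have := rootConst_pos hμ
  unfold geoConst; positivity

theorem geoConst'_pos {μ : ℝ} (hμ : 0 < μ) : 0 < geoConst' μ := by
  have := rootConst_pos hμ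
  have := geoConst_pos hμ
  unfold geoConst'; positivity

theorem stageRoot_le_rootConst {μ x : ℝ} (hμ : 0 < μ) (hx : 0 ≤ x) (z : ℝ) :
    stageRoot μ x z ≤ rootConst μ * (√x + |z|) := by
  refine (stageRoot_le_abs hμ hx z).trans ?_
  rw [Real.sqrt_div hx, rootConst]
  have h1 : 0 ≤ √x := Real.sqrt_nonneg x
  have h2 : 0 ≤ |z| := abs_nonneg z
  have h3 : √x / √μ = 1 / √μ * √x := by ring
  have h4 : |z| / μ = 1 / μ * |z| := by ring
  have h5 : 0 ≤ 1 / √μ := by positivity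
  have h6 : 0 ≤ 1 / μ := by positivity
  rw [h3, h4]
  nlinarith [mul_nonneg h5 h2, mul_nonneg h6 h1]

/-- The concave square root is linearized by `√u ≤ η u + 1 / (4 η)`. Since `z ≤ 0`, the distance `r
(z - y)` is at most `r (1 + y²) / 2`, of mean at most `r`. -/
theorem lintegral_sqrt_le {r R A η z : ℝ} (hr : 0 ≤ r) (hR : 0 ≤ R) (hA : 0 ≤ A) (hη : 0 < η)
    (hz : z ≤ 0) :
    ∫⁻ y, (Ioi 0).indicator (fun y => ENNReal.ofReal (R + A * √y)) (r * (z - y)) ∂(gaussianReal 0 1)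
      ≤ ENNReal.ofReal (R * stdCdf z + A * (η * r + 1 / (4 * η))) := by
  have i1 : Integrable (fun y : ℝ => (1 + y ^ 2) / 2) (gaussianReal 0 1) :=
    ((integrable_const 1).add integrable_sq_gaussian).div_const 2
  have hi1 : Integrable ((Iio z).indicator fun _ => R) (gaussianReal 0 1) :=
    (integrable_const R).indicator measurableSet_Iio
  have hi2 : Integrable (fun y : ℝ => A * (η * r * ((1 + y ^ 2) / 2) + 1 / (4 * η)))
      (gaussianReal 0 1) :=
    ((i1.const_mul (η * r)).add (integrable_const _)).const_mul A
  have e1 : ∫ y, ((Iio z).indicator (fun _ => R) y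
      + A * (η * r * ((1 + y ^ 2) / 2) + 1 / (4 * η))) ∂(gaussianReal 0 1)
      = R * stdCdf z + A * (η * r + 1 / (4 * η)) := by
    rw [integral_add hi1 hi2, integral_indicator measurableSet_Iio, integral_const_mul,
      integral_add (i1.const_mul _) (integrable_const _), integral_const_mul, integral_div,
      integral_add (integrable_const _) integrable_sq_gaussian, integral_sq_gaussian]
    have : (gaussianReal 0 1).real (Iio z) = stdCdf z := by
      rw [stdCdf_eq, measureReal_def, measureReal_def, gaussian_Iio]
    simp only [integral_const, measureReal_restrict_apply_univ, this, probReal_univ, smul_eq_mul]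
    ring
  have hi3 : Integrable (fun y => (Iio z).indicator (fun _ => R) y
      + A * (η * r * ((1 + y ^ 2) / 2) + 1 / (4 * η))) (gaussianReal 0 1) := hi1.add hi2
  rw [← e1, ofReal_integral_eq_lintegral_ofReal hi3 (ae_of_all _ fun y => by
    have : 0 ≤ (Iio z).indicator (fun _ => R) y := indicator_nonneg (fun _ _ => hR) y
    simp only [Pi.zero_apply]
    positivity)]
  refine lintegral_mono fun y => ?_
  by_cases hy : r * (z - y) ∈ Ioi 0
  · rw [indicator_of_mem hy]
    have hy1 : 0 < r * (z - y) := hy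
    have hyz : y < z := by
      by_contra hc
      push Not at hc
      nlinarith
    rw [indicator_of_mem (show y ∈ Iio z from hyz)]
    refine ENNReal.ofReal_le_ofReal (add_le_add le_rfl (mul_le_mul_of_nonneg_left ?_ hA))
    have h2 := Real.sq_sqrt hy1.le
    generalize √(r * (z - y)) = s at h2
    have h3 : s ≤ η * s ^ 2 + 1 / (4 * η) := by
      have : η * s ^ 2 + 1 / (4 * η) - s = η * (s - 1 / (2 * η)) ^ 2 := by
        field_simp; ring
      have h4 : 0 ≤ η * (s - 1 / (2 * η)) ^ 2 := by positivity
      linarith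
    have h5 : s ^ 2 ≤ r * ((1 + y ^ 2) / 2) := by
      rw [h2]
      refine mul_le_mul_of_nonneg_left ?_ hr
      nlinarith [sq_nonneg (y + 1)]
    have h6 := mul_le_mul_of_nonneg_left h5 hη.le
    linarith
  · rw [indicator_of_notMem hy]; exact zero_le

theorem geoBound_aux {A C K q s : ℝ} (hA : 0 ≤ A) (hC : 0 ≤ C) (hq : 1 ≤ q)
    (hK : K = 2 * (A + A * C / 2)) :
    q * (A / 2 * (s + q)) + q * A * ((s + q) / 2 + C / 2) + K * q ^ 2 / 2
      ≤ (A * s + K * q) * q := by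
  have h0 : 0 ≤ A * C := by positivity
  have h2 : A * C * q ≤ A * C * q ^ 2 := mul_le_mul_of_nonneg_left (by nlinarith) h0
  have h3 : (A * s + K * q) * q - (q * (A / 2 * (s + q)) + q * A * ((s + q) / 2 + C / 2)
      + K * q ^ 2 / 2) = (A * C * q ^ 2 - A * C * q) / 2 := by
    rw [hK]; ring
  linarith

/-- Stages are geometric with failure probability `Φ(z)`, and `R = c / (1 - Φ(z))` solves `R = c + R
Φ(z)` exactly. For `z ≤ 0` this probability is at most `1 / 2`, which leaves half of the constant
term to spare; the term in `√x` is also halved by one stage. The spare halves pay for the overshoot.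
-/
theorem geoBound_super {μ c x z : ℝ} (hμ : 0 < μ) (hc : 0 ≤ c) (hx : 0 < x) (hz : z ≤ 0) :
    ENNReal.ofReal c + (ENNReal.ofReal μ)⁻¹ * overshoot μ x (stageSize μ x z)
      + kernelAt μ (fun y => ENNReal.ofReal (geoBound μ c y z)) x (stageSize μ x z)
      ≤ ENNReal.ofReal (geoBound μ c x z) := by
  have hp : 0 < 1 - stdCdf z := by have := stdCdf_lt_one z; linarith
  have hΦ : stdCdf z ≤ 1 / 2 := by rw [← stdCdf_zero]; exact stdCdf_strictMono.monotone hz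
  have hΦ0 := stdCdf_nonneg z
  have hDel0 := Del_nonneg z
  rw [overshoot_stageSize hμ hx, kernelAt_stageSize hμ hx.le]
  have hr0 := stageRoot_nonneg hμ hx.le z
  have hr := stageRoot_le_rootConst hμ hx.le z
  have hC := rootConst_pos hμ
  have hA := geoConst_pos hμ
  have hB := geoConst'_pos hμ
  have hDel := Del_le_abs z
  have hA2 : rootConst μ / μ = geoConst μ / 2 := by rw [geoConst]; field_simp
  have hK2 : geoConst' μ = 2 * (geoConst μ + geoConst μ * rootConst μ / 2) := by
    rw [geoConst', hA2]; ring
  simp only [geoBound]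
  generalize stageRoot μ x z = r at hr0 hr ⊢
  generalize geoConst μ = A at hA hA2 hK2 ⊢
  generalize geoConst' μ = K at hB hK2 ⊢
  generalize rootConst μ = C at hr hC hA2 hK2 ⊢
  have hq1 : 1 ≤ |z| + 1 := by have := abs_nonneg z; linarith
  have hr' : r ≤ C * (√x + (|z| + 1)) := hr.trans (by gcongr; linarith)
  generalize |z| + 1 = q at hq1 hr' hDel ⊢
  have hsx : 0 ≤ √x := Real.sqrt_nonneg x
  -- With `η = 1 / (2 C)` and `r ≤ C (√x + q)` the new coefficient of `√x` is half of the old one.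
  have hker := lintegral_sqrt_le (r := r) (R := c / (1 - stdCdf z) + K * q ^ 2) (A := q * A)
    (η := 1 / (2 * C)) (z := z) hr0 (by positivity) (by positivity) (by positivity) hz
  have e0 : ∀ y : ℝ, c / (1 - stdCdf z) + (A * √y + K * q) * q
      = c / (1 - stdCdf z) + K * q ^ 2 + q * A * √y := fun y => by ring
  simp only [← e0] at hker
  refine (add_le_add le_rfl hker).trans ?_
  rw [← ENNReal.ofReal_inv_of_pos hμ, ← ENNReal.ofReal_mul (by positivity),
    ← ENNReal.ofReal_add hc (by positivity),
    ← ENNReal.ofReal_add (by positivity) (by positivity)]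
  refine ENNReal.ofReal_le_ofReal ?_
  have e2 : c + c / (1 - stdCdf z) * stdCdf z = c / (1 - stdCdf z) := by
    field_simp; ring
  have e3 : μ⁻¹ * (r * Del z) ≤ q * (A / 2 * (√x + q)) := by
    rw [← hA2]
    calc μ⁻¹ * (r * Del z) ≤ μ⁻¹ * (C * (√x + q) * q) := by gcongr
      _ = _ := by field_simp
  have e4 : 1 / (2 * C) * r ≤ (√x + q) / 2 := by
    calc 1 / (2 * C) * r ≤ 1 / (2 * C) * (C * (√x + q)) := by gcongr
      _ = _ := by field_simp
  have e5 : 1 / (4 * (1 / (2 * C))) = C / 2 := by field_simp; ring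
  have e6 : q * A * (1 / (2 * C) * r + 1 / (4 * (1 / (2 * C))))
      ≤ q * A * ((√x + q) / 2 + C / 2) := by
    rw [e5]; gcongr
  have e7 : K * q ^ 2 * stdCdf z ≤ K * q ^ 2 / 2 := by
    calc K * q ^ 2 * stdCdf z ≤ K * q ^ 2 * (1 / 2) := by gcongr
      _ = _ := by ring
  have e8 := geoBound_aux (s := √x) hA.le hC.le hq1 hK2
  rw [add_mul]
  linarith

/-- One stage with the parameter `z`, followed by a procedure of cost `v`. -/
def stageStep (μ c : ℝ) (z : ℝ → ℝ) (v : ℝ → ℝ≥0∞) (x : ℝ) : ℝ≥0∞ :=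
  ENNReal.ofReal c + (ENNReal.ofReal μ)⁻¹ * overshoot μ x (stageSize μ x (z x))
    + kernelAt μ v x (stageSize μ x (z x))

/-- A bound for the cost of a policy, without the time `x / μ`. -/
def policyBound (μ c : ℝ) : ℕ → (ℕ → ℝ → ℝ) → ℝ → ℝ≥0∞
  | 0, zf => fun x => ENNReal.ofReal (geoBound μ c x (zf 0 x))
  | n + 1, zf => stageStep μ c (zf 0) (policyBound μ c n fun k => zf (k + 1))

theorem policyBound_congr (μ c : ℝ) (n : ℕ) {zf zf' : ℕ → ℝ → ℝ}
    (he : ∀ i x, 0 < x → zf i x = zf' i x) {x : ℝ} (hx : 0 < x) :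
    policyBound μ c n zf x = policyBound μ c n zf' x := by
  induction n generalizing zf zf' x with
  | zero => simp only [policyBound, he 0 x hx]
  | succ n ih =>
    simp only [policyBound, stageStep, he 0 x hx]
    rw [kernelAt_congr fun y hy => ih (fun i x hx => he (i + 1) x hx) hy]

theorem measurable_kernelAt (μ : ℝ) {v : ℝ → ℝ≥0∞} (hv : Measurable v) :
    Measurable (fun p : ℝ × ℝ≥0 => kernelAt μ v p.1 p.2) := by
  unfold kernelAt
  have : Measurable (fun q : (ℝ × ℝ≥0) × ℝ =>
      (Ioi 0).indicator v (q.1.1 - μ * q.1.2 - √(q.1.2 : ℝ) * q.2)) :=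
    (hv.indicator measurableSet_Ioi).comp (by fun_prop)
  exact this.lintegral_prod_right'

theorem measurable_overshoot (μ : ℝ) :
    Measurable (fun p : ℝ × ℝ≥0 => overshoot μ p.1 p.2) := by
  unfold overshoot
  have : Measurable (fun q : (ℝ × ℝ≥0) × ℝ =>
      ENNReal.ofReal (√(q.1.2 : ℝ) * q.2 + μ * q.1.2 - q.1.1)) := by fun_prop
  exact this.lintegral_prod_right'

theorem measurable_geoBound (μ c : ℝ) : Measurable (fun p : ℝ × ℝ => geoBound μ c p.1 p.2) := by
  have := continuous_stdCdf.measurable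
  unfold geoBound
  fun_prop

theorem measurable_stageStep {μ c : ℝ} {z : ℝ → ℝ} (hz : Measurable z) {v : ℝ → ℝ≥0∞}
    (hv : Measurable v) : Measurable (stageStep μ c z v) := by
  have h1 : Measurable fun x => (x, stageSize μ x (z x)) :=
    measurable_id.prodMk ((measurable_stageSize μ).comp (measurable_id.prodMk hz))
  exact (((measurable_overshoot μ).comp h1).const_mul _ |>.const_add _).add
    ((measurable_kernelAt μ hv).comp h1)

theorem measurable_policyBound (μ c : ℝ) (n : ℕ) {zf : ℕ → ℝ → ℝ}
    (hzf : ∀ i, i ≤ n → Measurable (zf i)) : Measurable (policyBound μ c n zf) := by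
  induction n generalizing zf with
  | zero =>
    exact ((measurable_geoBound μ c).comp
      (measurable_id.prodMk (hzf 0 le_rfl))).ennreal_ofReal
  | succ n ih =>
    exact measurable_stageStep (hzf 0 (Nat.zero_le _)) (ih fun i hi => hzf (i + 1) (by omega))

variable {Ω : Type*} [MeasurableSpace Ω] {P : Measure Ω} {B : ℝ≥0 → Ω → ℝ}

/-- For `k ≤ n` the potential uses the recursive bound for the rest of the policy; afterwards it
uses `geoBound` with the frozen parameter. Wald's identity makes the potential decrease by at least
the cost of each stage. -/
theorem IsPolicy.stageCost_le (hB : IsPreBrownianReal B P)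
    (hmeas : ∀ t, Measurable (B t)) (hcont : ∀ ω, Continuous fun t => B t ω)
    (hzero : ∀ ω, B 0 ω = 0) {μ : ℝ} (hμ : 0 < μ) {n : ℕ} {zf : ℕ → ℝ → ℝ}
    {δ : ℝ → (ℝ≥0 → ℝ) → ℕ → ℝ≥0} (h : IsPolicy μ n zf δ)
    (hzf : ∀ i, 1 ≤ i → i ≤ n → Measurable (zf i)) (hneg : ∀ x, 0 < x → zf n x ≤ 0)
    {a c : ℝ} (ha : 0 < a) (hc0 : 0 ≤ c) :
    stageCost P (drifted μ B) c a (applied δ a (drifted μ B))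
      ≤ ENNReal.ofReal (a / μ) + policyBound μ c n zf a := by
  have hP : IsProbabilityMeasure P := hB.isGaussianProcess.isProbabilityMeasure
  have hc := continuous_drifted hcont μ
  have h0 : ∀ ω, drifted μ B 0 ω = 0 := fun ω => by simp [drifted, hzero]
  have hT := h.isSamplingRule hzf hc h0 a
  set X := drifted μ B with hX
  set T := applied δ a X with hTdef
  have hle := fun k => pastAt_le (measurable_drifted hmeas μ) (hT.stopping k)
  have hAm : ∀ k, MeasurableSet (alive X a T k) := fun k =>
    hle k _ (hT.measurableSet_alive hc a k)
  have hTm : ∀ k, Measurable (fun ω => (T k ω : ℝ≥0∞)) := fun k =>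
    measurable_coe_nnreal_ennreal.comp ((hT.measurable_stage k).mono (hle k) le_rfl)
  have hTk : ∀ k ω, ω ∈ alive X a T k →
      T k ω = stageSize μ (distAt X a T k ω) (zf (min k n) (distAt X a T (min k n) ω)) := by
    intro k ω hω
    have := h a (fun s => X s ω) (h0 ω) k
    exact this.trans (if_pos (hω k le_rfl))
  have hμ' : ENNReal.ofReal μ ≠ 0 := by simpa using hμ
  -- the potential: remaining time plus the bound for the rest of the policy
  let w : ℕ → Ω → ℝ≥0∞ := fun k ω =>
    if k ≤ n then policyBound μ c (n - k) (fun i => zf (k + i)) (distAt X a T k ω)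
    else ENNReal.ofReal (geoBound μ c (distAt X a T k ω) (zf n (distAt X a T n ω)))
  have hstep : ∀ (x : ℝ) (t : ℝ≥0) (v : ℝ → ℝ≥0∞), 0 < x →
      (t : ℝ≥0∞) + ENNReal.ofReal c
        + kernelAt μ (fun y => (ENNReal.ofReal μ)⁻¹ * ENNReal.ofReal y + v y) x t
      = (ENNReal.ofReal μ)⁻¹ * ENNReal.ofReal x + (ENNReal.ofReal c
        + (ENNReal.ofReal μ)⁻¹ * overshoot μ x t + kernelAt μ v x t) := by
    intro x t v hx
    rw [kernelAt_add (by fun_prop), kernelAt_const_mul ENNReal.measurable_ofReal]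
    have h1 := congrArg (fun r => (ENNReal.ofReal μ)⁻¹ * r) (kernelAt_ofReal_add hμ hx.le t)
    simp only [mul_add, ← mul_assoc, ENNReal.inv_mul_cancel hμ' ENNReal.ofReal_ne_top,
      one_mul] at h1
    calc _ = ((ENNReal.ofReal μ)⁻¹ * kernelAt μ ENNReal.ofReal x t + t)
          + (ENNReal.ofReal c + kernelAt μ v x t) := by ring
      _ = _ := by rw [h1]; ring
  have key := MultistageSampling.stageCost_le (P := P) (X := X) (c := c) (a := a) (T := T)
    (fun k ω => (ENNReal.ofReal μ)⁻¹ * ENNReal.ofReal (distAt X a T k ω) + w k ω) ?_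
  · refine key.trans_eq ?_
    rw [alive_zero ha h0]
    have hw0 : ∀ ω, w 0 ω = policyBound μ c n zf a := by
      intro ω
      simp only [w, Nat.zero_le, if_true, Nat.sub_zero, Nat.zero_add, distAt_zero h0]
    simp only [hw0, distAt_zero h0]
    simp only [Measure.restrict_univ, lintegral_const, measure_univ, mul_one]
    rw [ENNReal.ofReal_div_of_pos hμ, div_eq_mul_inv, mul_comm]
  intro k
  rcases Nat.lt_or_ge k n with hk | hk
  · -- a stage of the first kind
    have hv : Measurable (policyBound μ c (n - (k + 1)) (fun i => zf (k + 1 + i))) :=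
      measurable_policyBound μ c _ fun i hi => hzf _ (by omega) (by omega)
    have h1 := lintegral_alive_succ hB hmeas hcont hT a k (Z := fun _ => 0) measurable_const
      (ψ := fun _ y => (ENNReal.ofReal μ)⁻¹ * ENNReal.ofReal y
        + policyBound μ c (n - (k + 1)) (fun i => zf (k + 1 + i)) y)
      (by
        show Measurable (fun p : ℝ × ℝ => (ENNReal.ofReal μ)⁻¹ * ENNReal.ofReal p.2
          + policyBound μ c (n - (k + 1)) (fun i => zf (k + 1 + i)) p.2)
        fun_prop)
    have hw1 : ∀ ω, w (k + 1) ω = policyBound μ c (n - (k + 1)) (fun i => zf (k + 1 + i))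
        (distAt X a T (k + 1) ω) := by
      intro ω; simp only [w, if_pos (show k + 1 ≤ n by omega)]
    simp only [hw1]
    rw [h1, ← lintegral_add_left ((hTm k).add_const _)]
    refine setLIntegral_mono' (hAm k) fun ω hω => ?_
    rw [hstep _ _ _ (hω k le_rfl)]
    refine add_le_add le_rfl ?_
    simp only [w, if_pos hk.le]
    rw [hTk k ω hω, show min k n = k from min_eq_left hk.le]
    rw [show n - k = (n - (k + 1)) + 1 by omega, policyBound, stageStep]
    refine le_of_eq ?_
    simp only [add_zero]
    congr 2
    ext y
    congr 2
    ext i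
    congr 1
    omega
  -- From stage `n` on the parameter is a random variable fixed at that stage. It is known at every
  -- later stage and is passed through the conditional law as `Z`.
  · have hZ : Measurable[hT.known k] (fun ω => zf n (distAt X a T n ω)) := by
      rcases Nat.eq_zero_or_pos n with hn | hn
      · subst hn
        simp only [distAt_zero h0]
        exact measurable_const
      · exact (hzf n hn le_rfl).comp (hT.measurable_distAt hc a hk)
    have h1 := lintegral_alive_succ hB hmeas hcont hT a k hZ
      (ψ := fun z y => (ENNReal.ofReal μ)⁻¹ * ENNReal.ofReal y
        + ENNReal.ofReal (geoBound μ c y z))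
      (by
        have hg := (measurable_geoBound μ c).comp (measurable_snd.prodMk measurable_fst)
        show Measurable (fun p : ℝ × ℝ => (ENNReal.ofReal μ)⁻¹ * ENNReal.ofReal p.2
          + ENNReal.ofReal (geoBound μ c p.2 p.1))
        exact (ENNReal.measurable_ofReal.comp measurable_snd).const_mul _ |>.add
          hg.ennreal_ofReal)
    have hw1 : ∀ ω, w (k + 1) ω = ENNReal.ofReal (geoBound μ c (distAt X a T (k + 1) ω)
        (zf n (distAt X a T n ω))) := by
      intro ω; simp only [w, if_neg (show ¬ k + 1 ≤ n by omega)]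
    have hw : ∀ ω, w k ω = ENNReal.ofReal (geoBound μ c (distAt X a T k ω)
        (zf n (distAt X a T n ω))) := by
      intro ω
      by_cases hkn : k ≤ n
      · obtain rfl : k = n := by omega
        simp only [w, le_refl, if_true, Nat.sub_self, policyBound, add_zero]
      · simp only [w, if_neg hkn]
    simp only [hw1, hw]
    rw [h1, ← lintegral_add_left ((hTm k).add_const _)]
    refine setLIntegral_mono' (hAm k) fun ω hω => ?_
    rw [hstep _ _ _ (hω k le_rfl)]
    refine add_le_add le_rfl ?_
    rw [hTk k ω hω, show min k n = n from min_eq_right hk]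
    exact geoBound_super hμ hc0 (hω k le_rfl) (hneg _ (hω n hk))

end UpperBound


/-! ### Asymptotics of the critical functions and the recursion for their constants. -/

section Critical

theorem crit_eq {m : ℕ} (hm : 1 ≤ m) (x : ℝ) :
    crit m x = x ^ ((1 / 2 : ℝ) ^ m) * Real.log x ^ (1 / 2 - (1 / 2 : ℝ) ^ m) := by
  cases m with
  | zero => omega
  | succ m => rfl

theorem half_pow_pos (m : ℕ) : (0 : ℝ) < (1 / 2 : ℝ) ^ m := by positivity

theorem half_pow_le {m : ℕ} (hm : 1 ≤ m) : (1 / 2 : ℝ) ^ m ≤ 1 / 2 := by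
  calc (1 / 2 : ℝ) ^ m ≤ (1 / 2 : ℝ) ^ 1 := pow_le_pow_of_le_one (by norm_num) (by norm_num) hm
    _ = 1 / 2 := by norm_num

theorem crit_pos {m : ℕ} (hm : 1 ≤ m) {x : ℝ} (hx : 1 < x) : 0 < crit m x := by
  rw [crit_eq hm]
  have := Real.log_pos hx
  positivity

theorem crit_monotoneOn {m : ℕ} (hm : 1 ≤ m) : MonotoneOn (crit m) (Ici 1) := by
  intro x hx y hy hxy
  have hx' : (1 : ℝ) ≤ x := hx
  have h1 := Real.log_nonneg hx'
  have h2 : Real.log x ≤ Real.log y := Real.log_le_log (by linarith) hxy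
  have := half_pow_le hm
  rw [crit_eq hm, crit_eq hm]
  have h3 : x ^ ((1 / 2 : ℝ) ^ m) ≤ y ^ ((1 / 2 : ℝ) ^ m) :=
    Real.rpow_le_rpow (by linarith) hxy (half_pow_pos m).le
  have h4 : Real.log x ^ (1 / 2 - (1 / 2 : ℝ) ^ m) ≤ Real.log y ^ (1 / 2 - (1 / 2 : ℝ) ^ m) :=
    Real.rpow_le_rpow h1 h2 (by linarith)
  exact mul_le_mul h3 h4 (Real.rpow_nonneg h1 _) (Real.rpow_nonneg (by linarith) _)

theorem rpow_le_crit {m : ℕ} (hm : 1 ≤ m) {x : ℝ} (hx : Real.exp 1 ≤ x) :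
    x ^ ((1 / 2 : ℝ) ^ m) ≤ crit m x := by
  have hx0 : 0 < x := (Real.exp_pos 1).trans_le hx
  have h1 : 1 ≤ Real.log x := (Real.le_log_iff_exp_le hx0).2 hx
  have := half_pow_le hm
  rw [crit_eq hm]
  exact le_mul_of_one_le_right (by positivity) (Real.one_le_rpow h1 (by linarith))

theorem tendsto_crit {m : ℕ} (hm : 1 ≤ m) : Tendsto (crit m) atTop atTop := by
  refine tendsto_atTop_mono' _ ?_ (tendsto_rpow_atTop (half_pow_pos m))
  filter_upwards [eventually_ge_atTop (Real.exp 1)] with x hx using rpow_le_crit hm hx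

theorem crit_le_sqrt {m : ℕ} (hm : 1 ≤ m) {x : ℝ} (hx : 1 ≤ x) : crit m x ≤ √x := by
  have := half_pow_le hm
  have h1 : Real.log x ≤ x := (Real.log_le_sub_one_of_pos (by linarith)).trans (by linarith)
  rw [crit_eq hm, Real.sqrt_eq_rpow]
  calc _ ≤ x ^ ((1 / 2 : ℝ) ^ m) * x ^ (1 / 2 - (1 / 2 : ℝ) ^ m) := by
        gcongr
        exact Real.log_nonneg hx
    _ = x ^ (1 / 2 : ℝ) := by
        rw [← Real.rpow_add (by linarith)]; congr 1; ring

theorem crit_one_eq (x : ℝ) : crit 1 x = √x := by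
  rw [crit_eq le_rfl, Real.sqrt_eq_rpow]; norm_num

theorem tendsto_loglog_div_log :
    Tendsto (fun a : ℝ => Real.log (Real.log a) / Real.log a) atTop (𝓝 0) :=
  (Real.isLittleO_log_id_atTop.tendsto_div_nhds_zero).comp Real.tendsto_log_atTop

/-- If `y` is of the order of `√(a log a)` then `h_m(y)` is of the order of `h_{m+1}(a)`. -/
theorem tendsto_crit_div {m : ℕ} (hm : 1 ≤ m) {y : ℝ → ℝ} {b : ℝ} (hb : 0 < b)
    (hy : Tendsto (fun a => y a / √(a * Real.log a)) atTop (𝓝 b)) :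
    Tendsto (fun a => crit m (y a) / crit (m + 1) a) atTop
      (𝓝 (b ^ ((1 / 2 : ℝ) ^ m) * (1 / 2 : ℝ) ^ (1 / 2 - (1 / 2 : ℝ) ^ m))) := by
  have hp := half_pow_pos m
  have hp' := half_pow_le hm
  have hev : ∀ᶠ a in atTop, 0 < y a / √(a * Real.log a) ∧ 1 < a ∧ 1 < Real.log a :=
    (hy.eventually (lt_mem_nhds hb)).and ((eventually_gt_atTop 1).and
      (Real.tendsto_log_atTop.eventually (eventually_gt_atTop 1)))
  have hyp : ∀ᶠ a in atTop, 0 < y a ∧ 1 < a ∧ 1 < Real.log a := by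
    filter_upwards [hev] with a ⟨h1, h2, h3⟩
    refine ⟨?_, h2, h3⟩
    by_contra hc
    exact absurd h1 (not_lt.2 (div_nonpos_of_nonpos_of_nonneg (not_lt.1 hc) (Real.sqrt_nonneg _)))
  -- As `y` is of order `√(a log a)`, its logarithm is about half of `log a`; this produces the
  -- power of `1 / 2` in the limit.
  have hlog : Tendsto (fun a => Real.log (y a) / Real.log a) atTop (𝓝 (1 / 2)) := by
    have h1 : Tendsto (fun a => Real.log (y a / √(a * Real.log a)) / Real.log a
        + 1 / 2 + 1 / 2 * (Real.log (Real.log a) / Real.log a)) atTop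
        (𝓝 (0 + 1 / 2 + 1 / 2 * 0)) := by
      refine Tendsto.add (Tendsto.add ?_ tendsto_const_nhds) (tendsto_loglog_div_log.const_mul _)
      exact ((Real.continuousAt_log hb.ne').tendsto.comp hy).div_atTop Real.tendsto_log_atTop
    rw [show (0 : ℝ) + 1 / 2 + 1 / 2 * 0 = 1 / 2 by norm_num] at h1
    refine h1.congr' ?_
    filter_upwards [hyp] with a ⟨hy0, h2, h3⟩
    have h4 : 0 < a * Real.log a := by positivity
    rw [Real.log_div hy0.ne' (Real.sqrt_pos.2 h4).ne', Real.log_sqrt h4.le,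
      Real.log_mul (by linarith) (by linarith)]
    field_simp
    ring
  have hlim := ((hy.rpow_const (p := (1 / 2 : ℝ) ^ m) (Or.inl hb.ne')).mul
    (hlog.rpow_const (p := 1 / 2 - (1 / 2 : ℝ) ^ m) (Or.inl (by norm_num))))
  refine hlim.congr' ?_
  have hylog : ∀ᶠ a in atTop, 0 < Real.log (y a) / Real.log a :=
    hlog.eventually (lt_mem_nhds (by norm_num))
  filter_upwards [hyp, hylog] with a ⟨hy0, h2, h3⟩ h5
  have h6 : 0 < Real.log (y a) := by
    by_contra hc
    exact absurd h5 (not_lt.2 (div_nonpos_of_nonpos_of_nonneg (not_lt.1 hc) (by linarith)))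
  have ha0 : 0 < a := by linarith
  have hL0 : 0 < Real.log a := by linarith
  rw [crit_eq hm, crit_eq (by omega), pow_succ (1 / 2 : ℝ) m]
  generalize (1 / 2 : ℝ) ^ m = p
  rw [Real.div_rpow hy0.le (Real.sqrt_nonneg _), Real.div_rpow h6.le hL0.le,
    Real.sqrt_eq_rpow, ← Real.rpow_mul (by positivity), Real.mul_rpow ha0.le hL0.le,
    div_mul_div_comm, show 1 / 2 * p = p * (1 / 2) by ring]
  congr 1
  rw [mul_assoc, ← Real.rpow_add hL0]
  congr 2
  ring

theorem kap_pos {μ : ℝ} (hμ : 0 < μ) {m : ℕ} : 0 < kap μ m := by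
  refine mul_pos (by positivity) (Finset.prod_pos fun i hi => ?_)
  rw [Finset.mem_Icc] at hi
  refine Real.rpow_pos_of_pos (sub_pos.2 ?_) _
  exact pow_lt_pow_right_of_lt_one₀ (by norm_num) (by norm_num) (by omega)

theorem kap_one {μ : ℝ} : kap μ 1 = μ ^ (-(3 / 2) : ℝ) := by
  simp only [kap]
  norm_num

/-- The limit of `h_m(y) / h_{m+1}(a)` when `y ~ √(a / μ) √((1 - (1/2)^m) log a)`. -/
def ratioConst (μ : ℝ) (m : ℕ) : ℝ :=
  √((1 - (1 / 2 : ℝ) ^ m) / μ) ^ ((1 / 2 : ℝ) ^ m) * (1 / 2 : ℝ) ^ (1 / 2 - (1 / 2 : ℝ) ^ m)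

theorem sum_half_pow (m : ℕ) : ∑ i ∈ Finset.Icc 1 m, (1 / 2 : ℝ) ^ (i + 1)
    = 1 / 2 - (1 / 2 : ℝ) ^ (m + 1) := by
  induction m with
  | zero => norm_num
  | succ m ih =>
    rw [Finset.sum_Icc_succ_top (by omega), ih, pow_succ _ (m + 1)]
    ring

/-- Passing from `m` to `m + 1` halves every bracket of the product, with exponents that sum to `1 /
2 - (1/2)^m`, and adds one bracket `1 - (1/2)^m`. The latter combines with the change in the power
of `μ` to the square root in `ratioConst`. -/
theorem kap_succ {μ : ℝ} (hμ : 0 < μ) {m : ℕ} (hm : 1 ≤ m) :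
    kap μ (m + 1) = kap μ m * ratioConst μ m := by
  obtain ⟨m, rfl⟩ : ∃ k, m = k + 1 := ⟨m - 1, by omega⟩
  have hpos : ∀ i ∈ Finset.Icc 1 m, (0 : ℝ) < (1 / 2 : ℝ) ^ (m - i) - (1 / 2 : ℝ) ^ m := by
    intro i hi
    rw [Finset.mem_Icc] at hi
    exact sub_pos.2 (pow_lt_pow_right_of_lt_one₀ (by norm_num) (by norm_num) (by omega))
  have hq : (1 / 2 : ℝ) ^ (m + 1) < 1 := pow_lt_one₀ (by norm_num) (by norm_num) (by omega)
  have hprod : ∏ i ∈ Finset.Icc 1 m,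
      ((1 / 2 : ℝ) ^ (m + 1 - i) - (1 / 2 : ℝ) ^ (m + 1)) ^ ((1 / 2 : ℝ) ^ (i + 1))
      = (∏ i ∈ Finset.Icc 1 m,
        ((1 / 2 : ℝ) ^ (m - i) - (1 / 2 : ℝ) ^ m) ^ ((1 / 2 : ℝ) ^ (i + 1)))
        * (1 / 2 : ℝ) ^ (1 / 2 - (1 / 2 : ℝ) ^ (m + 1)) := by
    rw [← sum_half_pow, Real.rpow_sum_of_pos (by norm_num), ← Finset.prod_mul_distrib]
    refine Finset.prod_congr rfl fun i hi => ?_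
    rw [← Real.mul_rpow (hpos i hi).le (by norm_num)]
    congr 1
    rw [Finset.mem_Icc] at hi
    rw [show m + 1 - i = m - i + 1 by omega, pow_succ, pow_succ]
    ring
  simp only [kap, ratioConst, Nat.add_sub_cancel]
  rw [Finset.prod_Icc_succ_top (by omega), hprod, Nat.sub_self, pow_zero,
    Real.sqrt_eq_rpow, ← Real.rpow_mul (div_nonneg (by linarith) hμ.le),
    Real.div_rpow (by linarith) hμ.le, show (1 / 2 : ℝ) * (1 / 2) ^ (m + 1) = (1 / 2) ^ (m + 1 + 1)
      by rw [pow_succ (1 / 2 : ℝ) (m + 1)]; ring]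
  have e : μ ^ (-2 + (1 / 2 : ℝ) ^ (m + 1)) / μ ^ ((1 / 2 : ℝ) ^ (m + 1 + 1))
      = μ ^ (-2 + (1 / 2 : ℝ) ^ (m + 1 + 1)) := by
    rw [← Real.rpow_sub hμ]
    congr 1
    rw [pow_succ (1 / 2 : ℝ) (m + 1)]; ring
  rw [← e]
  ring

theorem ratioConst_pos {μ : ℝ} (hμ : 0 < μ) {m : ℕ} (hm : 1 ≤ m) : 0 < ratioConst μ m := by
  have := half_pow_le hm
  have h1 : 0 < (1 - (1 / 2 : ℝ) ^ m) / μ := div_pos (by linarith) hμ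
  have := Real.sqrt_pos.2 h1
  unfold ratioConst
  positivity

end Critical

/-! ### The function `f`, its inverse, and passage between bands. -/

section Inverse

theorem fFun_strictMonoOn {μ : ℝ} (hμ : 0 < μ) : StrictMonoOn (fFun μ) (Ici 0) := by
  intro x hx y hy hxy
  have hx' : (0 : ℝ) ≤ x := hx
  unfold fFun
  refine mul_lt_mul_of_pos_left (Real.sqrt_lt_sqrt ?_ ?_) (by positivity)
  · exact mul_nonneg hx' (Real.log_nonneg (by linarith))
  · have h1 : Real.log (x + 1) < Real.log (y + 1) := Real.log_lt_log (by linarith) (by linarith)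
    have h2 : 0 ≤ Real.log (x + 1) := Real.log_nonneg (by linarith)
    nlinarith

theorem tendsto_fFun {μ : ℝ} (hμ : 0 < μ) : Tendsto (fFun μ) atTop atTop := by
  refine Tendsto.const_mul_atTop (by positivity) (Real.tendsto_sqrt_atTop.comp ?_)
  exact tendsto_id.atTop_mul_atTop₀
    (Real.tendsto_log_atTop.comp (tendsto_atTop_add_const_right _ 1 tendsto_id))

theorem continuousOn_fFun (μ : ℝ) : ContinuousOn (fFun μ) (Ici 0) := by
  unfold fFun
  refine continuousOn_const.mul (ContinuousOn.sqrt (continuousOn_id.mul (ContinuousOn.log ?_ ?_)))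
  · fun_prop
  · intro x hx
    have : (0 : ℝ) ≤ x := hx
    linarith

theorem exists_fFun_eq {μ : ℝ} (hμ : 0 < μ) {y : ℝ} (hy : 0 < y) : ∃ x ∈ Ioi 0, fFun μ x = y := by
  have h0 : fFun μ 0 = 0 := by simp [fFun]
  obtain ⟨b, hb, hb0⟩ := ((tendsto_fFun hμ).eventually (eventually_ge_atTop y)).and
    (eventually_ge_atTop 0) |>.exists
  have h1 := intermediate_value_Icc hb0 ((continuousOn_fFun μ).mono Icc_subset_Ici_self)
  rw [h0] at h1
  obtain ⟨x, hx, hxy⟩ := h1 ⟨hy.le, hb⟩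
  refine ⟨x, hx.1.lt_of_ne fun h => ?_, hxy⟩
  rw [← h, h0] at hxy
  exact hy.ne hxy

theorem fInv_pos {μ : ℝ} (hμ : 0 < μ) {y : ℝ} (hy : 0 < y) : 0 < fInv μ y :=
  Function.invFunOn_mem (exists_fFun_eq hμ hy)

theorem fFun_fInv {μ : ℝ} (hμ : 0 < μ) {y : ℝ} (hy : 0 < y) : fFun μ (fInv μ y) = y :=
  Function.invFunOn_eq (exists_fFun_eq hμ hy)

theorem fFun_pos {μ : ℝ} (hμ : 0 < μ) {x : ℝ} (hx : 0 < x) : 0 < fFun μ x := by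
  have h0 : fFun μ 0 = 0 := by simp [fFun]
  rw [← h0]
  exact fFun_strictMonoOn hμ self_mem_Ici hx.le hx

theorem fInv_le {μ : ℝ} (hμ : 0 < μ) {y a : ℝ} (hy : 0 < y) (ha : 0 < a) (h : y ≤ fFun μ a) :
    fInv μ y ≤ a := by
  rw [← fFun_fInv hμ hy] at h
  exact ((fFun_strictMonoOn hμ).le_iff_le (fInv_pos hμ hy).le ha.le).1 h

theorem le_fInv {μ : ℝ} (hμ : 0 < μ) {y a : ℝ} (hy : 0 < y) (ha : 0 < a) (h : fFun μ a ≤ y) :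
    a ≤ fInv μ y := by
  rw [← fFun_fInv hμ hy] at h
  exact ((fFun_strictMonoOn hμ).le_iff_le ha.le (fInv_pos hμ hy).le).1 h

theorem fInv_monotoneOn {μ : ℝ} (hμ : 0 < μ) : MonotoneOn (fInv μ) (Ioi 0) := by
  intro x hx y hy hxy
  refine fInv_le hμ hx (fInv_pos hμ hy) ?_
  rw [fFun_fInv hμ hy]; exact hxy

theorem tendsto_fInv {μ : ℝ} (hμ : 0 < μ) : Tendsto (fInv μ) atTop atTop := by
  refine tendsto_atTop.2 fun b => ?_
  filter_upwards [eventually_ge_atTop (fFun μ (max b 1)), eventually_gt_atTop 0] with y h1 h2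
  exact (le_max_left b 1).trans (le_fInv hμ h2 (by positivity) h1)

theorem measurable_fInv_restrict {μ : ℝ} (hμ : 0 < μ) :
    Measurable (fun x : Ioi (0 : ℝ) => fInv μ x) :=
  Monotone.measurable fun x y h => fInv_monotoneOn hμ x.2 y.2 h

theorem tendsto_log_add_one_div_log :
    Tendsto (fun a : ℝ => Real.log (a + 1) / Real.log a) atTop (𝓝 1) := by
  have h1 : Tendsto (fun a : ℝ => 1 + Real.log (1 + a⁻¹) / Real.log a) atTop (𝓝 (1 + 0)) := by
    refine tendsto_const_nhds.add (Tendsto.div_atTop (a := Real.log (1 + 0)) ?_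
      Real.tendsto_log_atTop)
    exact (Real.continuousAt_log (by norm_num)).tendsto.comp
      (tendsto_const_nhds.add tendsto_inv_atTop_zero)
  rw [add_zero] at h1
  refine h1.congr' ?_
  filter_upwards [eventually_gt_atTop 1] with a ha
  have hL := Real.log_pos ha
  have : a + 1 = a * (1 + a⁻¹) := by field_simp
  rw [this, Real.log_mul (by linarith) (by positivity)]
  field_simp

theorem tendsto_fFun_div {μ : ℝ} (hμ : 0 < μ) :
    Tendsto (fun a => fFun μ a / √(a * Real.log a)) atTop (𝓝 (6 / √μ)) := by
  have h1 := (tendsto_log_add_one_div_log.sqrt).const_mul (6 / √μ)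
  rw [Real.sqrt_one, mul_one] at h1
  refine h1.congr' ?_
  filter_upwards [eventually_gt_atTop 1] with a ha
  have hL := Real.log_pos ha
  have hL' : 0 < Real.log (a + 1) := Real.log_pos (by linarith)
  rw [fFun, Real.sqrt_div hL'.le, Real.sqrt_mul (by linarith), Real.sqrt_mul (by linarith)]
  have : 0 < √a := Real.sqrt_pos.2 (by linarith)
  have : 0 < √(Real.log a) := Real.sqrt_pos.2 hL
  field_simp

/-- Composition with `f⁻¹` carries the band `m + 1` to the band `m`. -/
theorem comp_fInv_mem_bandO {μ : ℝ} (hμ : 0 < μ) {m : ℕ} (hm : 1 ≤ m) {g : ℝ → ℝ}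
    (hg : g ∈ bandO (m + 1)) : g ∘ fInv μ ∈ bandO m := by
  obtain ⟨hpos, h1, h2⟩ := hg
  have hinv := tendsto_fInv hμ
  have hf := tendsto_fFun_div hμ
  have hb : 0 < 6 / √μ := by positivity
  have hcancel : ∀ F : ℝ → ℝ, (F ∘ fFun μ) ∘ fInv μ =ᶠ[atTop] F := by
    intro F
    filter_upwards [eventually_gt_atTop 0] with y hy
    simp only [Function.comp_apply, fFun_fInv hμ hy]
  have hlim : ∀ k, 1 ≤ k → ∃ L, 0 < L ∧
      Tendsto (fun a => crit k (fFun μ a) / crit (k + 1) a) atTop (𝓝 L) := fun k hk =>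
    ⟨_, by positivity, tendsto_crit_div hk hb hf⟩
  have hne : ∀ k, 1 ≤ k → ∀ᶠ a in atTop, crit k a ≠ 0 := fun k hk => by
    filter_upwards [eventually_gt_atTop 1] with a ha using (crit_pos hk ha).ne'
  refine ⟨fun x hx => hpos _ (fInv_pos hμ hx), ?_, ?_⟩
  · obtain ⟨L, hL, hlimL⟩ := hlim m hm
    have h3 : (crit m ∘ fFun μ) =O[atTop] crit (m + 1) :=
      isBigO_of_div_tendsto_nhds ((hne (m + 1) (by omega)).mono fun a ha h => absurd h ha) L hlimL
    have h4 := (h3.comp_tendsto hinv).congr' (hcancel _) EventuallyEq.rfl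
    exact h4.trans_isLittleO (h1.comp_tendsto hinv)
  · simp only [Nat.add_sub_cancel] at h2
    have h3 : crit m =O[atTop] (crit (m - 1) ∘ fFun μ) := by
      rcases Nat.lt_or_ge 1 m with hm1 | hm1
      · obtain ⟨L, hL, hlimL⟩ := hlim (m - 1) (by omega)
        rw [Nat.sub_add_cancel hm] at hlimL
        have h5 := hlimL.inv₀ hL.ne'
        simp only [inv_div] at h5
        refine isBigO_of_div_tendsto_nhds ?_ _ h5
        have h6 := (tendsto_fFun hμ).eventually (hne (m - 1) (by omega))
        exact h6.mono fun a ha h => absurd h ha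
      -- The comparison function is now `crit 0`, the identity, which `tendsto_crit_div` does not
      -- cover; `√a` is compared with `f(a)` directly.
      · obtain rfl : m = 1 := by omega
        refine IsBigO.of_bound (√μ / 6) ?_
        filter_upwards [eventually_ge_atTop (Real.exp 1)] with a ha
        have ha0 : 0 < a := (Real.exp_pos 1).trans_le ha
        have h7 : 1 ≤ Real.log (a + 1) := by
          rw [Real.le_log_iff_exp_le (by linarith)]; linarith
        simp only [crit_one_eq, Nat.sub_self, Function.comp_apply,
          show ∀ x, crit 0 x = x from fun _ => rfl]
        rw [Real.norm_of_nonneg (Real.sqrt_nonneg _), Real.norm_of_nonneg (fFun_pos hμ ha0).le,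
          fFun]
        have h8 : √a ≤ √(a * Real.log (a + 1)) := Real.sqrt_le_sqrt (by nlinarith)
        calc √a ≤ √(a * Real.log (a + 1)) := h8
          _ = _ := by field_simp
    have h4 := (h3.comp_tendsto hinv).congr' EventuallyEq.rfl (hcancel _)
    exact (h2.comp_tendsto hinv).trans_isBigO h4

theorem measurable_comp_fInv {μ : ℝ} (hμ : 0 < μ) {g : ℝ → ℝ}
    (hg : Measurable (fun x : Ioi (0 : ℝ) => g x)) :
    Measurable (fun x : Ioi (0 : ℝ) => (g ∘ fInv μ) x) := by
  have h1 : Measurable (fun x : Ioi (0 : ℝ) => (⟨fInv μ x, fInv_pos hμ x.2⟩ : Ioi (0 : ℝ))) :=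
    (measurable_fInv_restrict hμ).subtype_mk
  exact hg.comp h1

theorem monotoneOn_comp_fInv {μ : ℝ} (hμ : 0 < μ) {g : ℝ → ℝ} {x₀ : ℝ}
    (hg : MonotoneOn g (Ici x₀)) : ∃ x₁, MonotoneOn (g ∘ fInv μ) (Ici x₁) := by
  obtain ⟨b, hb⟩ := (((tendsto_fInv hμ).eventually (eventually_ge_atTop x₀)).and
    (eventually_gt_atTop 0)).exists_forall_of_atTop
  refine ⟨b, fun x hx y hy hxy => ?_⟩
  exact hg (hb x hx).1 (hb y hy).1 (fInv_monotoneOn hμ (hb x hx).2 (hb y hy).2 hxy)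

/-- Every function in a band has a nondecreasing minorant in the same band. -/
theorem exists_monotone_minorant {m : ℕ} (hm : 1 ≤ m) {h : ℝ → ℝ} (hh : h ∈ bandO m) :
    ∃ g ∈ bandO m, MonotoneOn g (Ioi 0) ∧ ∀ᶠ x in atTop, g x ≤ h x := by
  obtain ⟨hpos, h1, h2⟩ := hh
  have hle : ∀ ε : ℝ, 0 < ε → ∃ x₁, 2 ≤ x₁ ∧ ∀ y, x₁ ≤ y → crit m y ≤ ε * h y := by
    intro ε hε
    obtain ⟨b, hb⟩ := (h1.bound hε).exists_forall_of_atTop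
    refine ⟨max b 2, le_max_right _ _, fun y hy => ?_⟩
    have hy2 : 2 ≤ y := (le_max_right _ _).trans hy
    have := hb y ((le_max_left _ _).trans hy)
    rwa [Real.norm_of_nonneg (crit_pos hm (by linarith)).le,
      Real.norm_of_nonneg (hpos y (by linarith)).le] at this
  obtain ⟨x₀, hx₀, hx₀'⟩ := hle 1 one_pos
  let S : ℝ → Set ℝ := fun x => h '' Ici (max x x₀)
  have hS : ∀ x, (S x).Nonempty := fun x => nonempty_Ici.image h
  have hlow : ∀ x y, max x x₀ ≤ y → crit m x₀ ≤ h y := by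
    intro x y hy
    have hy0 : x₀ ≤ y := (le_max_right _ _).trans hy
    have h3 := crit_monotoneOn hm (show (1 : ℝ) ≤ x₀ by linarith) (show (1 : ℝ) ≤ y by linarith) hy0
    have := hx₀' y hy0
    linarith
  have hbdd : ∀ x, BddBelow (S x) := fun x => ⟨crit m x₀, by
    rintro _ ⟨y, hy, rfl⟩; exact hlow x y hy⟩
  -- The infimum of `h` over `[x, ∞)` is nondecreasing, and it inherits domination of `crit m`
  -- because `crit m` is itself nondecreasing. The cutoff `x₀` keeps it positive for small `x`.
  let g : ℝ → ℝ := fun x => sInf (S x)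
  have hg0 : ∀ x, crit m x₀ ≤ g x := fun x => le_csInf (hS x) (by
    rintro _ ⟨y, hy, rfl⟩; exact hlow x y hy)
  have hc0 : 0 < crit m x₀ := crit_pos hm (by linarith)
  have hgh : ∀ x, x₀ ≤ x → g x ≤ h x := fun x hx =>
    csInf_le (hbdd x) ⟨x, by simp [hx], rfl⟩
  refine ⟨g, ⟨fun x _ => hc0.trans_le (hg0 x), ?_, ?_⟩, fun x _ y _ hxy => ?_, ?_⟩
  · refine IsLittleO.of_bound fun ε hε => ?_
    obtain ⟨x₁, hx₁, hx₁'⟩ := hle ε hε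
    filter_upwards [eventually_ge_atTop (max x₁ x₀)] with x hx
    have hxx1 : x₁ ≤ x := (le_max_left _ _).trans hx
    rw [Real.norm_of_nonneg (crit_pos hm (by linarith)).le,
      Real.norm_of_nonneg (hc0.trans_le (hg0 x)).le, ← div_le_iff₀' hε]
    refine le_csInf (hS x) ?_
    rintro _ ⟨y, hy, rfl⟩
    have hy0 : x ≤ y := (le_max_left _ _).trans hy
    rw [div_le_iff₀' hε]
    exact (crit_monotoneOn hm (show (1 : ℝ) ≤ x by linarith) (show (1 : ℝ) ≤ y by linarith)
      hy0).trans (hx₁' y (hxx1.trans hy0))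
  · refine IsBigO.trans_isLittleO (IsBigO.of_bound 1 ?_) h2
    filter_upwards [eventually_ge_atTop x₀] with x hx
    rw [one_mul, Real.norm_of_nonneg (hc0.trans_le (hg0 x)).le,
      Real.norm_of_nonneg (hpos x (by linarith)).le]
    exact hgh x hx
  · exact csInf_le_csInf (hbdd x) (hS y)
      (image_mono (Ici_subset_Ici.2 (max_le_max_right _ hxy)))
  · filter_upwards [eventually_ge_atTop x₀] with x hx using hgh x hx

end Inverse


/-! ### Asymptotics of stage sizes and of remaining distances. -/

section StageAsymptotics

/-- If the crossing parameter is small compared with `√x` then `t(x, z) ~ x / μ`. -/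
theorem tendsto_stageRoot_div {μ : ℝ} (hμ : 0 < μ) {z : ℝ → ℝ}
    (hz : Tendsto (fun x => z x / √x) atTop (𝓝 0)) :
    Tendsto (fun x => stageRoot μ x (z x) / √x) atTop (𝓝 (1 / √μ)) := by
  have h1 : Tendsto (fun x => (√(4 * μ + (z x / √x) ^ 2) - z x / √x) / (2 * μ)) atTop
      (𝓝 ((√(4 * μ + 0 ^ 2) - 0) / (2 * μ))) :=
    (((tendsto_const_nhds.add (hz.pow 2)).sqrt).sub hz).div_const _
  have e : (√(4 * μ + 0 ^ 2) - 0) / (2 * μ) = 1 / √μ := by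
    have h4 : √(4 * μ) = 2 * √μ := by
      rw [Real.sqrt_mul (by norm_num), show (4 : ℝ) = 2 ^ 2 by norm_num,
        Real.sqrt_sq (by norm_num)]
    have h5 := Real.sq_sqrt hμ.le
    have h6 := Real.sqrt_pos.2 hμ
    rw [zero_pow two_ne_zero, add_zero, sub_zero, h4]
    field_simp
    linarith
  rw [e] at h1
  refine h1.congr' ?_
  filter_upwards [eventually_gt_atTop 0] with x hx
  have hs : 0 < √x := Real.sqrt_pos.2 hx
  have h7 : 4 * x * μ + z x ^ 2 = x * (4 * μ + (z x / √x) ^ 2) := by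
    rw [div_pow, Real.sq_sqrt hx.le]
    field_simp
  rw [stageRoot, h7, Real.sqrt_mul hx.le]
  field_simp

theorem tendsto_sqrt_log_div_sqrt : Tendsto (fun x : ℝ => √(Real.log x) / √x) atTop (𝓝 0) := by
  have h1 := (Real.isLittleO_log_id_atTop.tendsto_div_nhds_zero).sqrt
  rw [Real.sqrt_zero] at h1
  refine h1.congr' ?_
  filter_upwards [eventually_ge_atTop 1] with x hx
  rw [id, Real.sqrt_div (Real.log_nonneg hx)]

theorem tendsto_sqrt_log : Tendsto (fun x : ℝ => √(Real.log x)) atTop atTop :=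
  Real.tendsto_sqrt_atTop.comp Real.tendsto_log_atTop

theorem tendsto_div_sqrt_of_div_sqrt_log {z : ℝ → ℝ} {b : ℝ}
    (hz : Tendsto (fun x => z x / √(Real.log x)) atTop (𝓝 b)) :
    Tendsto (fun x => z x / √x) atTop (𝓝 0) := by
  have h := hz.mul tendsto_sqrt_log_div_sqrt
  rw [mul_zero] at h
  refine h.congr' ?_
  filter_upwards [tendsto_sqrt_log.eventually (eventually_gt_atTop 0)] with x hx
  field_simp

/-- The order of the distance that remains after a stage with parameter of order `√(log x)`. -/
theorem tendsto_remaining_div {μ : ℝ} (hμ : 0 < μ) {z w : ℝ → ℝ} {b d : ℝ}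
    (hz : Tendsto (fun x => z x / √(Real.log x)) atTop (𝓝 b))
    (hw : Tendsto (fun x => w x / √(Real.log x)) atTop (𝓝 d)) :
    Tendsto (fun x => stageRoot μ x (z x) * w x / √(x * Real.log x)) atTop (𝓝 (1 / √μ * d)) := by
  refine ((tendsto_stageRoot_div hμ (tendsto_div_sqrt_of_div_sqrt_log hz)).mul hw).congr' ?_
  filter_upwards [eventually_gt_atTop 1] with x hx
  rw [Real.sqrt_mul (by linarith), div_mul_div_comm]

end StageAsymptotics

/-! ### Lower bounds valid for all rules. -/

section Lower

variable {μ : ℝ}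

theorem le_kernelAt {v : ℝ → ℝ≥0∞} {x K : ℝ} {t : ℝ≥0} {w : ℝ≥0∞}
    (h : ∀ y, y < K → 0 < x - μ * t - √(t : ℝ) * y ∧ w ≤ v (x - μ * t - √(t : ℝ) * y)) :
    w * ENNReal.ofReal (stdCdf K) ≤ kernelAt μ v x t := by
  rw [stdCdf_eq, ofReal_measureReal, ← gaussian_Iio, ← lintegral_indicator_const measurableSet_Iio]
  refine lintegral_mono fun y => ?_
  by_cases hy : y ∈ Iio K
  · rw [indicator_of_mem hy, indicator_of_mem (show _ ∈ Ioi (0 : ℝ) from (h y hy).1)]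
    exact (h y hy).2
  · rw [indicator_of_notMem hy]; exact zero_le

/-- Every rule has to pay for at least one stage. -/
theorem const_mem_lowerBound (c : ℝ) : (fun _ => ENNReal.ofReal c) ∈ LowerBound μ c 1 :=
  ⟨measurable_const, 0, rfl, fun x _ t => by
    rw [add_assoc]; exact le_self_add⟩

/-- Let `w → ∞`: a stage that surely stops short causes no overshoot and exactly one further stage.
-/
theorem le_one_of_le_stageValue {v r : ℝ} (hv : ∀ w, v ≤ stdCdf w + r * Del w) : v ≤ 1 := by
  have h1 : Tendsto (fun w => stdCdf w + r * Del w) atTop (𝓝 (1 + r * 0)) :=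
    tendsto_stdCdf_atTop.add (tendsto_Del_atTop.const_mul r)
  rw [mul_zero, add_zero] at h1
  exact ge_of_tendsto' h1 hv

/-- The candidate lower bound: the constant `v` on the set where `c ≤ Q h_m`. -/
def lowerFun (m : ℕ) (Q c x₀ v : ℝ) : ℝ → ℝ≥0∞ :=
  {x | x₀ ≤ x ∧ c ≤ Q * crit m x}.indicator fun _ => ENNReal.ofReal (v * c)

theorem measurable_crit (m : ℕ) : Measurable (crit m) := by
  cases m with
  | zero => exact measurable_id
  | succ m =>
    have : crit (m + 1) = fun x => x ^ ((1 / 2 : ℝ) ^ (m + 1))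
        * Real.log x ^ (1 / 2 - (1 / 2 : ℝ) ^ (m + 1)) := rfl
    rw [this]
    have := Real.measurable_log
    exact (measurable_id.pow_const _).mul (this.pow_const _)

theorem measurable_lowerFun (m : ℕ) (Q c x₀ v : ℝ) : Measurable (lowerFun m Q c x₀ v) := by
  refine measurable_const.indicator ?_
  exact (measurableSet_le measurable_const measurable_id).inter
    (measurableSet_le measurable_const ((measurable_crit m).const_mul Q))

theorem lowerFun_mem {m n : ℕ} {Q c x₀ v : ℝ} {L : ℝ → ℝ≥0∞} (hL : L ∈ LowerBound μ c n)
    (h : ∀ x, 0 < x → x₀ ≤ x → c ≤ Q * crit m x → ∀ t : ℝ≥0, ENNReal.ofReal (v * c)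
      ≤ ENNReal.ofReal c + (ENNReal.ofReal μ)⁻¹ * overshoot μ x t + kernelAt μ L x t) :
    lowerFun m Q c x₀ v ∈ LowerBound μ c (n + 1) := by
  refine ⟨measurable_lowerFun m Q c x₀ v, L, hL, fun x hx t => ?_⟩
  by_cases hmem : x ∈ {x | x₀ ≤ x ∧ c ≤ Q * crit m x}
  · rw [lowerFun, indicator_of_mem hmem]
    exact h x hx hmem.1 hmem.2 t
  · rw [lowerFun, indicator_of_notMem hmem]; exact zero_le

theorem stageRoot_le_sqrt (hμ : 0 < μ) {x K : ℝ} (hx : 0 < x) (hK : 0 ≤ K) {t : ℝ≥0} (ht : 0 < t)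
    (h : (x - μ * t) / √(t : ℝ) ≤ K) : stageRoot μ x K ≤ √(t : ℝ) := by
  have hs : 0 < √(t : ℝ) := Real.sqrt_pos.2 (by exact_mod_cast ht)
  have h1 := Real.sq_sqrt t.coe_nonneg
  rw [div_le_iff₀ hs] at h
  have h2 := stageRoot_quadratic hμ hx.le K
  have h3 := stageRoot_nonneg hμ hx.le K
  by_contra hc
  push Not at hc
  have h4 : √(t : ℝ) ^ 2 < stageRoot μ x K ^ 2 := pow_lt_pow_left₀ hc hs.le two_ne_zero
  nlinarith [mul_le_mul_of_nonneg_left hc.le hK]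

/-- After the first stage, with parameter `z`, another is needed with probability `Φ(z)`, and the
overshoot costs `√t Δ(z) / μ`. For bounded `z` the latter is at least nearly `κ_1 √x Δ(z)`, hence
nearly `(κ_1 / Q) Δ(z) c` since `c ≤ Q √x`. For large `z` the second stage alone suffices, because
`v ≤ 1`. -/
theorem lowerFun_one (hμ : 0 < μ) {Q v ε : ℝ} (hQ : 0 < Q)
    (hv : ∀ w, v ≤ stdCdf w + kap μ 1 / Q * Del w) (hε : 0 < ε) (hε1 : ε < 1) :
    ∃ x₀, ∀ c, 0 < c → lowerFun 1 Q c x₀ (1 + v - ε) ∈ LowerBound μ c 2 := by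
  have hv1 := le_one_of_le_stageValue hv
  have hkap := kap_pos hμ (m := 1)
  obtain ⟨K, hK, hK0⟩ := ((tendsto_stdCdf_atTop.eventually
    (lt_mem_nhds (show 1 - ε < 1 by linarith))).and (eventually_ge_atTop 0)).exists
  have hroot : ∀ᶠ x in atTop, (1 - ε) * (1 / √μ) ≤ stageRoot μ x K / √x := by
    have h1 : Tendsto (fun x : ℝ => K / √x) atTop (𝓝 0) :=
      tendsto_const_nhds.div_atTop Real.tendsto_sqrt_atTop
    refine (tendsto_stageRoot_div hμ h1).eventually (le_mem_nhds ?_)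
    have : 0 < 1 / √μ := by positivity
    nlinarith
  obtain ⟨x₀, hx₀⟩ := hroot.exists_forall_of_atTop
  refine ⟨x₀, fun c hc => lowerFun_mem (const_mem_lowerBound c) fun x hx hxx₀ hcx t => ?_⟩
  rw [crit_one_eq] at hcx
  -- A stage of size zero has no crossing parameter; it wastes `c` and leaves at least another `c`
  -- to pay.
  rcases eq_or_ne t 0 with rfl | ht
  · have h1 : kernelAt μ (fun _ => ENNReal.ofReal c) x 0 = ENNReal.ofReal c := by
      simp [kernelAt, hx]
    rw [h1]
    refine le_trans ?_ (add_le_add le_self_add le_rfl)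
    rw [← ENNReal.ofReal_add hc.le hc.le]
    refine ENNReal.ofReal_le_ofReal ?_
    nlinarith
  have ht0 : 0 < t := pos_iff_ne_zero.2 ht
  have hs : 0 < √(t : ℝ) := Real.sqrt_pos.2 (by exact_mod_cast ht0)
  set z := (x - μ * t) / √(t : ℝ) with hz
  have hker : ENNReal.ofReal c * ENNReal.ofReal (stdCdf z)
      ≤ kernelAt μ (fun _ => ENNReal.ofReal c) x t := by
    refine le_kernelAt fun y hy => ⟨?_, le_rfl⟩
    rw [hz, lt_div_iff₀ hs] at hy
    linarith
  refine le_trans ?_ (add_le_add le_rfl hker)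
  rw [overshoot_eq t ht0, ← hz, ← ENNReal.ofReal_inv_of_pos hμ, ← ENNReal.ofReal_mul (by positivity),
    ← ENNReal.ofReal_mul hc.le]
  have hDel := Del_nonneg z
  have hΦ := stdCdf_nonneg z
  rw [← ENNReal.ofReal_add hc.le (by positivity), ← ENNReal.ofReal_add (by positivity) (by positivity)]
  refine ENNReal.ofReal_le_ofReal ?_
  rcases le_total K z with hKz | hKz
  · have h2 : 1 - ε < stdCdf z := hK.trans_le (stdCdf_strictMono.monotone hKz)
    have h3 : 0 ≤ μ⁻¹ * (√(t : ℝ) * Del z) := by positivity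
    nlinarith
  · have h4 := stageRoot_le_sqrt hμ hx hK0 ht0 hKz
    have h5 := hx₀ x hxx₀
    have hsx : 0 < √x := Real.sqrt_pos.2 hx
    rw [le_div_iff₀ hsx] at h5
    have h6 : (1 - ε) * (1 / √μ) * √x ≤ √(t : ℝ) := h5.trans h4
    have h7 : kap μ 1 = μ⁻¹ * (1 / √μ) := by
      rw [kap_one, Real.sqrt_eq_rpow, one_div, ← Real.rpow_neg_one μ,
        ← Real.rpow_neg hμ.le, ← Real.rpow_add hμ]
      norm_num
    have h8 : (1 - ε) * (kap μ 1 / Q * Del z) * c ≤ μ⁻¹ * (√(t : ℝ) * Del z) := by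
      calc (1 - ε) * (kap μ 1 / Q * Del z) * c
          ≤ (1 - ε) * (kap μ 1 / Q * Del z) * (Q * √x) := by
            gcongr
        _ = μ⁻¹ * ((1 - ε) * (1 / √μ) * √x * Del z) := by
            rw [h7]; field_simp
        _ ≤ _ := by gcongr
    have h9 := hv z
    have h10 : (1 - ε) * v * c ≤ (1 - ε) * (stdCdf z + kap μ 1 / Q * Del z) * c := by
      gcongr
    have h11 : ε * v * c ≤ ε * c := by nlinarith [mul_pos hε hc]
    have h12 : 0 ≤ ε * (stdCdf z * c) := by positivity
    nlinarith

/-- Ending the stage earlier than `t(x, z)` makes crossing unlikely but leaves a large distance. -/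
theorem le_remaining (hμ : 0 < μ) {x z K y : ℝ} (hx : 0 < x) (hK : 0 ≤ K) {t : ℝ≥0}
    (ht : t ≤ stageSize μ x z) (hy : y < K) :
    stageRoot μ x z * (z - K) ≤ x - μ * t - √(t : ℝ) * y := by
  have h1 := stageRoot_quadratic hμ hx.le z
  have h2 : (t : ℝ) ≤ stageRoot μ x z ^ 2 := by
    rw [← stageSize_eq hμ hx.le]; exact_mod_cast ht
  have h3 : √(t : ℝ) ≤ stageRoot μ x z := by
    rw [← sqrt_stageSize hμ hx.le]; exact Real.sqrt_le_sqrt (by exact_mod_cast ht)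
  have h4 : √(t : ℝ) * y ≤ stageRoot μ x z * K :=
    (mul_le_mul_of_nonneg_left hy.le (Real.sqrt_nonneg _)).trans
      (mul_le_mul_of_nonneg_right h3 hK)
  nlinarith

/-- A longer stage has both a larger `√t` and a smaller crossing parameter, and each increases the
overshoot. -/
theorem le_overshoot (hμ : 0 < μ) {x z : ℝ} (hx : 0 < x) (hz : 0 ≤ z) {t : ℝ≥0}
    (ht : stageSize μ x z ≤ t) :
    ENNReal.ofReal (stageRoot μ x z * Del z) ≤ overshoot μ x t := by
  have h0 := stageRoot_pos hμ hx z
  have h2 : stageRoot μ x z ^ 2 ≤ t := by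
    rw [← stageSize_eq hμ hx.le]; exact_mod_cast ht
  have ht0 : 0 < t := by
    rw [← NNReal.coe_pos]; exact lt_of_lt_of_le (by positivity) h2
  have hs : 0 < √(t : ℝ) := Real.sqrt_pos.2 (by exact_mod_cast ht0)
  have h3 : stageRoot μ x z ≤ √(t : ℝ) := Real.le_sqrt_of_sq_le h2
  rw [overshoot_eq t ht0]
  refine ENNReal.ofReal_le_ofReal ?_
  have h1 := stageRoot_quadratic hμ hx.le z
  have h4 : (x - μ * t) / √(t : ℝ) ≤ z := by
    rw [div_le_iff₀ hs]
    nlinarith [mul_le_mul_of_nonneg_left h3 hz]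
  exact mul_le_mul h3 (Del_antitone h4) (Del_nonneg _) hs.le

/-- With a crossing parameter slightly below `√((1 - p) log x)`, the overshoot is large compared
with `x ^ (p / 2) (log x) ^ q`. -/
theorem tendsto_overshoot_div (hμ : 0 < μ) {p η : ℝ} (q : ℝ) (hp : p < 1) (hη : 0 < η)
    (hη1 : η < 1) :
    Tendsto (fun x => stageRoot μ x ((1 - η) * √((1 - p) * Real.log x))
      * Del ((1 - η) * √((1 - p) * Real.log x)) / (x ^ (p / 2) * Real.log x ^ q)) atTop atTop := by
  set z : ℝ → ℝ := fun x => (1 - η) * √((1 - p) * Real.log x) with hz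
  have hzlim : Tendsto (fun x => z x / √(Real.log x)) atTop (𝓝 ((1 - η) * √(1 - p))) := by
    refine tendsto_const_nhds.congr' ?_
    filter_upwards [tendsto_sqrt_log.eventually (eventually_gt_atTop 0)] with x hx
    simp only [hz]
    rw [Real.sqrt_mul (by linarith)]
    field_simp
  have hroot := tendsto_stageRoot_div hμ (tendsto_div_sqrt_of_div_sqrt_log hzlim)
  have hμ1 : 0 < 1 / √μ := by positivity
  set C := (√(2 * Real.pi))⁻¹ with hC
  have hC0 : 0 < C := by positivity
  have hpow : Tendsto (fun x : ℝ => x ^ (η * (1 - p) / 2) / Real.log x ^ q) atTop atTop := by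
    have h1 : 0 < η * (1 - p) / 2 := by
      have : 0 < 1 - p := by linarith
      positivity
    have h2 := (isLittleO_log_rpow_rpow_atTop q h1).tendsto_div_nhds_zero
    have h3 : Tendsto (fun x : ℝ => (Real.log x ^ q / x ^ (η * (1 - p) / 2))⁻¹) atTop atTop := by
      refine Tendsto.inv_tendsto_nhdsGT_zero (tendsto_nhdsWithin_iff.2 ⟨h2, ?_⟩)
      filter_upwards [eventually_gt_atTop 1] with x hx
      have := Real.log_pos hx
      exact div_pos (Real.rpow_pos_of_pos this _) (Real.rpow_pos_of_pos (by linarith) _)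
    refine h3.congr fun x => by rw [inv_div]
  refine tendsto_atTop_mono' _ ?_ (hpow.const_mul_atTop (show 0 < 1 / √μ / 2 * C by positivity))
  -- `z x ^ 2` carries the factor `(1 - η)²`; giving up one power of `1 - η` absorbs the shift by
  -- `2` from `exp_le_Del`.
  have hsq : ∀ᶠ x in atTop, (z x + 2) ^ 2 ≤ (1 - η) * ((1 - p) * Real.log x) := by
    have h4 : Tendsto (fun x => (z x / √(Real.log x) + 2 / √(Real.log x)) ^ 2) atTop
        (𝓝 (((1 - η) * √(1 - p) + 0) ^ 2)) :=
      (hzlim.add (tendsto_const_nhds.div_atTop tendsto_sqrt_log)).pow 2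
    have h5 : ((1 - η) * √(1 - p) + 0) ^ 2 < (1 - η) * (1 - p) := by
      rw [add_zero, mul_pow, Real.sq_sqrt (by linarith)]
      have : 0 < (1 - η) * (1 - p) := mul_pos (by linarith) (by linarith)
      nlinarith
    filter_upwards [h4.eventually (ge_mem_nhds h5), eventually_gt_atTop 1] with x hx hx1
    have hL := Real.log_pos hx1
    rw [← add_div, div_pow, Real.sq_sqrt hL.le, div_le_iff₀ hL] at hx
    linarith
  filter_upwards [hsq, hroot.eventually (le_mem_nhds (show 1 / √μ / 2 < 1 / √μ by linarith)),
    eventually_gt_atTop 1] with x h6 h7 hx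
  have hx0 : 0 < x := by linarith
  have hL := Real.log_pos hx
  have hsx : 0 < √x := Real.sqrt_pos.2 hx0
  rw [le_div_iff₀ hsx] at h7
  have hz0 : 0 ≤ z x := mul_nonneg (by linarith) (Real.sqrt_nonneg _)
  have h8 : C * x ^ (-((1 - η) * (1 - p) / 2)) ≤ Del (z x) := by
    refine le_trans ?_ (exp_le_Del hz0)
    rw [Real.rpow_def_of_pos hx0]
    gcongr
    linarith
  have hlq : 0 < Real.log x ^ q := Real.rpow_pos_of_pos hL _
  rw [le_div_iff₀ (by positivity)]
  calc 1 / √μ / 2 * C * (x ^ (η * (1 - p) / 2) / Real.log x ^ q) * (x ^ (p / 2) * Real.log x ^ q)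
      = 1 / √μ / 2 * C * (x ^ (η * (1 - p) / 2) * x ^ (p / 2)) := by field_simp
    _ = 1 / √μ / 2 * √x * (C * x ^ (-((1 - η) * (1 - p) / 2))) := by
        rw [Real.sqrt_eq_rpow x, ← Real.rpow_add hx0]
        have : x ^ (η * (1 - p) / 2 + p / 2)
            = x ^ (1 / 2 : ℝ) * x ^ (-((1 - η) * (1 - p) / 2)) := by
          rw [← Real.rpow_add hx0]; congr 1; ring
        rw [this]; ring
    _ ≤ stageRoot μ x (z x) * Del (z x) := by
        have : 0 ≤ C * x ^ (-((1 - η) * (1 - p) / 2)) := by positivity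
        exact mul_le_mul h7 h8 this (stageRoot_nonneg hμ hx0.le _)

/-- The first stage is compared with one whose parameter is slightly below `√((1 - 2^(-m)) log x)`.
If it is longer, then the overshoot alone exceeds `(m + 2) c`. If it is shorter, then with
probability near `1` it leaves a distance `y` with `c ≤ Q' h_m(y)`, where the inductive bound
applies on top of the `c` already paid. -/
theorem lowerFun_succ (hμ : 0 < μ) {m : ℕ} (hm : 1 ≤ m)
    (ih : ∀ Q v ε : ℝ, 0 < Q → 0 ≤ v → (∀ w, v ≤ stdCdf w + kap μ m / Q * Del w) → 0 < ε → ε < 1 →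
      ∃ x₀, ∀ c, 0 < c → lowerFun m Q c x₀ (m + v - ε) ∈ LowerBound μ c (m + 1))
    {Q v ε : ℝ} (hQ : 0 < Q) (hv0 : 0 ≤ v)
    (hv : ∀ w, v ≤ stdCdf w + kap μ (m + 1) / Q * Del w) (hε : 0 < ε) (hε1 : ε < 1) :
    ∃ x₀, ∀ c, 0 < c →
      lowerFun (m + 1) Q c x₀ ((m + 1 : ℕ) + v - ε) ∈ LowerBound μ c (m + 2) := by
  have hv1 := le_one_of_le_stageValue hv
  have hkap := kap_pos hμ (m := m)
  have hρ := ratioConst_pos hμ hm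
  have hp0 := half_pow_pos m
  have hp := half_pow_le hm
  have hm' : (1 : ℝ) ≤ m := by exact_mod_cast hm
  -- The losses are at most `η v ≤ η` from the enlarged `Q'`, `η` from the inductive bound, and `η
  -- (m + 1)` from the probability `1 - η`: together `η (m + 3) = ε`.
  obtain ⟨η, hη⟩ : ∃ η : ℝ, η = ε / (m + 3) := ⟨_, rfl⟩
  have hη0 : 0 < η := by rw [hη]; positivity
  have hη1 : η < 1 := by
    rw [hη, div_lt_one (by positivity)]; linarith
  have hηε : η * (m + 3) = ε := by rw [hη]; field_simp
  -- `ratioConst` converts `h_{m+1}(x)` into `h_m` at the remaining distance; the factor `1 - η`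
  -- allows for a parameter below the critical one. Then `κ_m / Q'` is nearly `κ_{m+1} / Q`.
  obtain ⟨Q', hQ'⟩ : ∃ Q' : ℝ, Q' = Q / (ratioConst μ m * (1 - η)) := ⟨_, rfl⟩
  have h1η : 0 < 1 - η := by linarith
  have hQ'0 : 0 < Q' := by rw [hQ']; positivity
  have hr : kap μ m / Q' = (1 - η) * (kap μ (m + 1) / Q) := by
    rw [hQ', kap_succ hμ hm]; field_simp
  obtain ⟨y₀, hy₀⟩ := ih Q' ((1 - η) * v) η hQ'0 (by positivity) (fun w => by
    rw [hr]
    have h1 := mul_le_mul_of_nonneg_left (hv w) h1η.le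
    have h2 : 0 ≤ η * stdCdf w := mul_nonneg hη0.le (stdCdf_nonneg w)
    linarith) hη0 hη1
  obtain ⟨K, hK, hK0⟩ := ((tendsto_stdCdf_atTop.eventually
    (lt_mem_nhds (show 1 - η < 1 by linarith))).and (eventually_ge_atTop 0)).exists
  -- the parameter of the critical first stage
  set p := (1 / 2 : ℝ) ^ m with hpdef
  set z : ℝ → ℝ := fun x => (1 - η / 2) * √((1 - p) * Real.log x) with hz
  have hzlim : Tendsto (fun x => z x / √(Real.log x)) atTop (𝓝 ((1 - η / 2) * √(1 - p))) := by
    refine tendsto_const_nhds.congr' ?_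
    filter_upwards [tendsto_sqrt_log.eventually (eventually_gt_atTop 0)] with x hx
    simp only [hz]
    rw [Real.sqrt_mul (by linarith)]
    field_simp
  have hwlim : Tendsto (fun x => (z x - K) / √(Real.log x)) atTop (𝓝 ((1 - η / 2) * √(1 - p))) := by
    have := hzlim.sub (tendsto_const_nhds (x := K) |>.div_atTop tendsto_sqrt_log)
    rw [sub_zero] at this
    exact this.congr fun x => by rw [sub_div]
  have hylim := tendsto_remaining_div hμ hzlim hwlim
  have hb : 1 / √μ * ((1 - η / 2) * √(1 - p)) = (1 - η / 2) * √((1 - p) / μ) := by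
    rw [Real.sqrt_div (by linarith)]; ring
  rw [hb] at hylim
  have hb0 : 0 < √((1 - p) / μ) := Real.sqrt_pos.2 (div_pos (by linarith) hμ)
  have hb1 : 0 < (1 - η / 2) * √((1 - p) / μ) := mul_pos (by linarith) hb0
  have hcrit := tendsto_crit_div hm hb1 hylim
  have hlt : (1 - η) * ratioConst μ m < ((1 - η / 2) * √((1 - p) / μ)) ^ ((1 / 2 : ℝ) ^ m)
      * (1 / 2 : ℝ) ^ (1 / 2 - (1 / 2 : ℝ) ^ m) := by
    rw [Real.mul_rpow (by linarith) hb0.le, mul_assoc]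
    refine mul_lt_mul_of_pos_right ?_ hρ
    calc 1 - η < (1 - η / 2) ^ (1 : ℝ) := by rw [Real.rpow_one]; linarith
      _ ≤ _ := Real.rpow_le_rpow_of_exponent_ge (by linarith) (by linarith) (by linarith)
  have hylarge : Tendsto (fun x => stageRoot μ x (z x) * (z x - K)) atTop atTop := by
    have h3 : Tendsto (fun x : ℝ => √(x * Real.log x)) atTop atTop :=
      Real.tendsto_sqrt_atTop.comp (tendsto_id.atTop_mul_atTop₀ Real.tendsto_log_atTop)
    refine (hylim.pos_mul_atTop hb1 h3).congr' ?_
    filter_upwards [h3.eventually (eventually_gt_atTop 0)] with x hx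
    field_simp
  have hover := tendsto_overshoot_div hμ (p := p) (η := η / 2) (1 / 2 - p / 2) (by linarith)
    (by linarith) (by linarith)
  have hev := (hover.eventually (eventually_ge_atTop (μ * ((m + 2) * Q)))).and
    ((hylarge.eventually (eventually_ge_atTop (max y₀ 1))).and
      ((hcrit.eventually (lt_mem_nhds hlt)).and (eventually_gt_atTop 1)))
  obtain ⟨x₀, hx₀⟩ := hev.exists_forall_of_atTop
  refine ⟨x₀, fun c hc => lowerFun_mem (hy₀ c hc) fun x hx hxx₀ hcx t => ?_⟩
  obtain ⟨h4, h5, h6, h7⟩ := hx₀ x hxx₀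
  have hz0 : 0 ≤ z x := mul_nonneg (by linarith) (Real.sqrt_nonneg _)
  have hcr : crit (m + 1) x = x ^ (p / 2) * Real.log x ^ (1 / 2 - p / 2) := by
    rw [crit_eq (by omega), pow_succ, ← hpdef, mul_one_div]
  have hcr0 : 0 < crit (m + 1) x := crit_pos (by omega) h7
  push_cast
  rcases le_total (stageSize μ x (z x)) t with ht | ht
  · have h8 : ENNReal.ofReal ((m + 1 + v - ε) * c)
        ≤ (ENNReal.ofReal μ)⁻¹ * overshoot μ x t := by
      refine le_trans ?_ (mul_le_mul_right (le_overshoot hμ hx hz0 ht) _)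
      rw [← ENNReal.ofReal_inv_of_pos hμ, ← ENNReal.ofReal_mul (by positivity)]
      refine ENNReal.ofReal_le_ofReal ?_
      rw [← hcr, le_div_iff₀ hcr0] at h4
      have h9 : (m + 1 + v - ε) * c ≤ (m + 2) * (Q * crit (m + 1) x) :=
        mul_le_mul (by linarith) hcx hc.le (by positivity)
      rw [inv_mul_eq_div, le_div_iff₀ hμ]
      calc (m + 1 + v - ε) * c * μ ≤ (m + 2) * (Q * crit (m + 1) x) * μ := by gcongr
        _ = μ * ((m + 2) * Q) * crit (m + 1) x := by ring
        _ ≤ _ := h4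
    exact h8.trans (le_add_self.trans le_self_add)
  · have hker : ENNReal.ofReal ((m + (1 - η) * v - η) * c) * ENNReal.ofReal (stdCdf K)
        ≤ kernelAt μ (lowerFun m Q' c y₀ (m + (1 - η) * v - η)) x t := by
      refine le_kernelAt fun y hy => ?_
      have h8 := le_remaining hμ hx hK0 ht hy
      have h9 : max y₀ 1 ≤ x - μ * t - √(t : ℝ) * y := h5.trans h8
      have h10 : (1 : ℝ) ≤ stageRoot μ x (z x) * (z x - K) := (le_max_right _ _).trans h5
      refine ⟨by linarith, ?_⟩
      rw [lowerFun, indicator_of_mem]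
      refine ⟨(le_max_left _ _).trans h9, hcx.trans ?_⟩
      rw [lt_div_iff₀ hcr0] at h6
      have h11 := crit_monotoneOn hm (show (1 : ℝ) ≤ _ from h10)
        (show (1 : ℝ) ≤ _ from h10.trans h8) h8
      calc Q * crit (m + 1) x = Q' * ((1 - η) * ratioConst μ m * crit (m + 1) x) := by
            rw [hQ']; field_simp
        _ ≤ Q' * crit m (x - μ * t - √(t : ℝ) * y) := by
            gcongr
            exact h6.le.trans h11
    refine le_trans ?_ (add_le_add le_self_add hker)
    have h12 : 0 ≤ m + (1 - η) * v - η := by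
      have : 0 ≤ (1 - η) * v := by positivity
      linarith
    rw [← ENNReal.ofReal_mul (by positivity), ← ENNReal.ofReal_add hc.le
      (mul_nonneg (by positivity) (stdCdf_nonneg K))]
    refine ENNReal.ofReal_le_ofReal ?_
    have h13 : (m + (1 - η) * v - η) * c * (1 - η) ≤ (m + (1 - η) * v - η) * c * stdCdf K := by
      gcongr
    have h14 : m + v - ε ≤ (m + (1 - η) * v - η) * (1 - η) := by
      have h15 : η * v ≤ η := mul_le_of_le_one_right hη0.le hv1
      have h16 : m + (1 - η) * v - η ≤ m + 1 := by
        have : 0 ≤ η * v := by positivity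
        linarith
      have h17 := mul_le_mul_of_nonneg_left h16 hη0.le
      linarith
    have h18 := mul_le_mul_of_nonneg_right h14 hc.le
    linarith

/-- The lower bound for the cost of all rules when the cost per stage is at most `Q h_m`. -/
theorem exists_lowerFun_mem (hμ : 0 < μ) {m : ℕ} (hm : 1 ≤ m) :
    ∀ Q v ε : ℝ, 0 < Q → 0 ≤ v → (∀ w, v ≤ stdCdf w + kap μ m / Q * Del w) → 0 < ε → ε < 1 →
      ∃ x₀, ∀ c, 0 < c → lowerFun m Q c x₀ (m + v - ε) ∈ LowerBound μ c (m + 1) := by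
  induction m, hm using Nat.le_induction with
  | base =>
    intro Q v ε hQ hv0 hv hε hε1
    simpa using lowerFun_one hμ hQ hv hε hε1
  | succ m hm ih =>
    intro Q v ε hQ hv0 hv hε hε1
    exact lowerFun_succ hμ hm ih hQ hv0 hv hε hε1

end Lower


/-! ### Upper bounds for a single stage, with explicit errors. -/

section StageUpper

variable {μ : ℝ}

theorem stdPdf_le_one (z : ℝ) : stdPdf z ≤ 1 := by
  rw [stdPdf_eq]
  have h1 : 1 ≤ √(2 * Real.pi) := Real.one_le_sqrt.2 (by linarith [Real.pi_gt_three])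
  have h2 : Real.exp (-z ^ 2 / 2) ≤ 1 := Real.exp_le_one_iff.2 (by nlinarith [sq_nonneg z])
  exact mul_le_one₀ (inv_le_one_of_one_le₀ h1) (Real.exp_pos _).le h2

theorem stdCdf_sub_le {a b : ℝ} (h : a ≤ b) : stdCdf b - stdCdf a ≤ b - a := by
  have hd : Differentiable ℝ stdCdf := fun z => (hasDerivAt_stdCdf z).differentiableAt
  have := image_sub_le_mul_sub_of_deriv_le hd (C := 1)
    (fun z => by rw [(hasDerivAt_stdCdf z).deriv]; exact stdPdf_le_one z) h
  linarith

theorem gaussian_Iio_eq (z : ℝ) : (gaussianReal 0 1) (Iio z) = ENNReal.ofReal (stdCdf z) := by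
  rw [gaussian_Iio, stdCdf_eq, ofReal_measureReal]

theorem gaussian_Ico_eq {a b : ℝ} (h : a ≤ b) :
    (gaussianReal 0 1) (Ico a b) = ENNReal.ofReal (stdCdf b - stdCdf a) := by
  have e : Ico a b = Iio b \ Iio a := by ext; simp
  rw [e, measure_sdiff (Iio_subset_Iio h) measurableSet_Iio.nullMeasurableSet
    (measure_ne_top _ _), gaussian_Iio_eq, gaussian_Iio_eq, ENNReal.ofReal_sub _ (stdCdf_nonneg a)]

theorem lintegral_shortfall (w : ℝ) :
    ∫⁻ y, ENNReal.ofReal (w - y) ∂(gaussianReal 0 1) = ENNReal.ofReal (Del (-w)) := by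
  rw [← lintegral_excess]
  have h : (gaussianReal 0 1).map (fun y => -y) = gaussianReal 0 1 := by
    have := gaussianReal_map_neg (μ := 0) (v := 1)
    simpa using this
  conv_lhs => rw [← h]
  rw [lintegral_map (by fun_prop) measurable_neg]
  refine lintegral_congr fun y => ?_
  congr 1; ring

theorem stageStep_eq (hμ : 0 < μ) {x : ℝ} (hx : 0 < x) (c : ℝ) (z : ℝ → ℝ) (v : ℝ → ℝ≥0∞) :
    stageStep μ c z v x = ENNReal.ofReal c
      + ENNReal.ofReal (stageRoot μ x (z x) * Del (z x) / μ)
      + ∫⁻ y, (Ioi 0).indicator v (stageRoot μ x (z x) * (z x - y)) ∂(gaussianReal 0 1) := by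
  rw [stageStep, overshoot_stageSize hμ hx, kernelAt_stageSize hμ hx.le,
    ← ENNReal.ofReal_inv_of_pos hμ, ← ENNReal.ofReal_mul (by positivity)]
  rw [inv_mul_eq_div]

/-- The expected cost after a stage, from bounds for the cost at the remaining distance `y`. -/
theorem lintegral_stage_le {r z c A B' N C y₀ d F : ℝ} (hr : 0 < r) (hc : 0 ≤ c) (hA : 0 ≤ A)
    (hN : 0 ≤ N) (hNB : N ≤ B') (hC : 0 ≤ C) (hF : 1 ≤ F) (hy₀ : 0 ≤ y₀) {v : ℝ → ℝ≥0∞}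
    (h1 : ∀ y, 0 < y → v y ≤ ENNReal.ofReal (N * c + C * (1 + y)))
    (h2 : ∀ y, y₀ ≤ y → y ≤ d → v y ≤ ENNReal.ofReal (A * c))
    (h3 : ∀ y, y₀ ≤ y → y ≤ F → v y ≤ ENNReal.ofReal (B' * c)) :
    ∫⁻ y, (Ioi 0).indicator v (r * (z - y)) ∂(gaussianReal 0 1)
      ≤ ENNReal.ofReal (A * c * stdCdf z + (N * c + C * (1 + y₀)) * (y₀ / r)
        + B' * c * stdCdf (z - d / r) + 4 * C * (r * Del (F / (2 * r) - z))) := by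
  have hB : 0 ≤ B' := hN.trans hNB
  have hD := Del_nonneg (F / (2 * r) - z)
  have e1 : 0 ≤ A * c * stdCdf z := mul_nonneg (by positivity) (stdCdf_nonneg _)
  have e2 : 0 ≤ (N * c + C * (1 + y₀)) * (y₀ / r) := by positivity
  have e3 : 0 ≤ B' * c * stdCdf (z - d / r) := mul_nonneg (by positivity) (stdCdf_nonneg _)
  have e4 : 0 ≤ 4 * C * (r * Del (F / (2 * r) - z)) := by positivity
  have hyr : z - y₀ / r ≤ z := by have : 0 ≤ y₀ / r := by positivity
                                  linarith
  calc ∫⁻ y, (Ioi 0).indicator v (r * (z - y)) ∂(gaussianReal 0 1)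
      ≤ ∫⁻ y, (((Iio z).indicator (fun _ => ENNReal.ofReal (A * c)) y
          + (Ico (z - y₀ / r) z).indicator (fun _ => ENNReal.ofReal (N * c + C * (1 + y₀))) y)
          + (Iio (z - d / r)).indicator (fun _ => ENNReal.ofReal (B' * c)) y)
          + ENNReal.ofReal (4 * C * r) * ENNReal.ofReal (z - F / (2 * r) - y) ∂(gaussianReal 0 1) := by
        -- Four ranges of the remaining distance: below `y₀` the crude bound is used, with
        -- probability at most `y₀ / r` as the density is at most `1`; up to `d` the sharp cost `A
        -- c`; up to `F` the cost `B' c`, on a rare event; beyond `F` the crude bound again.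
        refine lintegral_mono fun y => ?_
        by_cases hy : r * (z - y) ∈ Ioi 0
        · have hy' : 0 < r * (z - y) := hy
          have hyz : 0 < z - y := by
            by_contra hcon
            push Not at hcon
            nlinarith
          rw [indicator_of_mem hy]
          rcases lt_or_ge (r * (z - y)) y₀ with h4 | h4
          · have hm : y ∈ Ico (z - y₀ / r) z := by
              refine ⟨?_, by linarith⟩
              have : z - y ≤ y₀ / r := by rw [le_div_iff₀ hr]; linarith
              linarith
            have : v (r * (z - y)) ≤ ENNReal.ofReal (N * c + C * (1 + y₀)) :=
              (h1 _ hy').trans (ENNReal.ofReal_le_ofReal (by gcongr))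
            rw [indicator_of_mem hm]
            exact this.trans (le_add_self.trans (le_self_add.trans le_self_add))
          rcases le_or_gt (r * (z - y)) d with h5 | h5
          · rw [indicator_of_mem (show y ∈ Iio z by simp only [mem_Iio]; linarith)]
            exact (h2 _ h4 h5).trans (le_self_add.trans (le_self_add.trans le_self_add))
          · have hm : y ∈ Iio (z - d / r) := by
              have : d / r < z - y := by rw [div_lt_iff₀ hr]; linarith
              simp only [mem_Iio]; linarith
            rw [indicator_of_mem hm]
            rcases le_or_gt (r * (z - y)) F with h6 | h6
            · exact (h3 _ h4 h6).trans (le_add_self.trans le_self_add)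
            · have : v (r * (z - y))
                  ≤ ENNReal.ofReal (B' * c) + ENNReal.ofReal (4 * C * r)
                    * ENNReal.ofReal (z - F / (2 * r) - y) := by
                rw [← ENNReal.ofReal_mul (by positivity), ← ENNReal.ofReal_add (by positivity)]
                · refine (h1 _ hy').trans (ENNReal.ofReal_le_ofReal ?_)
                  -- For a distance `w > F ≥ 1` one has `1 + w ≤ 4 w - 2 F`, so the linear term is
                  -- dominated by an excess above `F / 2`, whose mean is a value of `Del`.
                  have e : 4 * C * r * (z - F / (2 * r) - y) = C * (4 * (r * (z - y)) - 2 * F) := by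
                    field_simp; ring
                  rw [e]
                  gcongr
                  linarith
                · have e : z - F / (2 * r) - y = (2 * (r * (z - y)) - F) / (2 * r) := by
                    field_simp
                    ring
                  rw [e]
                  have : 0 ≤ 2 * (r * (z - y)) - F := by linarith
                  positivity
              exact this.trans (add_le_add le_add_self le_rfl)
        · rw [indicator_of_notMem hy]; exact zero_le
    _ = ENNReal.ofReal (A * c) * ENNReal.ofReal (stdCdf z)
          + ENNReal.ofReal (N * c + C * (1 + y₀)) * ENNReal.ofReal (stdCdf z - stdCdf (z - y₀ / r))
          + ENNReal.ofReal (B' * c) * ENNReal.ofReal (stdCdf (z - d / r))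
          + ENNReal.ofReal (4 * C * r) * ENNReal.ofReal (Del (F / (2 * r) - z)) := by
        rw [lintegral_add_right _ (by fun_prop), lintegral_add_right _ (by measurability),
          lintegral_add_right _ (by measurability), lintegral_const_mul _ (by fun_prop),
          lintegral_shortfall, lintegral_indicator_const measurableSet_Iio,
          lintegral_indicator_const measurableSet_Iio, lintegral_indicator_const measurableSet_Ico,
          gaussian_Iio_eq, gaussian_Iio_eq, gaussian_Ico_eq hyr]
        congr 4
        ring
    _ ≤ _ := by
        rw [ENNReal.ofReal_add (by positivity) e4, ENNReal.ofReal_add (by positivity) e3,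
          ENNReal.ofReal_add e1 e2, ← ENNReal.ofReal_mul (by positivity),
          ← ENNReal.ofReal_mul (by positivity), ← ENNReal.ofReal_mul (by positivity),
          ← ENNReal.ofReal_mul (by positivity), ← mul_assoc (4 * C)]
        gcongr
        have := stdCdf_sub_le hyr
        linarith

theorem stageRoot_mul_Del_le (hμ : 0 < μ) {x : ℝ} (hx : 0 < x) {K z : ℝ} (hK : 0 ≤ K) (hz : -K ≤ z) :
    stageRoot μ x z * Del z ≤ rootConst μ * (1 + K) ^ 2 * (1 + x) := by
  have h1 := stageRoot_antitone hμ hx hz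
  have h2 := Del_antitone hz
  have h3 := stageRoot_le_rootConst hμ hx.le (-K)
  have h4 := Del_le_abs (-K)
  rw [abs_neg, abs_of_nonneg hK] at h3 h4
  have hs : √x ≤ 1 + x := by nlinarith [Real.sq_sqrt hx.le, sq_nonneg (√x - 1)]
  have hC := rootConst_pos hμ
  calc stageRoot μ x z * Del z ≤ rootConst μ * (√x + K) * (K + 1) :=
        mul_le_mul (h1.trans h3) (h2.trans h4) (Del_nonneg z) (by positivity)
    _ ≤ rootConst μ * ((1 + x) + K * (1 + x)) * (K + 1) := by
        gcongr
        nlinarith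
    _ = _ := by ring

/-- A crude bound for the cost of a policy. -/
theorem exists_policyBound_le (hμ : 0 < μ) {K : ℝ} (hK : 0 ≤ K) {n : ℕ} :
    ∃ N C : ℝ, 0 ≤ N ∧ 0 ≤ C ∧ ∀ zf : ℕ → ℝ → ℝ, (∀ i < n, ∀ x, 0 < x → -K ≤ zf i x) →
      (∀ x, 0 < x → zf n x ≤ 0 ∧ -(1 + √x) ≤ zf n x) → ∀ c, 0 ≤ c → ∀ x, 0 < x →
      policyBound μ c n zf x ≤ ENNReal.ofReal (N * c + C * (1 + x)) := by
  induction n with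
  | zero =>
    have hA := geoConst_pos hμ
    have hA' := geoConst'_pos hμ
    refine ⟨2, 8 * (geoConst μ + geoConst' μ), by norm_num, by positivity,
      fun zf _ h2 c hc x hx => ENNReal.ofReal_le_ofReal ?_⟩
    obtain ⟨h3, h4⟩ := h2 x hx
    have hΦ : stdCdf (zf 0 x) ≤ 1 / 2 := by
      rw [← stdCdf_zero]; exact stdCdf_strictMono.monotone h3
    have h5 : |zf 0 x| + 1 ≤ 2 + √x := by rw [abs_of_nonpos h3]; linarith
    have h6 : 0 ≤ |zf 0 x| + 1 := by positivity
    unfold geoBound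
    have hs := Real.sqrt_nonneg x
    refine add_le_add ?_ ?_
    · rw [div_le_iff₀ (by linarith)]
      nlinarith
    · calc (geoConst μ * √x + geoConst' μ * (|zf 0 x| + 1)) * (|zf 0 x| + 1)
          ≤ (geoConst μ * (2 + √x) + geoConst' μ * (2 + √x)) * (2 + √x) := by
            gcongr
            linarith
        _ = (geoConst μ + geoConst' μ) * (2 + √x) ^ 2 := by ring
        _ ≤ (geoConst μ + geoConst' μ) * (8 * (1 + x)) := by
            gcongr
            nlinarith [Real.sq_sqrt hx.le, sq_nonneg (√x - 2)]
        _ = _ := by ring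
  | succ n ih =>
    obtain ⟨N, C, hN, hC, h⟩ := ih
    have hR := rootConst_pos hμ
    set L := rootConst μ * (1 + K) ^ 2 with hL
    have hL0 : 0 ≤ L := by positivity
    refine ⟨N + 1, L / μ + C + C * L, by positivity, by positivity,
      fun zf h1 h2 c hc x hx => ?_⟩
    have h3 := h (fun k => zf (k + 1)) (fun i hi => h1 (i + 1) (by omega)) h2 c hc
    have h4 := stageRoot_mul_Del_le hμ hx hK (h1 0 (by omega) x hx)
    rw [← hL] at h4
    have h0 : 0 ≤ stageRoot μ x (zf 0 x) * Del (zf 0 x) :=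
      mul_nonneg (stageRoot_nonneg hμ hx.le _) (Del_nonneg _)
    have hov := overshoot_stageSize hμ hx (zf 0 x)
    -- A bound linear in the distance survives a stage, since by Wald's identity the mean remaining
    -- distance is at most `x` plus the overshoot.
    have hker : kernelAt μ (policyBound μ c n fun k => zf (k + 1)) x (stageSize μ x (zf 0 x))
        ≤ ENNReal.ofReal (N * c + C) + ENNReal.ofReal C
          * (ENNReal.ofReal x + overshoot μ x (stageSize μ x (zf 0 x))) := by
      rw [← kernelAt_ofReal_add hμ hx.le]
      calc _ ≤ kernelAt μ (fun y => ENNReal.ofReal (N * c + C)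
              + ENNReal.ofReal C * ENNReal.ofReal y) x (stageSize μ x (zf 0 x)) := by
            refine kernelAt_mono (fun y hy => (h3 y hy).trans ?_) _ _ _
            rw [← ENNReal.ofReal_mul hC, ← ENNReal.ofReal_add (by positivity) (by positivity)]
            exact ENNReal.ofReal_le_ofReal (by linarith)
        _ = kernelAt μ (fun _ => ENNReal.ofReal (N * c + C)) x (stageSize μ x (zf 0 x))
            + ENNReal.ofReal C * kernelAt μ ENNReal.ofReal x (stageSize μ x (zf 0 x)) := by
            rw [kernelAt_add measurable_const, kernelAt_const_mul ENNReal.measurable_ofReal]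
        _ ≤ _ := by
            gcongr
            · unfold kernelAt
              refine (lintegral_mono fun y => indicator_le_self (Ioi 0)
                (fun _ => ENNReal.ofReal (N * c + C)) _).trans ?_
              simp
            · exact le_self_add
    rw [hov] at hker
    rw [policyBound, stageStep, hov]
    refine (add_le_add le_rfl hker).trans ?_
    rw [← ENNReal.ofReal_inv_of_pos hμ, ← ENNReal.ofReal_mul (by positivity),
      ← ENNReal.ofReal_add hc (by positivity), ← ENNReal.ofReal_add hx.le h0,
      ← ENNReal.ofReal_mul hC, ← ENNReal.ofReal_add (by positivity) (by positivity),
      ← ENNReal.ofReal_add (by positivity) (by positivity)]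
    refine ENNReal.ofReal_le_ofReal ?_
    have h5 : μ⁻¹ * (stageRoot μ x (zf 0 x) * Del (zf 0 x)) ≤ L / μ * (1 + x) := by
      calc _ ≤ μ⁻¹ * (L * (1 + x)) := by gcongr
        _ = _ := by ring
    have h6 := mul_le_mul_of_nonneg_left h4 hC
    linarith

end StageUpper


/-! ### Asymptotic cost of a stage: the rare remaining distances are negligible. -/

section StageUpperAsymptotics

variable {μ : ℝ}

theorem tendsto_sqrt_log_add_one : Tendsto (fun x : ℝ => √(Real.log (x + 1))) atTop atTop :=
  Real.tendsto_sqrt_atTop.comp (Real.tendsto_log_atTop.comp (tendsto_atTop_add_const_right _ 1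
    tendsto_id))

theorem tendsto_sqrt_log_add_one_div :
    Tendsto (fun x : ℝ => √(Real.log (x + 1)) / √(Real.log x)) atTop (𝓝 1) := by
  have h := tendsto_log_add_one_div_log.sqrt
  rw [Real.sqrt_one] at h
  refine h.congr' ?_
  filter_upwards [eventually_ge_atTop 1] with x hx
  rw [Real.sqrt_div (Real.log_nonneg (by linarith))]

theorem tendsto_sqrt_log_add_one_div_sqrt :
    Tendsto (fun x : ℝ => √(Real.log (x + 1)) / √x) atTop (𝓝 0) :=
  tendsto_div_sqrt_of_div_sqrt_log tendsto_sqrt_log_add_one_div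

theorem tendsto_stageRoot (hμ : 0 < μ) {z : ℝ → ℝ}
    (hz : Tendsto (fun x => z x / √x) atTop (𝓝 0)) :
    Tendsto (fun x => stageRoot μ x (z x)) atTop atTop := by
  have hpos : 0 < 1 / √μ := by positivity
  refine ((tendsto_stageRoot_div hμ hz).pos_mul_atTop hpos Real.tendsto_sqrt_atTop).congr' ?_
  filter_upwards [eventually_gt_atTop 0] with x hx
  have := Real.sqrt_pos.2 hx
  field_simp

theorem eventually_stageRoot_le (hμ : 0 < μ) {z : ℝ → ℝ}
    (hz : Tendsto (fun x => z x / √x) atTop (𝓝 0)) {b : ℝ} (hb : 1 < b) :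
    ∀ᶠ x in atTop, stageRoot μ x (z x) ≤ b * (√x / √μ) := by
  have hpos : 0 < 1 / √μ := by positivity
  have h : 1 / √μ < b * (1 / √μ) := by nlinarith
  filter_upwards [(tendsto_stageRoot_div hμ hz).eventually (gt_mem_nhds h),
    eventually_gt_atTop 0] with x h1 hx
  have hs := Real.sqrt_pos.2 hx
  rw [div_lt_iff₀ hs] at h1
  calc stageRoot μ x (z x) ≤ b * (1 / √μ) * √x := h1.le
    _ = _ := by ring

theorem fFun_eq {x : ℝ} (hx : 0 ≤ x) :
    fFun μ x = 6 * √(Real.log (x + 1)) * (√x / √μ) := by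
  rw [fFun, Real.sqrt_mul hx]; ring

/-- The constant `6` in `f` is used here: divided by `3 / 2`, a margin in `√t ~ √(x / μ)`, it gives
`4`. Half of this, less a parameter `z ≤ √(log (x + 1))`, still leaves `√(log (x + 1))`. -/
theorem eventually_le_fFun_div (hμ : 0 < μ) {z : ℝ → ℝ}
    (hz : Tendsto (fun x => z x / √x) atTop (𝓝 0)) :
    ∀ᶠ x in atTop, 4 * √(Real.log (x + 1)) ≤ fFun μ x / stageRoot μ x (z x) := by
  filter_upwards [eventually_stageRoot_le hμ hz (show (1 : ℝ) < 3 / 2 by norm_num),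
    eventually_gt_atTop 0] with x h1 hx
  rw [le_div_iff₀ (stageRoot_pos hμ hx _), fFun_eq hx.le]
  calc 4 * √(Real.log (x + 1)) * stageRoot μ x (z x)
      ≤ 4 * √(Real.log (x + 1)) * (3 / 2 * (√x / √μ)) := by gcongr
    _ = _ := by ring

theorem exp_sqrt_log {x : ℝ} (hx : 0 < x) :
    √x * Real.exp (-√(Real.log (x + 1)) ^ 2 / 2) ≤ 1 := by
  rw [Real.sq_sqrt (Real.log_nonneg (by linarith)), neg_div, Real.exp_neg, ← div_eq_mul_inv,
    div_le_one (Real.exp_pos _), Real.exp_half, Real.exp_log (by linarith)]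
  exact Real.sqrt_le_sqrt (by linarith)

theorem tendsto_fFun_div_sub (hμ : 0 < μ) {z : ℝ → ℝ}
    (hz : Tendsto (fun x => z x / √x) atTop (𝓝 0)) (hzl : ∀ᶠ x in atTop, z x ≤ √(Real.log (x + 1))) :
    Tendsto (fun x => fFun μ x / stageRoot μ x (z x) - z x) atTop atTop := by
  refine tendsto_atTop_mono' _ ?_ tendsto_sqrt_log_add_one
  filter_upwards [eventually_le_fFun_div hμ hz, hzl] with x h1 h2
  have := Real.sqrt_nonneg (Real.log (x + 1))
  linarith

/-- The argument of `Del` is at least `√(log (x + 1))`, so its exponential bound cancels the `√x`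
from the stage, and the factor `1 / √(log (x + 1))` remains. -/
theorem tendsto_excess_fFun (hμ : 0 < μ) {z : ℝ → ℝ}
    (hz : Tendsto (fun x => z x / √x) atTop (𝓝 0)) (hzl : ∀ᶠ x in atTop, z x ≤ √(Real.log (x + 1))) :
    Tendsto (fun x => stageRoot μ x (z x)
      * Del (fFun μ x / (2 * stageRoot μ x (z x)) - z x)) atTop (𝓝 0) := by
  have hlim : Tendsto (fun x : ℝ => 3 / 2 * (1 / √μ) / √(Real.log (x + 1))) atTop (𝓝 0) :=
    tendsto_const_nhds.div_atTop tendsto_sqrt_log_add_one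
  refine tendsto_of_tendsto_of_tendsto_of_le_of_le' tendsto_const_nhds hlim ?_ ?_
  · filter_upwards [eventually_ge_atTop 0] with x hx
    exact mul_nonneg (stageRoot_nonneg hμ hx _) (Del_nonneg _)
  · filter_upwards [eventually_le_fFun_div hμ hz, hzl, eventually_gt_atTop 0,
      eventually_stageRoot_le hμ hz (show (1 : ℝ) < 3 / 2 by norm_num),
      tendsto_sqrt_log_add_one.eventually (eventually_gt_atTop 0)] with x h1 h2 hx h3 h4
    have h5 : √(Real.log (x + 1)) ≤ fFun μ x / (2 * stageRoot μ x (z x)) - z x := by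
      rw [mul_comm (2 : ℝ), ← div_div]; linarith
    have h6 := exp_sqrt_log hx
    calc stageRoot μ x (z x) * Del (fFun μ x / (2 * stageRoot μ x (z x)) - z x)
        ≤ 3 / 2 * (√x / √μ) * (Real.exp (-√(Real.log (x + 1)) ^ 2 / 2) / √(Real.log (x + 1))) :=
          mul_le_mul h3 ((Del_antitone h5).trans (Del_le_exp h4)) (Del_nonneg _) (by positivity)
      _ = 3 / 2 * (1 / √μ) / √(Real.log (x + 1))
          * (√x * Real.exp (-√(Real.log (x + 1)) ^ 2 / 2)) := by ring
      _ ≤ _ := mul_le_of_le_one_right (by positivity) h6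

/-- The cost of a stage followed by a procedure with cost `A c` at the distances at most `d`. -/
theorem eventually_stageStep_le (hμ : 0 < μ) {z d : ℝ → ℝ} {A B' N C y₀ ε : ℝ} (hA : 0 ≤ A)
    (hN : 0 ≤ N) (hNB : N ≤ B') (hC : 0 ≤ C) (hy₀ : 0 ≤ y₀) (hε : 0 < ε)
    (hz : Tendsto (fun x => z x / √x) atTop (𝓝 0)) (hzl : ∀ᶠ x in atTop, z x ≤ √(Real.log (x + 1)))
    (hd : Tendsto (fun x => d x / stageRoot μ x (z x) - z x) atTop atTop) :
    ∀ᶠ x in atTop, ∀ c, 1 ≤ c → ∀ v : ℝ → ℝ≥0∞,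
      (∀ y, 0 < y → v y ≤ ENNReal.ofReal (N * c + C * (1 + y))) →
      (∀ y, y₀ ≤ y → y ≤ d x → v y ≤ ENNReal.ofReal (A * c)) →
      (∀ y, y₀ ≤ y → y ≤ fFun μ x → v y ≤ ENNReal.ofReal (B' * c)) →
      stageStep μ c z v x ≤ ENNReal.ofReal ((1 + A * stdCdf (z x) + ε) * c
        + stageRoot μ x (z x) * Del (z x) / μ) := by
  have l1 : Tendsto (fun x => (N + C * (1 + y₀)) * (y₀ / stageRoot μ x (z x))) atTop (𝓝 0) := by
    simpa using (tendsto_const_nhds (x := y₀).div_atTop (tendsto_stageRoot hμ hz)).const_mul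
      (N + C * (1 + y₀))
  have l2 : Tendsto (fun x => B' * stdCdf (z x - d x / stageRoot μ x (z x))) atTop (𝓝 0) := by
    have h := tendsto_stdCdf_atBot.comp (tendsto_neg_atTop_atBot.comp hd)
    simpa using (h.congr fun x => by simp).const_mul B'
  have l3 := (tendsto_excess_fFun hμ hz hzl).const_mul (4 * C)
  have l := (l1.add l2).add l3
  simp only [mul_zero, add_zero] at l
  filter_upwards [l.eventually (gt_mem_nhds hε), eventually_gt_atTop 0,
    (tendsto_fFun hμ).eventually (eventually_ge_atTop 1)] with x hx hx0 hF c hc v h1 h2 h3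
  have hr := stageRoot_pos hμ hx0 (z x)
  have hc0 : 0 ≤ c := by linarith
  rw [stageStep_eq hμ hx0]
  refine (add_le_add le_rfl
    (lintegral_stage_le hr hc0 hA hN hNB hC hF hy₀ h1 h2 h3)).trans ?_
  have h4 := Del_nonneg (z x)
  have h5 := Del_nonneg (fFun μ x / (2 * stageRoot μ x (z x)) - z x)
  have h6 := stdCdf_nonneg (z x)
  have h7 := stdCdf_nonneg (z x - d x / stageRoot μ x (z x))
  have hB : 0 ≤ B' := hN.trans hNB
  rw [← ENNReal.ofReal_add hc0 (by positivity), ← ENNReal.ofReal_add (by positivity) (by positivity)]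
  refine ENNReal.ofReal_le_ofReal ?_
  have h8 := mul_le_mul_of_nonneg_right hx.le hc0
  -- As `c ≥ 1`, error terms that do not involve `c` may be multiplied by it.
  have h9 : (N * c + C * (1 + y₀)) * (y₀ / stageRoot μ x (z x))
      ≤ (N + C * (1 + y₀)) * (y₀ / stageRoot μ x (z x)) * c := by
    have e : (N + C * (1 + y₀)) * (y₀ / stageRoot μ x (z x)) * c
        = (N * c + C * (1 + y₀) * c) * (y₀ / stageRoot μ x (z x)) := by ring
    rw [e]
    gcongr ?_ * _
    have : C * (1 + y₀) ≤ C * (1 + y₀) * c := le_mul_of_one_le_right (by positivity) hc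
    linarith
  have h10 : 4 * C * (stageRoot μ x (z x) * Del (fFun μ x / (2 * stageRoot μ x (z x)) - z x))
      ≤ 4 * C * (stageRoot μ x (z x) * Del (fFun μ x / (2 * stageRoot μ x (z x)) - z x)) * c :=
    le_mul_of_one_le_right (by positivity) hc
  linarith

end StageUpperAsymptotics

/-! ### Cost of the samplers for the bands. -/

section BandUpper

variable {μ : ℝ}

theorem tendsto_atTop_of_crit_isLittleO {m : ℕ} (hm : 1 ≤ m) {g : ℝ → ℝ} (hg : g ∈ bandO m) :
    Tendsto g atTop atTop := by
  have h := (tendsto_norm_atTop_atTop.comp (tendsto_crit hm)).congr' (f₂ := fun x => ‖crit m x‖)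
    (by rfl)
  have h2 : Tendsto (fun x => ‖g x‖) atTop atTop := by
    refine tendsto_atTop_mono' _ ?_ h
    filter_upwards [hg.2.1.bound one_pos] with x hx
    simpa using hx
  refine h2.congr' ?_
  filter_upwards [eventually_gt_atTop 0] with x hx
  exact Real.norm_of_nonneg (hg.1 x hx).le

/-- From the second band on, `g` is small compared with `√x`, so `x / g²` tends to infinity. -/
theorem tendsto_log_div_sq {m : ℕ} {g : ℝ → ℝ} (hg : g ∈ bandO (m + 2)) :
    Tendsto (fun x => √(Real.log (x / g x ^ 2 + 1))) atTop atTop := by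
  have h1 : Tendsto (fun x => g x / √x) atTop (𝓝 0) := by
    have h2 : g =o[atTop] fun x : ℝ => √x := by
      refine hg.2.2.trans_isBigO (IsBigO.of_bound 1 ?_)
      filter_upwards [eventually_gt_atTop 1] with x hx
      rw [Real.norm_of_nonneg (crit_pos (by omega) hx).le, Real.norm_of_nonneg (Real.sqrt_nonneg _),
        one_mul]
      exact crit_le_sqrt (by omega) hx.le
    exact h2.tendsto_div_nhds_zero
  have h3 : Tendsto (fun x => (g x / √x) ^ 2) atTop (𝓝[>] 0) := by
    refine tendsto_nhdsWithin_iff.2 ⟨by simpa using h1.pow 2, ?_⟩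
    filter_upwards [eventually_gt_atTop 0] with x hx
    have := hg.1 x hx
    have := Real.sqrt_pos.2 hx
    simp only [mem_Ioi]; positivity
  refine Real.tendsto_sqrt_atTop.comp (Real.tendsto_log_atTop.comp
    (tendsto_atTop_add_const_right _ 1 (h3.inv_tendsto_nhdsGT_zero.congr' ?_)))
  filter_upwards [eventually_gt_atTop 0] with x hx
  simp only [Pi.inv_apply]
  rw [div_pow, Real.sq_sqrt hx.le, inv_div]

theorem exp_sqrt_log_div {x g : ℝ} (hx : 0 < x) (hg : 0 < g) :
    √x * Real.exp (-√(Real.log (x / g ^ 2 + 1)) ^ 2 / 2) ≤ g := by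
  have h0 : 0 < x / g ^ 2 := by positivity
  rw [Real.sq_sqrt (Real.log_nonneg (by linarith)), neg_div, Real.exp_neg, ← div_eq_mul_inv,
    div_le_iff₀ (Real.exp_pos _), Real.exp_half, Real.exp_log (by linarith)]
  calc √x = g * √(x / g ^ 2) := by
        rw [Real.sqrt_div hx.le, Real.sqrt_sq hg.le]; field_simp
    _ ≤ _ := by gcongr; linarith

/-- The parameter `z` is chosen so that `√x exp (-z² / 2) ≤ g`; the factor `1 / z` in `Del_le_exp`
then makes the overshoot negligible. -/
theorem tendsto_overshootO (hμ : 0 < μ) {m : ℕ} {g : ℝ → ℝ} (hg : g ∈ bandO (m + 2)) :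
    Tendsto (fun x => stageRoot μ x (√(Real.log (x / g x ^ 2 + 1)))
      * Del (√(Real.log (x / g x ^ 2 + 1))) / μ / g x) atTop (𝓝 0) := by
  have hz := tendsto_log_div_sq hg
  have hlim : Tendsto (fun x => 1 / √μ / μ / √(Real.log (x / g x ^ 2 + 1))) atTop (𝓝 0) :=
    tendsto_const_nhds.div_atTop hz
  refine tendsto_of_tendsto_of_tendsto_of_le_of_le' tendsto_const_nhds hlim ?_ ?_
  · filter_upwards [eventually_gt_atTop 0] with x hx
    have := hg.1 x hx
    have := stageRoot_nonneg hμ hx.le (√(Real.log (x / g x ^ 2 + 1)))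
    have := Del_nonneg (√(Real.log (x / g x ^ 2 + 1)))
    positivity
  · filter_upwards [eventually_gt_atTop 0, hz.eventually (eventually_gt_atTop 0)] with x hx hz0
    have hgx := hg.1 x hx
    have h1 := stageRoot_le hμ hx.le hz0.le
    have h2 := Del_le_exp hz0
    have h3 := exp_sqrt_log_div hx hgx
    rw [Real.sqrt_div hx.le] at h1
    generalize √(Real.log (x / g x ^ 2 + 1)) = z at *
    rw [div_le_iff₀ hgx, div_le_iff₀ hμ]
    calc stageRoot μ x z * Del z ≤ √x / √μ * (Real.exp (-z ^ 2 / 2) / z) :=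
          mul_le_mul h1 h2 (Del_nonneg z) (by positivity)
      _ = 1 / √μ / z * (√x * Real.exp (-z ^ 2 / 2)) := by ring
      _ ≤ 1 / √μ / z * g x := by gcongr
      _ = _ := by field_simp

/-- In the first band `g` dominates `√x`, so `√g / x^(1/4)` tends to infinity. Hence a single stage
crosses with probability tending to `1`. -/
theorem tendsto_zetaFun {g : ℝ → ℝ} (hg : g ∈ bandO 1) : Tendsto (zetaFun g) atTop atBot := by
  refine tendsto_neg_atTop_atBot.comp (tendsto_atTop.2 fun b => ?_)
  have h1 : Tendsto (fun x => √(g x / √x)) atTop atTop := by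
    have h2 : Tendsto (fun x => crit 1 x / g x) atTop (𝓝[>] 0) := by
      refine tendsto_nhdsWithin_iff.2 ⟨hg.2.1.tendsto_div_nhds_zero, ?_⟩
      filter_upwards [eventually_gt_atTop 1] with x hx
      exact div_pos (crit_pos le_rfl hx) (hg.1 x (by linarith))
    refine Real.tendsto_sqrt_atTop.comp (h2.inv_tendsto_nhdsGT_zero.congr fun x => ?_)
    simp [crit_one_eq]
  filter_upwards [h1.eventually (eventually_ge_atTop b), eventually_gt_atTop 0,
    (tendsto_rpow_atTop (show (0 : ℝ) < 1 / 7 by norm_num)).eventually (eventually_ge_atTop b)]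
    with x h2 hx h3
  refine le_min ?_ h3
  rw [Real.sqrt_div (hg.1 x hx).le, Real.sqrt_eq_rpow √x, Real.sqrt_eq_rpow x,
    ← Real.rpow_mul hx.le] at h2
  norm_num at h2 ⊢
  exact h2

theorem zetaFun_nonpos {g : ℝ → ℝ} {x : ℝ} (hx : 0 < x) : zetaFun g x ≤ 0 := by
  unfold zetaFun
  have : 0 ≤ min (√(g x) / x ^ (1 / 4 : ℝ)) (x ^ (1 / 7 : ℝ)) := le_min (by positivity) (by positivity)
  linarith

theorem le_zetaFun {g : ℝ → ℝ} {x : ℝ} (hx : 0 < x) : -(1 + √x) ≤ zetaFun g x := by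
  unfold zetaFun
  refine neg_le_neg ((min_le_right _ _).trans ?_)
  rcases le_total x 1 with h | h
  · have : x ^ (1 / 7 : ℝ) ≤ 1 := Real.rpow_le_one hx.le h (by norm_num)
    have := Real.sqrt_nonneg x
    linarith
  · have : x ^ (1 / 7 : ℝ) ≤ x ^ (1 / 2 : ℝ) := Real.rpow_le_rpow_of_exponent_le h (by norm_num)
    rw [← Real.sqrt_eq_rpow] at this
    linarith

/-- The part of the bound for geometric sampling that does not depend on the cost per stage. -/
theorem geoBound_zetaFun_isLittleO {g : ℝ → ℝ} (hg : g ∈ bandO 1) (A A' : ℝ) :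
    Tendsto (fun x => (A * √x + A' * (|zetaFun g x| + 1)) * (|zetaFun g x| + 1) / g x)
      atTop (𝓝 0) := by
  -- here `√x |ζ| / g ≤ √(√x / g) → 0` and `ζ ^ 2 / g ≤ 1 / √x → 0`
  have hu : Tendsto (fun x => √x / g x) atTop (𝓝 0) :=
    hg.2.1.tendsto_div_nhds_zero.congr fun x => by rw [crit_one_eq]
  have hgi : Tendsto (fun x => 1 / g x) atTop (𝓝 0) :=
    tendsto_const_nhds.div_atTop (tendsto_atTop_of_crit_isLittleO le_rfl hg)
  have h4 : ∀ᶠ x in atTop, |zetaFun g x| ≤ √(g x) / x ^ (1 / 4 : ℝ) := by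
    filter_upwards [eventually_gt_atTop 0] with x hx
    rw [abs_of_nonpos (zetaFun_nonpos hx), zetaFun, neg_neg]
    exact min_le_left _ _
  have h5 : Tendsto (fun x => √x * |zetaFun g x| / g x) atTop (𝓝 0) := by
    have hsu := hu.sqrt
    rw [Real.sqrt_zero] at hsu
    refine tendsto_of_tendsto_of_tendsto_of_le_of_le' tendsto_const_nhds hsu ?_ ?_
    · filter_upwards [eventually_gt_atTop 0] with x hx
      have := hg.1 x hx
      positivity
    · filter_upwards [h4, eventually_gt_atTop 0] with x h6 hx
      have hgx := hg.1 x hx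
      have hx4 : 0 < x ^ (1 / 4 : ℝ) := by positivity
      have e : √x = x ^ (1 / 4 : ℝ) * x ^ (1 / 4 : ℝ) := by
        rw [← Real.rpow_add hx, Real.sqrt_eq_rpow]; norm_num
      have e2 := Real.mul_self_sqrt hgx.le
      have hsg := Real.sqrt_pos.2 hgx
      rw [Real.sqrt_div (Real.sqrt_nonneg x), e, Real.sqrt_mul_self hx4.le]
      calc _ ≤ x ^ (1 / 4 : ℝ) * x ^ (1 / 4 : ℝ) * (√(g x) / x ^ (1 / 4 : ℝ)) / (√(g x) * √(g x)) := by
            rw [e2]; gcongr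
        _ = _ := by field_simp
  have h6 : Tendsto (fun x => |zetaFun g x| ^ 2 / g x) atTop (𝓝 0) := by
    have hlim : Tendsto (fun x : ℝ => 1 / √x) atTop (𝓝 0) :=
      tendsto_const_nhds.div_atTop Real.tendsto_sqrt_atTop
    refine tendsto_of_tendsto_of_tendsto_of_le_of_le' tendsto_const_nhds hlim ?_ ?_
    · filter_upwards [eventually_gt_atTop 0] with x hx
      have := hg.1 x hx
      positivity
    · filter_upwards [h4, eventually_gt_atTop 0] with x h6 hx
      have hgx := hg.1 x hx
      have e : √x = (x ^ (1 / 4 : ℝ)) ^ 2 := by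
        rw [sq, ← Real.rpow_add hx, Real.sqrt_eq_rpow]; norm_num
      rw [div_le_iff₀ hgx, e]
      calc |zetaFun g x| ^ 2 ≤ (√(g x) / x ^ (1 / 4 : ℝ)) ^ 2 := by gcongr
        _ = _ := by rw [div_pow, Real.sq_sqrt hgx.le]; ring
  have h7 : Tendsto (fun x => 2 * (|zetaFun g x| ^ 2 / g x) + 2 * (1 / g x)) atTop (𝓝 0) := by
    simpa using (h6.const_mul 2).add (hgi.const_mul 2)
  have h8 : Tendsto (fun x => (|zetaFun g x| + 1) ^ 2 / g x) atTop (𝓝 0) := by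
    refine tendsto_of_tendsto_of_tendsto_of_le_of_le' tendsto_const_nhds h7 ?_ ?_
    · filter_upwards [eventually_gt_atTop 0] with x hx
      have := hg.1 x hx
      positivity
    · filter_upwards [eventually_gt_atTop 0] with x hx
      have hgx := hg.1 x hx
      rw [div_le_iff₀ hgx]
      have : (2 * (|zetaFun g x| ^ 2 / g x) + 2 * (1 / g x)) * g x
          = 2 * |zetaFun g x| ^ 2 + 2 := by field_simp
      rw [this]
      nlinarith [sq_nonneg (|zetaFun g x| - 1)]
  have h9 := ((h5.add hu).const_mul A).add (h8.const_mul A')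
  simp only [add_zero, mul_zero] at h9
  refine h9.congr fun x => ?_
  ring

theorem paramsO_bounds (m : ℕ) (g : ℝ → ℝ) :
    (∀ i < m, ∀ x, 0 < x → -0 ≤ paramsO μ m g i x) ∧
      ∀ x, 0 < x → paramsO μ m g m x ≤ 0 ∧ -(1 + √x) ≤ paramsO μ m g m x := by
  induction m generalizing g with
  | zero => exact ⟨fun i hi => by omega, fun x hx => ⟨zetaFun_nonpos hx, le_zetaFun hx⟩⟩
  | succ m ih =>
    refine ⟨fun i hi x hx => ?_, (ih _).2⟩
    rcases i with _ | i
    · simp only [paramsO, consSeq, neg_zero]; positivity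
    · exact (ih _).1 i (by omega) x hx

/-- The cost of `samplerO μ (m + 1) g` is asymptotically at most `m + 1` stages. -/
theorem eventually_policyBound_paramsO_le (hμ : 0 < μ) (m : ℕ) {g : ℝ → ℝ} (hg : g ∈ bandO (m + 1))
    (hmon : m = 0 ∨ ∃ x₀, MonotoneOn g (Ici x₀)) {ε : ℝ} (hε : 0 < ε) :
    ∀ᶠ x in atTop, ∀ c, g x ≤ c →
      policyBound μ c m (paramsO μ m g) x ≤ ENNReal.ofReal ((m + 1 + ε) * c) := by
  induction m generalizing g ε with
  | zero =>
    have h1 : Tendsto (fun x => 1 / (1 - stdCdf (zetaFun g x))) atTop (𝓝 (1 / (1 - 0))) :=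
      tendsto_const_nhds.div (tendsto_const_nhds.sub (tendsto_stdCdf_atBot.comp (tendsto_zetaFun hg)))
        (by norm_num)
    have h2 := geoBound_zetaFun_isLittleO hg (geoConst μ) (geoConst' μ)
    filter_upwards [h1.eventually (gt_mem_nhds (show 1 / (1 - 0) < 1 + ε / 2 by linarith)),
      h2.eventually (gt_mem_nhds (half_pos hε)), eventually_gt_atTop 0] with x h3 h4 hx c hc
    have hgx := hg.1 x hx
    rw [div_lt_iff₀ hgx] at h4
    refine ENNReal.ofReal_le_ofReal ?_
    have h5 : c / (1 - stdCdf (zetaFun g x)) ≤ (1 + ε / 2) * c := by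
      rw [div_eq_mul_one_div, mul_comm]
      exact mul_le_mul_of_nonneg_right h3.le (by linarith)
    have h6 : ε / 2 * g x ≤ ε / 2 * c := by gcongr
    simp only [paramsO, geoBound]
    push_cast
    linarith
  | succ m ih =>
    obtain ⟨x₀, hx₀⟩ := hmon.resolve_left (by omega)
    have hg' := comp_fInv_mem_bandO hμ (by omega) hg
    obtain ⟨y₀, hy₀⟩ := (((ih hg' (Or.inr (monotoneOn_comp_fInv hμ hx₀))
      (show 0 < ε / 4 by positivity)).and (((tendsto_fInv hμ).eventually (eventually_ge_atTop x₀)).and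
        (eventually_gt_atTop 0)))).exists_forall_of_atTop
    obtain ⟨N, C, hN, hC, hcrude⟩ := exists_policyBound_le hμ (le_refl (0 : ℝ)) (n := m)
    set z : ℝ → ℝ := fun a => √(Real.log (a / g a ^ 2 + 1)) with hz
    have hgtop := tendsto_atTop_of_crit_isLittleO (by omega) hg
    have hzl : ∀ᶠ x in atTop, z x ≤ √(Real.log (x + 1)) := by
      filter_upwards [hgtop.eventually (eventually_ge_atTop 1), eventually_gt_atTop 0] with x h1 hx
      have : x / g x ^ 2 ≤ x := div_le_self hx.le (one_le_pow₀ h1)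
      have h0 : 0 < x / g x ^ 2 := by positivity
      exact Real.sqrt_le_sqrt (Real.log_le_log (by linarith) (by linarith))
    have hzs : Tendsto (fun x => z x / √x) atTop (𝓝 0) := by
      refine tendsto_of_tendsto_of_tendsto_of_le_of_le' tendsto_const_nhds
        tendsto_sqrt_log_add_one_div_sqrt (Eventually.of_forall fun x => by positivity) ?_
      filter_upwards [hzl] with x hx
      gcongr
    -- The inductive bound holds all the way up to `f(x)`, so the typical range and the whole
    -- controlled range coincide; adding `N` to `B'` only serves the requirement `N ≤ B'`.
    have key := eventually_stageStep_le hμ (z := z) (d := fFun μ) (A := m + 1 + ε / 4)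
      (B' := m + 1 + ε / 4 + N) (N := N) (C := C) (y₀ := max y₀ 0) (ε := ε / 4) (by positivity) hN
      (by linarith [show (0 : ℝ) ≤ m + 1 + ε / 4 by positivity]) hC (le_max_right _ _)
      (by positivity) hzs hzl (tendsto_fFun_div_sub hμ hzs hzl)
    filter_upwards [key, hgtop.eventually (eventually_ge_atTop 1), eventually_gt_atTop 0,
      eventually_ge_atTop x₀, (tendsto_overshootO hμ hg).eventually
        (gt_mem_nhds (show 0 < ε / 4 by positivity))] with x h1 h2 hx hxx₀ h3 c hc
    have hc1 : 1 ≤ c := h2.trans hc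
    have hgx := hg.1 x hx
    -- At distances `y ≤ f(x)` monotonicity gives `g (f⁻¹ y) ≤ g x ≤ c`, so the inductive bound
    -- applies with the same `c`. This is the purpose of composing with `f⁻¹` and of the
    -- monotonicity of `g`.
    have hmid : ∀ y, max y₀ 0 ≤ y → y ≤ fFun μ x →
        policyBound μ c m (paramsO μ m (g ∘ fInv μ)) y ≤ ENNReal.ofReal ((m + 1 + ε / 4) * c) := by
      intro y hy hyF
      obtain ⟨h4, h5, h6⟩ := hy₀ y ((le_max_left _ _).trans hy)
      refine h4 c (le_trans ?_ hc)
      exact hx₀ h5 hxx₀ (fInv_le hμ h6 hx hyF)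
    refine (h1 c hc1 _ (fun y hy => hcrude _ (paramsO_bounds m _).1
      (paramsO_bounds m _).2 c (by linarith) y hy) hmid
      (fun y hy hyF => (hmid y hy hyF).trans (ENNReal.ofReal_le_ofReal
        (mul_le_mul_of_nonneg_right (by linarith) (by linarith))))).trans ?_
    refine ENNReal.ofReal_le_ofReal ?_
    change stageRoot μ x (z x) * Del (z x) / μ / g x < ε / 4 at h3
    rw [div_lt_iff₀ hgx] at h3
    have h4 : (m + 1 + ε / 4) * stdCdf (z x) ≤ m + 1 + ε / 4 :=
      mul_le_of_le_one_right (by positivity) (stdCdf_lt_one _).le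
    have h5 := mul_le_mul_of_nonneg_right h4 (show 0 ≤ c by linarith)
    have h6 : ε / 4 * g x ≤ ε / 4 * c := by gcongr
    have h7 : 0 ≤ ε * c := by positivity
    push_cast
    linarith

end BandUpper


/-! ### Cost of the samplers on the boundaries between bands. -/

section PlusUpper

variable {μ : ℝ}

theorem tendsto_sqrt_log_add_one_div_rpow {s : ℝ} (hs : 0 < s) :
    Tendsto (fun x : ℝ => (√(Real.log (x + 1)) + 1) / x ^ s) atTop (𝓝 0) := by
  have h1 : Tendsto (fun x : ℝ => √(Real.log x / x ^ (s + s))) atTop (𝓝 0) := by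
    have := (isLittleO_log_rpow_atTop (show 0 < s + s by positivity)).tendsto_div_nhds_zero.sqrt
    rwa [Real.sqrt_zero] at this
  have h2 : Tendsto (fun x : ℝ => 1 / x ^ s) atTop (𝓝 0) :=
    tendsto_const_nhds.div_atTop (tendsto_rpow_atTop hs)
  have h3 := (tendsto_sqrt_log_add_one_div.mul h1).add h2
  simp only [mul_zero, add_zero] at h3
  refine h3.congr' ?_
  filter_upwards [eventually_gt_atTop 1] with x hx
  have hx0 : 0 < x := by linarith
  have hl := Real.sqrt_pos.2 (Real.log_pos hx)
  have hxs : 0 < x ^ s := Real.rpow_pos_of_pos hx0 s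
  rw [Real.sqrt_div (Real.log_pos hx).le, Real.rpow_add hx0, Real.sqrt_mul_self hxs.le]
  field_simp

theorem nuFun_bounds {x : ℝ} (hx : 0 < x) : nuFun x ≤ 0 ∧ -(1 + √x) ≤ nuFun x := by
  unfold nuFun
  have h1 := Real.sqrt_nonneg (Real.log (x + 1))
  have h2 : √(Real.log (x + 1)) ≤ √x := by
    refine Real.sqrt_le_sqrt ?_
    have := Real.log_le_sub_one_of_pos (show 0 < x + 1 by linarith)
    linarith
  constructor <;> linarith

theorem tendsto_nuFun : Tendsto nuFun atTop atBot :=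
  tendsto_neg_atTop_atBot.comp tendsto_sqrt_log_add_one

/-- The exponent `2 / 3` lies above `1 / 2`, which absorbs the logarithms, and is small enough that
the bound at distance `f(x)` is negligible against `√x`, by `tendsto_fFun_rpow`. -/
theorem tendsto_geoBound_nuFun (A A' : ℝ) :
    Tendsto (fun x => (A * √x + A' * (|nuFun x| + 1)) * (|nuFun x| + 1) / x ^ (2 / 3 : ℝ))
      atTop (𝓝 0) := by
  have h := ((tendsto_sqrt_log_add_one_div_rpow (show (0 : ℝ) < 1 / 6 by norm_num)).const_mul A).add
    (((tendsto_sqrt_log_add_one_div_rpow (show (0 : ℝ) < 1 / 3 by norm_num)).pow 2).const_mul A')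
  rw [mul_zero, zero_pow two_ne_zero, mul_zero, add_zero] at h
  refine h.congr' ?_
  filter_upwards [eventually_gt_atTop 0] with x hx
  have e1 : x ^ (2 / 3 : ℝ) = x ^ (1 / 6 : ℝ) * √x := by
    rw [Real.sqrt_eq_rpow, ← Real.rpow_add hx]; norm_num
  have e2 : x ^ (2 / 3 : ℝ) = (x ^ (1 / 3 : ℝ)) ^ 2 := by
    rw [← Real.rpow_natCast, ← Real.rpow_mul hx.le]; norm_num
  have hs := Real.sqrt_pos.2 hx
  have h6 : 0 < x ^ (1 / 6 : ℝ) := by positivity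
  have h3 : 0 < x ^ (1 / 3 : ℝ) := by positivity
  rw [nuFun, abs_neg, abs_of_nonneg (Real.sqrt_nonneg _)]
  generalize √(Real.log (x + 1)) + 1 = q
  have a1 : A * √x * q / x ^ (2 / 3 : ℝ) = A * (q / x ^ (1 / 6 : ℝ)) := by rw [e1]; field_simp
  have a2 : A' * q * q / x ^ (2 / 3 : ℝ) = A' * (q / x ^ (1 / 3 : ℝ)) ^ 2 := by rw [e2]; field_simp
  rw [add_mul, add_div, a1, a2]

theorem tendsto_fFun_rpow (hμ : 0 < μ) :
    Tendsto (fun x => fFun μ x ^ (2 / 3 : ℝ) / √x) atTop (𝓝 0) := by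
  have h1 := (tendsto_sqrt_log_add_one_div_rpow (show (0 : ℝ) < 1 / 4 by norm_num)).const_mul
    (6 / √μ)
  rw [mul_zero] at h1
  have h2 : Tendsto (fun x => fFun μ x / x ^ (3 / 4 : ℝ)) atTop (𝓝 0) := by
    refine tendsto_of_tendsto_of_tendsto_of_le_of_le' tendsto_const_nhds h1 ?_ ?_
    · filter_upwards [eventually_gt_atTop 0] with x hx
      have := fFun_pos hμ hx
      positivity
    · filter_upwards [eventually_gt_atTop 0] with x hx
      have e : x ^ (3 / 4 : ℝ) = x ^ (1 / 4 : ℝ) * √x := by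
        rw [Real.sqrt_eq_rpow, ← Real.rpow_add hx]; norm_num
      have hs := Real.sqrt_pos.2 hx
      rw [fFun_eq hx.le, e]
      calc 6 * √(Real.log (x + 1)) * (√x / √μ) / (x ^ (1 / 4 : ℝ) * √x)
          = 6 / √μ * (√(Real.log (x + 1)) / x ^ (1 / 4 : ℝ)) := by field_simp
        _ ≤ _ := by gcongr; linarith
  have h3 := h2.rpow_const (p := 2 / 3) (Or.inr (by norm_num))
  rw [Real.zero_rpow (by norm_num)] at h3
  refine h3.congr' ?_
  filter_upwards [eventually_gt_atTop 0] with x hx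
  rw [Real.div_rpow (fFun_pos hμ hx).le (by positivity), ← Real.rpow_mul hx.le, Real.sqrt_eq_rpow]
  norm_num

theorem paramsPlus_bounds (m : ℕ) (z : ℝ) :
    (∀ i < m + 1, ∀ x, 0 < x → -|z| ≤ paramsPlus m z i x) ∧
      ∀ x, 0 < x → paramsPlus m z (m + 1) x ≤ 0 ∧ -(1 + √x) ≤ paramsPlus m z (m + 1) x := by
  induction m with
  | zero =>
    refine ⟨fun i hi x hx => ?_, fun x hx => nuFun_bounds hx⟩
    obtain rfl : i = 0 := by omega
    exact neg_abs_le z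
  | succ m ih =>
    refine ⟨fun i hi x hx => ?_, ih.2⟩
    rcases i with _ | i
    · have : 0 ≤ |z| := abs_nonneg z
      exact le_trans (by linarith) (Real.sqrt_nonneg _)
    · exact ih.1 i (by omega) x hx

theorem sqrt_critical_le {p : ℝ} (hp0 : 0 ≤ p) {x : ℝ} (hx : 0 ≤ x) :
    √((1 - p) * Real.log (x + 1)) ≤ √(Real.log (x + 1)) := by
  refine Real.sqrt_le_sqrt ?_
  have := mul_nonneg hp0 (Real.log_nonneg (show 1 ≤ x + 1 by linarith))
  linarith

theorem tendsto_sqrt_critical_div {p : ℝ} (hp1 : p ≤ 1) :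
    Tendsto (fun x : ℝ => √((1 - p) * Real.log (x + 1)) / √(Real.log x)) atTop (𝓝 √(1 - p)) := by
  have h := tendsto_sqrt_log_add_one_div.const_mul √(1 - p)
  rw [mul_one] at h
  refine h.congr fun x => ?_
  rw [Real.sqrt_mul (by linarith)]
  ring

theorem tendsto_sqrt_critical {p : ℝ} (hp1 : p < 1) :
    Tendsto (fun x : ℝ => √((1 - p) * Real.log (x + 1))) atTop atTop := by
  refine (tendsto_sqrt_log_add_one.const_mul_atTop
    (Real.sqrt_pos.2 (show 0 < 1 - p by linarith))).congr fun x => ?_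
  rw [Real.sqrt_mul (by linarith)]

/-- With `p = 2^(-m)` the critical parameter gives `√x exp (-z² / 2) ≤ x^(p / 2)`, the power of `x`
in `h_{m+1}`. The factor `1 / z` of `Del_le_exp` tends to zero. -/
theorem tendsto_overshootPlus (hμ : 0 < μ) {m : ℕ} (hm : 1 ≤ m) :
    Tendsto (fun x => stageRoot μ x (√((1 - (1 / 2 : ℝ) ^ m) * Real.log (x + 1)))
      * Del (√((1 - (1 / 2 : ℝ) ^ m) * Real.log (x + 1))) / μ / crit (m + 1) x) atTop (𝓝 0) := by
  have hp0 := half_pow_pos m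
  have hp := half_pow_le hm
  have e : (1 / 2 : ℝ) ^ (m + 1) = (1 / 2 : ℝ) ^ m / 2 := by rw [pow_succ]; ring
  have hcrit : ∀ x, Real.exp 1 ≤ x → x ^ ((1 / 2 : ℝ) ^ m / 2) ≤ crit (m + 1) x := fun x hx => by
    rw [← e]; exact rpow_le_crit (by omega) hx
  set p := (1 / 2 : ℝ) ^ m with hpdef
  have hz := tendsto_sqrt_critical (p := p) (by linarith)
  have hlim : Tendsto (fun x : ℝ => 1 / √μ / μ / √((1 - p) * Real.log (x + 1))) atTop (𝓝 0) :=
    tendsto_const_nhds.div_atTop hz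
  refine tendsto_of_tendsto_of_tendsto_of_le_of_le' tendsto_const_nhds hlim ?_ ?_
  · filter_upwards [eventually_gt_atTop 1] with x hx
    have := crit_pos (m := m + 1) (by omega) hx
    have := stageRoot_nonneg hμ (show 0 ≤ x by linarith) (√((1 - p) * Real.log (x + 1)))
    have := Del_nonneg (√((1 - p) * Real.log (x + 1)))
    positivity
  · filter_upwards [eventually_gt_atTop 1, hz.eventually (eventually_gt_atTop 0),
      eventually_ge_atTop (Real.exp 1)] with x hx1 hz0 hxe
    have hx : 0 < x := by linarith
    have hc := crit_pos (m := m + 1) (by omega) hx1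
    have h1 := stageRoot_le hμ hx.le hz0.le
    have h2 := Del_le_exp hz0
    have h3 : √x * Real.exp (-√((1 - p) * Real.log (x + 1)) ^ 2 / 2) ≤ crit (m + 1) x := by
      refine le_trans ?_ (hcrit x hxe)
      rw [Real.sq_sqrt (mul_nonneg (by linarith) (Real.log_nonneg (by linarith)))]
      have h4 : Real.exp (-((1 - p) * Real.log (x + 1)) / 2) ≤ x ^ (-((1 - p) / 2)) := by
        rw [Real.rpow_def_of_pos hx]
        refine Real.exp_le_exp.2 ?_
        have := Real.log_le_log hx (show x ≤ x + 1 by linarith)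
        nlinarith
      calc _ ≤ x ^ (1 / 2 : ℝ) * x ^ (-((1 - p) / 2)) := by
            rw [Real.sqrt_eq_rpow]; gcongr
        _ = _ := by rw [← Real.rpow_add hx]; congr 1; ring
    rw [Real.sqrt_div hx.le] at h1
    generalize √((1 - p) * Real.log (x + 1)) = z at *
    rw [div_le_iff₀ hc, div_le_iff₀ hμ]
    calc stageRoot μ x z * Del z ≤ √x / √μ * (Real.exp (-z ^ 2 / 2) / z) :=
          mul_le_mul h1 h2 (Del_nonneg z) (by positivity)
      _ = 1 / √μ / z * (√x * Real.exp (-z ^ 2 / 2)) := by ring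
      _ ≤ 1 / √μ / z * crit (m + 1) x := by gcongr
      _ = _ := by field_simp

/-- The first stage costs `c` plus an overshoot of about `κ_1 √x Δ(z)`, at most about `(κ_1 / Q)
Δ(z) c`. If it fails, with probability `Φ(z)`, geometric sampling from a distance at most `f(x)`
typically needs one more stage, with overshoot `o(√x)`. -/
theorem policyBound_paramsPlus_zero (hμ : 0 < μ) (z : ℝ) {Q ε : ℝ} (hQ : 0 < Q) (hε : 0 < ε) :
    ∀ᶠ x in atTop, ∀ c, Q * crit 1 x ≤ c →
      policyBound μ c 1 (paramsPlus 0 z) x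
        ≤ ENNReal.ofReal ((1 + stdCdf z + kap μ 1 / Q * Del z + ε) * c) := by
  have hΦ : Tendsto (fun x => 1 / (1 - stdCdf (nuFun x))) atTop (𝓝 (1 / (1 - 0))) :=
    tendsto_const_nhds.div (tendsto_const_nhds.sub (tendsto_stdCdf_atBot.comp tendsto_nuFun))
      (by norm_num)
  obtain ⟨y₀, hy₀⟩ := ((hΦ.eventually (gt_mem_nhds (show 1 / (1 - 0) < 1 + ε / 8 by linarith))).and
    (((tendsto_geoBound_nuFun (geoConst μ) (geoConst' μ)).eventually (gt_mem_nhds one_pos)).and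
      (eventually_gt_atTop 0))).exists_forall_of_atTop
  obtain ⟨N, C, hN, hC, hcrude⟩ := exists_policyBound_le hμ (abs_nonneg z) (n := 0)
  have hzs : Tendsto (fun x : ℝ => z / √x) atTop (𝓝 0) :=
    tendsto_const_nhds.div_atTop Real.tendsto_sqrt_atTop
  have hzl : ∀ᶠ x : ℝ in atTop, z ≤ √(Real.log (x + 1)) :=
    tendsto_sqrt_log_add_one.eventually (eventually_ge_atTop z)
  have key := eventually_stageStep_le hμ (z := fun _ => z) (d := fFun μ) (A := 1 + ε / 4)
    (B' := 1 + ε / 4 + N) (N := N) (C := C) (y₀ := max y₀ 0) (ε := ε / 4) (by positivity) hN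
    (by linarith) hC (le_max_right _ _) (by positivity) hzs hzl (tendsto_fFun_div_sub hμ hzs hzl)
  have hover : Tendsto (fun x => stageRoot μ x z / √x * Del z / μ / Q) atTop
      (𝓝 (1 / √μ * Del z / μ / Q)) :=
    ((((tendsto_stageRoot_div hμ hzs).mul_const _).div_const _).div_const _)
  have hkap : 1 / √μ * Del z / μ / Q = kap μ 1 / Q * Del z := by
    have : kap μ 1 = 1 / √μ / μ := by
      rw [kap_one, show (-(3 / 2) : ℝ) = -(1 / 2) + -1 by norm_num, Real.rpow_add hμ,
        Real.rpow_neg hμ.le, Real.rpow_neg_one, Real.sqrt_eq_rpow]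
      ring
    rw [this]; ring
  rw [hkap] at hover
  filter_upwards [key, eventually_gt_atTop 0, (Real.tendsto_sqrt_atTop.const_mul_atTop hQ).eventually
      (eventually_ge_atTop 1), (tendsto_fFun_rpow hμ).eventually
      (gt_mem_nhds (show 0 < ε / 8 * Q by positivity)),
    hover.eventually (gt_mem_nhds (show _ < kap μ 1 / Q * Del z + ε / 4 by linarith))]
    with x h1 hx h2 h3 h4 c hc
  rw [crit_one_eq] at hc
  have hs := Real.sqrt_pos.2 hx
  have hc1 : 1 ≤ c := h2.trans hc
  have hc0 : 0 ≤ c := by linarith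
  have hmid : ∀ y, max y₀ 0 ≤ y → y ≤ fFun μ x →
      policyBound μ c 0 (fun _ => nuFun) y ≤ ENNReal.ofReal ((1 + ε / 4) * c) := by
    intro y hy hyF
    obtain ⟨h5, h6, h7⟩ := hy₀ y ((le_max_left _ _).trans hy)
    refine ENNReal.ofReal_le_ofReal ?_
    rw [div_lt_one (by positivity)] at h6
    rw [div_lt_iff₀ hs] at h3
    have h8 : y ^ (2 / 3 : ℝ) ≤ fFun μ x ^ (2 / 3 : ℝ) :=
      Real.rpow_le_rpow h7.le hyF (by norm_num)
    have h9 : c / (1 - stdCdf (nuFun y)) ≤ (1 + ε / 8) * c := by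
      rw [div_eq_mul_one_div, mul_comm]
      exact mul_le_mul_of_nonneg_right h5.le hc0
    have h10 : ε / 8 * (Q * √x) ≤ ε / 8 * c := by gcongr
    unfold geoBound
    linarith
  have h5 := h1 c hc1 _
    (fun y hy => hcrude (fun _ => nuFun) (fun i hi => by omega) (fun x hx => nuFun_bounds hx) c hc0
      y hy) hmid
    (fun y hy hyF => (hmid y hy hyF).trans (ENNReal.ofReal_le_ofReal
      (mul_le_mul_of_nonneg_right (by linarith) hc0)))
  refine h5.trans (ENNReal.ofReal_le_ofReal ?_)
  have h6 : stageRoot μ x z * Del z / μ ≤ (kap μ 1 / Q * Del z + ε / 4) * c := by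
    have hk : 0 ≤ kap μ 1 / Q * Del z + ε / 4 := by
      have := kap_pos hμ (m := 1)
      have := Del_nonneg z
      positivity
    calc stageRoot μ x z * Del z / μ = stageRoot μ x z / √x * Del z / μ / Q * (Q * √x) := by
          field_simp
      _ ≤ (kap μ 1 / Q * Del z + ε / 4) * c := mul_le_mul h4.le hc (by positivity) hk
  have h7 : ε / 4 * stdCdf z * c ≤ ε / 4 * c :=
    mul_le_mul_of_nonneg_right (mul_le_of_le_one_right (by positivity) (stdCdf_lt_one z).le) hc0
  have h8 : 0 ≤ ε * c := by positivity
  linarith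

/-- The typical remaining distance is at most slightly more than `√t` times the critical parameter;
there the inductive bound holds with a constant `Q₁` for which `κ_m / Q₁` is close to `κ_{m+1} / Q`.
Up to `f(x)` a poorer constant `Q₂` is good enough, as those distances are improbable. -/
theorem policyBound_paramsPlus_succ (hμ : 0 < μ) {m : ℕ} (hm : 1 ≤ m) {z : ℝ}
    (ih : ∀ Q ε : ℝ, 0 < Q → 0 < ε → ∀ᶠ x in atTop, ∀ c, Q * crit m x ≤ c →
      policyBound μ c m (paramsPlus (m - 1) z) x
        ≤ ENNReal.ofReal ((m + stdCdf z + kap μ m / Q * Del z + ε) * c))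
    {Q ε : ℝ} (hQ : 0 < Q) (hε : 0 < ε) :
    ∀ᶠ x in atTop, ∀ c, Q * crit (m + 1) x ≤ c →
      stageStep μ c (fun a => √((1 - (1 / 2 : ℝ) ^ m) * Real.log (a + 1)))
          (policyBound μ c m (paramsPlus (m - 1) z)) x
        ≤ ENNReal.ofReal ((m + 1 + stdCdf z + kap μ (m + 1) / Q * Del z + ε) * c) := by
  have hρ := ratioConst_pos hμ hm
  have hk := kap_pos hμ (m := m)
  have hk1 := kap_pos hμ (m := m + 1)
  have hDel := Del_nonneg z
  have hΦ := stdCdf_nonneg z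
  have hp0 := half_pow_pos m
  have hp := half_pow_le hm
  -- the small enlargement of the range of the typical remaining distances
  obtain ⟨η, hη0, hη⟩ : ∃ η : ℝ, 0 < η ∧ η * (kap μ (m + 1) / Q * Del z) ≤ ε / 4 := by
    refine ⟨ε / 4 / (kap μ (m + 1) / Q * Del z + 1), by positivity, ?_⟩
    rw [div_mul_eq_mul_div, div_le_iff₀ (by positivity)]
    nlinarith
  set ζ : ℝ → ℝ := fun a => √((1 - (1 / 2 : ℝ) ^ m) * Real.log (a + 1)) with hζ
  have hζdiv : Tendsto (fun x => ζ x / √(Real.log x)) atTop (𝓝 √(1 - (1 / 2 : ℝ) ^ m)) :=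
    tendsto_sqrt_critical_div (by linarith)
  have hζtop : Tendsto ζ atTop atTop := tendsto_sqrt_critical (by linarith)
  have hζs := tendsto_div_sqrt_of_div_sqrt_log hζdiv
  have hζl : ∀ᶠ x in atTop, ζ x ≤ √(Real.log (x + 1)) := by
    filter_upwards [eventually_ge_atTop 0] with x hx
    exact sqrt_critical_le hp0.le hx
  -- Exceeding `d` requires a normal deviation of size `η ζ x`, which tends to infinity, while
  -- `h_m(d x)` grows at most by the factor `1 + η`.
  set d : ℝ → ℝ := fun x => stageRoot μ x (ζ x) * ((1 + η) * ζ x) with hd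
  have hdlim : Tendsto (fun x => d x / √(x * Real.log x)) atTop
      (𝓝 ((1 + η) * √((1 - (1 / 2 : ℝ) ^ m) / μ))) := by
    have h := tendsto_remaining_div hμ hζdiv
      ((hζdiv.const_mul (1 + η)).congr fun x => (mul_div_assoc (1 + η) (ζ x) _).symm)
    rwa [show 1 / √μ * ((1 + η) * √(1 - (1 / 2 : ℝ) ^ m)) = (1 + η) * √((1 - (1 / 2 : ℝ) ^ m) / μ) by
      rw [Real.sqrt_div (by linarith)]; ring] at h
  have hb0 : 0 < √((1 - (1 / 2 : ℝ) ^ m) / μ) := Real.sqrt_pos.2 (div_pos (by linarith) hμ)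
  have hcrit := tendsto_crit_div hm (mul_pos (by linarith) hb0) hdlim
  have hlt : ((1 + η) * √((1 - (1 / 2 : ℝ) ^ m) / μ)) ^ ((1 / 2 : ℝ) ^ m)
      * (1 / 2 : ℝ) ^ (1 / 2 - (1 / 2 : ℝ) ^ m) < (1 + η) * ratioConst μ m := by
    rw [Real.mul_rpow (by linarith) hb0.le, mul_assoc]
    refine mul_lt_mul_of_pos_right ?_ hρ
    calc (1 + η) ^ ((1 / 2 : ℝ) ^ m) < (1 + η) ^ (1 : ℝ) :=
          Real.rpow_lt_rpow_of_exponent_lt (by linarith) (by linarith)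
      _ = 1 + η := Real.rpow_one _
  have hcritF := tendsto_crit_div hm (show 0 < 6 / √μ by positivity) (tendsto_fFun_div hμ)
  set L := (6 / √μ) ^ ((1 / 2 : ℝ) ^ m) * (1 / 2 : ℝ) ^ (1 / 2 - (1 / 2 : ℝ) ^ m) with hL
  have hL0 : 0 < L := by positivity
  obtain ⟨Q₁, hQ₁⟩ : ∃ Q₁ : ℝ, Q₁ = Q / ((1 + η) * ratioConst μ m) := ⟨_, rfl⟩
  obtain ⟨Q₂, hQ₂⟩ : ∃ Q₂ : ℝ, Q₂ = Q / (L + 1) := ⟨_, rfl⟩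
  have hQ₁0 : 0 < Q₁ := by rw [hQ₁]; positivity
  have hQ₂0 : 0 < Q₂ := by rw [hQ₂]; positivity
  have hr : kap μ m / Q₁ = (1 + η) * (kap μ (m + 1) / Q) := by
    rw [hQ₁, kap_succ hμ hm]; field_simp
  obtain ⟨y₀, hy₀⟩ := (((ih Q₁ (ε / 4) hQ₁0 (by positivity)).and (ih Q₂ (ε / 4) hQ₂0 (by positivity))).and
    (eventually_ge_atTop 1)).exists_forall_of_atTop
  obtain ⟨N, C, hN, hC, hcrude⟩ := exists_policyBound_le hμ (abs_nonneg z) (n := m)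
  set A := m + stdCdf z + kap μ m / Q₁ * Del z + ε / 4 with hA
  set A₂ := m + stdCdf z + kap μ m / Q₂ * Del z + ε / 4 with hA₂
  have hA0 : 0 ≤ A := by positivity
  have hA₂0 : 0 ≤ A₂ := by positivity
  have hdtop : Tendsto (fun x => d x / stageRoot μ x (ζ x) - ζ x) atTop atTop := by
    refine (hζtop.const_mul_atTop hη0).congr' ?_
    filter_upwards [eventually_gt_atTop 0] with x hx
    have := stageRoot_pos hμ hx (ζ x)
    simp only [hd]
    field_simp
    ring
  have key := eventually_stageStep_le hμ (z := ζ) (d := d) (A := A) (B' := A₂ + N) (N := N) (C := C)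
    (y₀ := max y₀ 0) (ε := ε / 4) hA0 hN (by linarith) hC (le_max_right _ _) (by positivity)
    hζs hζl hdtop
  filter_upwards [key, eventually_gt_atTop 1, ((tendsto_crit (m := m + 1) (by omega)).const_mul_atTop
      hQ).eventually (eventually_ge_atTop 1), hcrit.eventually (gt_mem_nhds hlt),
    hcritF.eventually (gt_mem_nhds (show L < L + 1 by linarith)),
    (tendsto_overshootPlus hμ hm).eventually (gt_mem_nhds (show 0 < ε / 4 * Q by positivity))]
    with x h1 hx h2 h3 h4 h5 c hc
  have hcr := crit_pos (m := m + 1) (by omega) hx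
  have hc1 : 1 ≤ c := h2.trans hc
  have hc0 : 0 ≤ c := by linarith
  rw [div_lt_iff₀ hcr] at h3 h4 h5
  have hmono : ∀ y w, max y₀ 0 ≤ y → y ≤ w → crit m y ≤ crit m w := fun y w hy hyw => by
    have h6 := (hy₀ y ((le_max_left _ _).trans hy)).2
    exact crit_monotoneOn hm h6 (h6.trans hyw) hyw
  have hm1 := h1 c hc1 (policyBound μ c m (paramsPlus (m - 1) z))
    (fun y hy => hcrude _
      (by have := (paramsPlus_bounds (m - 1) z).1; rwa [Nat.sub_add_cancel hm] at this)
      (by have := (paramsPlus_bounds (m - 1) z).2; rwa [Nat.sub_add_cancel hm] at this) c hc0 y hy)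
    (fun y hy hyd => by
      refine (hy₀ y ((le_max_left _ _).trans hy)).1.1 c ?_
      calc Q₁ * crit m y ≤ Q₁ * ((1 + η) * ratioConst μ m * crit (m + 1) x) := by
            gcongr; exact (hmono y _ hy hyd).trans h3.le
        _ = Q * crit (m + 1) x := by rw [hQ₁]; field_simp
        _ ≤ c := hc)
    (fun y hy hyF => by
      refine ((hy₀ y ((le_max_left _ _).trans hy)).1.2 c ?_).trans (ENNReal.ofReal_le_ofReal
        (mul_le_mul_of_nonneg_right (by linarith) hc0))
      calc Q₂ * crit m y ≤ Q₂ * ((L + 1) * crit (m + 1) x) := by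
            gcongr; exact (hmono y _ hy hyF).trans h4.le
        _ = Q * crit (m + 1) x := by rw [hQ₂]; field_simp
        _ ≤ c := hc)
  refine hm1.trans (ENNReal.ofReal_le_ofReal ?_)
  change stageRoot μ x (ζ x) * Del (ζ x) / μ < ε / 4 * Q * crit (m + 1) x at h5
  have h6 : ε / 4 * (Q * crit (m + 1) x) ≤ ε / 4 * c := by gcongr
  have h7 : A * stdCdf (ζ x) ≤ A := mul_le_of_le_one_right hA0 (stdCdf_lt_one _).le
  have h8 : A ≤ m + stdCdf z + kap μ (m + 1) / Q * Del z + ε / 4 + ε / 4 := by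
    rw [hA, hr]; linarith
  have h9 := mul_le_mul_of_nonneg_right (h7.trans h8) hc0
  have h10 : 0 ≤ ε * c := by positivity
  linarith

/-- The risk of `samplerPlus` when the cost per stage is at least `Q h_m`. -/
theorem eventually_policyBound_paramsPlus_le (hμ : 0 < μ) (m : ℕ) (z : ℝ) :
    ∀ Q ε : ℝ, 0 < Q → 0 < ε → ∀ᶠ x in atTop, ∀ c, Q * crit (m + 1) x ≤ c →
      policyBound μ c (m + 1) (paramsPlus m z) x
        ≤ ENNReal.ofReal (((m + 1 : ℕ) + stdCdf z + kap μ (m + 1) / Q * Del z + ε) * c) := by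
  induction m with
  | zero =>
    intro Q ε hQ hε
    simpa using policyBound_paramsPlus_zero hμ z hQ hε
  | succ m ih =>
    intro Q ε hQ hε
    have := policyBound_paramsPlus_succ hμ (m := m + 1) (by omega) ih hQ hε
    rw [show ((m + 1 + 1 : ℕ) : ℝ) = (m + 1 : ℕ) + 1 by push_cast; ring]
    exact this

end PlusUpper


/-! ### From two-sided bounds to asymptotic equivalence. -/

section Equivalence

/-- The bounds also exclude infinite values for large `a`, so `toReal` does not replace the risk by
its default value there. -/
theorem isEquivalent_toReal {R : ℝ → EReal} {h : ℝ → ℝ} (hh : ∀ x, 0 < x → 0 < h x) {V : ℝ}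
    (hV : 0 < V)
    (hl : ∀ ε, 0 < ε → ε < 1 → ∀ᶠ a in atTop, (((V - ε) * h a : ℝ) : EReal) ≤ R a)
    (hu : ∀ ε, 0 < ε → ε < 1 → ∀ᶠ a in atTop, R a ≤ (((V + ε) * h a : ℝ) : EReal)) :
    (fun a => (R a).toReal) ~[atTop] fun a => V * h a := by
  refine IsLittleO.of_bound fun δ hδ => ?_
  obtain ⟨ε, hε0, hε⟩ := exists_between (show 0 < min (δ * V) 1 from lt_min (by positivity) one_pos)
  filter_upwards [hl ε hε0 (hε.trans_le (min_le_right _ _)),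
    hu ε hε0 (hε.trans_le (min_le_right _ _)), eventually_gt_atTop 0] with a h1 h2 ha
  have hha := hh a ha
  have hεV : ε ≤ δ * V := hε.le.trans (min_le_left _ _)
  simp only [Pi.sub_apply, Real.norm_eq_abs]
  generalize R a = r at h1 h2 ⊢
  lift r to ℝ using ⟨(h2.trans_lt (EReal.coe_lt_top _)).ne,
    ((EReal.bot_lt_coe _).trans_le h1).ne'⟩
  rw [EReal.coe_le_coe_iff] at h1 h2
  rw [EReal.toReal_coe]
  rw [abs_of_pos (mul_pos hV hha)]
  have h3 : ε * h a ≤ δ * V * h a := by gcongr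
  rw [abs_le]
  constructor <;> linarith

end Equivalence

/-! ### Measurability of the crossing parameters on the positive axis. -/

section Measurability

theorem measurable_indicator_of_restrict {f : ℝ → ℝ} (hf : Measurable fun x : Ioi (0 : ℝ) => f x) :
    Measurable ((Ioi 0).indicator f) := by
  classical
  have e : (Ioi 0).indicator f = fun x => if hx : x ∈ Ioi (0 : ℝ) then f (⟨x, hx⟩ : Ioi (0 : ℝ)) else 0 := by
    ext x
    by_cases hx : x ∈ Ioi (0 : ℝ) <;> simp [hx]
  rw [e]
  exact Measurable.dite (f := fun x : Ioi (0 : ℝ) => f x) hf measurable_const measurableSet_Ioi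

theorem measurable_paramsO {μ : ℝ} (hμ : 0 < μ) (m : ℕ) {g : ℝ → ℝ}
    (hg : Measurable fun x : Ioi (0 : ℝ) => g x) (i : ℕ) :
    Measurable ((Ioi 0).indicator (paramsO μ m g i)) := by
  refine measurable_indicator_of_restrict ?_
  induction m generalizing g i with
  | zero =>
    exact ((hg.sqrt.div (measurable_subtype_coe.pow_const _)).min
      (measurable_subtype_coe.pow_const _)).neg
  | succ m ih =>
    rcases i with _ | i
    · exact ((measurable_subtype_coe.div (hg.pow_const 2)).add_const 1).log.sqrt
    · exact ih (measurable_comp_fInv hμ hg) i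

theorem measurable_paramsPlus (m : ℕ) (z : ℝ) (i : ℕ) :
    Measurable ((Ioi 0).indicator (paramsPlus m z i)) := by
  refine Measurable.indicator ?_ measurableSet_Ioi
  have hν : Measurable nuFun := by unfold nuFun; fun_prop
  induction m generalizing i with
  | zero =>
    rcases i with _ | i
    · exact measurable_const
    · exact hν
  | succ m ih =>
    rcases i with _ | i
    · simp only [paramsPlus, consSeq]
      fun_prop
    · exact ih i

end Measurability

/-! ### From cost bounds to bounds for the risk. -/

section Risk

variable {Ω : Type*} [MeasurableSpace Ω] {P : Measure Ω} {B : ℝ≥0 → Ω → ℝ}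

theorem le_optRisk (hB : IsPreBrownianReal B P)
    (hmeas : ∀ t, Measurable (B t)) (hcont : ∀ ω, Continuous fun t => B t ω)
    (hzero : ∀ ω, B 0 ω = 0) {μ : ℝ} (hμ : 0 < μ) {a c v : ℝ} (ha : 0 < a) (hc : 0 < c) (hv : 0 ≤ v)
    {n : ℕ} {L : ℝ → ℝ≥0∞} (hL : L ∈ LowerBound μ c n) (hvL : ENNReal.ofReal v ≤ L a) :
    (v : EReal) ≤ optRisk P (drifted μ B) μ c a := by
  refine le_iInf₂ fun T hT => ?_
  have h := (add_le_add_right hvL _).trans (le_stageCost hB hmeas hcont hzero hμ hT ha hc hL)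
  rw [risk_eq hmeas hcont hzero hT ha]
  refine EReal.le_sub_iff_add_le (.inl (EReal.coe_ne_bot _)) (.inl (EReal.coe_ne_top _)) |>.2 ?_
  rw [← ENNReal.ofReal_add (by positivity) hv] at h
  have h2 := EReal.coe_ennreal_le_coe_ennreal_iff.2 h
  rw [EReal.coe_ennreal_ofReal, max_eq_left (by positivity), add_comm, EReal.coe_add] at h2
  exact h2

theorem IsPolicy.isSamplingRule_and_risk_le (hB : IsPreBrownianReal B P)
    (hmeas : ∀ t, Measurable (B t)) (hcont : ∀ ω, Continuous fun t => B t ω)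
    (hzero : ∀ ω, B 0 ω = 0) {μ : ℝ} (hμ : 0 < μ) {n : ℕ} {zf : ℕ → ℝ → ℝ}
    {δ : ℝ → (ℝ≥0 → ℝ) → ℕ → ℝ≥0} (h : IsPolicy μ n zf δ)
    (hzf : ∀ i, 1 ≤ i → i ≤ n → Measurable ((Ioi 0).indicator (zf i)))
    (hneg : ∀ x, 0 < x → zf n x ≤ 0) {a : ℝ} (ha : 0 < a) :
    IsSamplingRule (drifted μ B) (applied δ a (drifted μ B)) ∧
    ∀ c v, 0 ≤ c → 0 ≤ v → policyBound μ c n zf a ≤ ENNReal.ofReal v →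
      risk P (drifted μ B) μ c a (applied δ a (drifted μ B)) ≤ (v : EReal) := by
  have e : ∀ i x, 0 < x → zf i x = (Ioi 0).indicator (zf i) x := fun i x hx =>
    (indicator_of_mem (show x ∈ Ioi 0 from hx) _).symm
  have h' := h.congr e
  have hrule := h'.isSamplingRule hzf (continuous_drifted hcont μ)
    (fun ω => by simp [drifted, hzero]) a
  refine ⟨hrule, fun c v hc hv hb => ?_⟩
  have h1 := h'.stageCost_le hB hmeas hcont hzero hμ hzf
    (fun x hx => by rw [← e n x hx]; exact hneg x hx) ha hc
  rw [← policyBound_congr μ c n e ha] at h1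
  have h2 := EReal.coe_ennreal_le_coe_ennreal_iff.2 (h1.trans (add_le_add_right hb _))
  rw [← ENNReal.ofReal_add (by positivity) hv, EReal.coe_ennreal_ofReal,
    max_eq_left (by positivity), add_comm, EReal.coe_add] at h2
  rw [risk_eq hmeas hcont hzero hrule ha]
  exact EReal.sub_le_of_le_add h2

end Risk

/-! ### Bounds for the optimal risk and for the risk of the samplers. -/

section Main

variable {Ω : Type*} [MeasurableSpace Ω] {P : Measure Ω} {B : ℝ≥0 → Ω → ℝ} {μ : ℝ} {m : ℕ}
  {h : ℝ → ℝ}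

/-- In band `m + 1` with `m ≥ 1` the cost is eventually below `Q h_m` for every `Q > 0`. Choosing `Q
= κ_m / hazard z` makes `z` optimal, and the minimal stage value is at least `Φ(z)`, which may be
taken close to `1`. In the first band the cost of one stage is all that is claimed. -/
theorem eventually_le_optRisk_bandO (hB : IsPreBrownianReal B P)
    (hmeas : ∀ t, Measurable (B t)) (hcont : ∀ ω, Continuous fun t => B t ω)
    (hzero : ∀ ω, B 0 ω = 0) (hμ : 0 < μ) (hh : h ∈ bandO (m + 1)) {ε : ℝ} (hε : 0 < ε)
    (hε1 : ε < 1) :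
    ∀ᶠ a in atTop, ((((m + 1 : ℕ) - ε) * h a : ℝ) : EReal)
      ≤ optRisk P (drifted μ B) μ (h a) a := by
  rcases Nat.eq_zero_or_pos m with rfl | hm
  · filter_upwards [eventually_gt_atTop 0] with a ha
    have hha := hh.1 a ha
    refine le_optRisk hB hmeas hcont hzero hμ ha hha ?_ (const_mem_lowerBound (h a))
      (ENNReal.ofReal_le_ofReal ?_)
    · exact mul_nonneg (by push_cast; linarith) hha.le
    · push_cast
      have := mul_pos hε hha
      linarith
  · have hk := kap_pos hμ (m := m)
    obtain ⟨z, hz⟩ := (tendsto_stdCdf_atTop.eventually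
      (lt_mem_nhds (show 1 - ε / 2 < 1 by linarith))).exists
    have hhz := hazard_pos z
    have hr : kap μ m / (kap μ m / hazard z) = hazard z := by field_simp
    obtain ⟨x₀, hx₀⟩ := exists_lowerFun_mem hμ hm (kap μ m / hazard z) (stdCdf z + hazard z * Del z)
      (ε / 2) (by positivity)
      (add_nonneg (stdCdf_nonneg z) (mul_nonneg hhz.le (Del_nonneg z)))
      (fun w => by rw [hr]; exact stageValue_min rfl w) (by positivity) (by linarith)
    have hcrit := hh.2.2.bound (show 0 < kap μ m / hazard z by positivity)
    filter_upwards [eventually_gt_atTop 1, eventually_ge_atTop x₀, hcrit] with a ha ha₀ hcr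
    have ha0 : 0 < a := by linarith
    have hha := hh.1 a ha0
    have hm' : (1 : ℝ) ≤ m := by exact_mod_cast hm
    rw [Nat.add_sub_cancel, Real.norm_of_nonneg hha.le, Real.norm_of_nonneg (crit_pos hm ha).le] at hcr
    refine le_optRisk hB hmeas hcont hzero hμ ha0 hha ?_ (hx₀ (h a) hha) ?_
    · exact mul_nonneg (by push_cast; linarith) hha.le
    · rw [lowerFun, indicator_of_mem (by exact ⟨ha₀, hcr⟩)]
      refine ENNReal.ofReal_le_ofReal (mul_le_mul_of_nonneg_right ?_ hha.le)
      have := mul_nonneg hhz.le (Del_nonneg z)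
      push_cast
      linarith

theorem samplerO_rule_and_risk (hB : IsPreBrownianReal B P)
    (hmeas : ∀ t, Measurable (B t)) (hcont : ∀ ω, Continuous fun t => B t ω)
    (hzero : ∀ ω, B 0 ω = 0) (hμ : 0 < μ) (hh : h ∈ bandO (m + 1)) {g : ℝ → ℝ}
    (hg : g ∈ bandO (m + 1))
    (hreg : m + 1 = 1 ∨ (Measurable (fun x : Ioi (0 : ℝ) => g x) ∧ ∃ x₀ : ℝ, MonotoneOn g (Ici x₀)))
    (hgh : ∀ᶠ x in atTop, g x ≤ h x) :
    (∀ a, 0 < a → IsSamplingRule (drifted μ B) (applied (samplerO μ (m + 1) g) a (drifted μ B))) ∧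
      ∀ ε, 0 < ε → ∀ᶠ a in atTop, risk P (drifted μ B) μ (h a) a
        (applied (samplerO μ (m + 1) g) a (drifted μ B)) ≤ ((((m + 1 : ℕ) + ε) * h a : ℝ) : EReal) := by
  -- For `m = 0` there is no index with `1 ≤ i ≤ m`, so measurability of `g` is only invoked when it
  -- is available.
  have hpol := fun a (ha : 0 < a) => (isPolicy_samplerO μ m g).isSamplingRule_and_risk_le hB hmeas
    hcont hzero hμ (fun i hi him => measurable_paramsO hμ m
      (hreg.resolve_left (by omega)).1 i) (fun x hx => ((paramsO_bounds m g).2 x hx).1) ha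
  refine ⟨fun a ha => (hpol a ha).1, fun ε hε => ?_⟩
  filter_upwards [eventually_policyBound_paramsO_le hμ m hg
    (hreg.imp (by omega) fun h => h.2) hε, hgh, eventually_gt_atTop 0] with a h1 h2 ha
  have hha := hh.1 a ha
  refine (hpol a ha).2 _ _ hha.le (by positivity) ?_
  push_cast
  exact h1 _ h2

/-- Eventually `h ≤ Q (1 + ε / 2) h_m`. Enlarging `Q` by this factor divides the minimal stage value
by at most the same factor, and as that value is at most `1` the loss is at most `ε / 2`. -/
theorem eventually_le_optRisk_bandPlus (hB : IsPreBrownianReal B P)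
    (hmeas : ∀ t, Measurable (B t)) (hcont : ∀ ω, Continuous fun t => B t ω)
    (hzero : ∀ ω, B 0 ω = 0) (hμ : 0 < μ) (hm : 1 ≤ m) (hh : ∀ x, 0 < x → 0 < h x) {Q z : ℝ}
    (hQ : 0 < Q) (hlim : Tendsto (fun x => h x / crit m x) atTop (𝓝 Q))
    (hz : hazard z = kap μ m / Q) {ε : ℝ} (hε : 0 < ε) (hε1 : ε < 1) :
    ∀ᶠ a in atTop, (((m + stdCdf z + Del z * hazard z - ε) * h a : ℝ) : EReal)
      ≤ optRisk P (drifted μ B) μ (h a) a := by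
  have hhz := hazard_pos z
  have hΦ := stdCdf_nonneg z
  have hD := Del_nonneg z
  set V := stdCdf z + hazard z * Del z with hV
  have hV0 : 0 ≤ V := by positivity
  have hV1 : V ≤ 1 := le_one_of_le_stageValue (stageValue_min rfl)
  have hη : 0 < 1 + ε / 2 := by linarith
  obtain ⟨x₀, hx₀⟩ := exists_lowerFun_mem hμ hm (Q * (1 + ε / 2)) (V / (1 + ε / 2)) (ε / 2)
    (by positivity) (by positivity) (fun w => by
      rw [div_le_iff₀ hη]
      have h1 := stageValue_min hz w
      rw [← hz, ← hV] at h1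
      have h2 : kap μ m / (Q * (1 + ε / 2)) * Del w * (1 + ε / 2) = hazard z * Del w := by
        rw [hz]; field_simp
      have h3 : 0 ≤ stdCdf w * (ε / 2) := mul_nonneg (stdCdf_nonneg w) (by positivity)
      linarith) (by positivity) (by linarith)
  have hVε : V - ε / 2 ≤ V / (1 + ε / 2) := by
    rw [le_div_iff₀ hη]
    nlinarith
  filter_upwards [eventually_gt_atTop 1, eventually_ge_atTop x₀,
    hlim.eventually (gt_mem_nhds (show Q < Q * (1 + ε / 2) by nlinarith))] with a ha ha₀ hcr
  have ha0 : 0 < a := by linarith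
  have hha := hh a ha0
  have hm' : (1 : ℝ) ≤ m := by exact_mod_cast hm
  rw [div_lt_iff₀ (crit_pos hm ha)] at hcr
  refine le_optRisk hB hmeas hcont hzero hμ ha0 hha ?_ (hx₀ (h a) hha) ?_
  · have : 0 ≤ Del z * hazard z := by positivity
    exact mul_nonneg (by linarith) hha.le
  · rw [lowerFun, indicator_of_mem (by exact ⟨ha₀, hcr.le⟩)]
    refine ENNReal.ofReal_le_ofReal (mul_le_mul_of_nonneg_right ?_ hha.le)
    rw [mul_comm (Del z)]
    linarith

/-- The cost bound is applied with `Q / (1 + η)`, which lies strictly below the limit of `h / h_m`;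
this inflates only the overshoot term, by the factor `1 + η`. -/
theorem samplerPlus_rule_and_risk (hB : IsPreBrownianReal B P)
    (hmeas : ∀ t, Measurable (B t)) (hcont : ∀ ω, Continuous fun t => B t ω)
    (hzero : ∀ ω, B 0 ω = 0) (hμ : 0 < μ) (hh : ∀ x, 0 < x → 0 < h x) {Q z : ℝ}
    (hQ : 0 < Q) (hlim : Tendsto (fun x => h x / crit (m + 1) x) atTop (𝓝 Q))
    (hz : hazard z = kap μ (m + 1) / Q) :
    (∀ a, 0 < a → IsSamplingRule (drifted μ B) (applied (samplerPlus μ (m + 1) z) a (drifted μ B))) ∧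
      ∀ ε, 0 < ε → ∀ᶠ a in atTop, risk P (drifted μ B) μ (h a) a
        (applied (samplerPlus μ (m + 1) z) a (drifted μ B))
          ≤ ((((m + 1 : ℕ) + stdCdf z + Del z * hazard z + ε) * h a : ℝ) : EReal) := by
  have hhz := hazard_pos z
  have hΦ := stdCdf_nonneg z
  have hD := Del_nonneg z
  have hpol := fun a (ha : 0 < a) => (isPolicy_samplerPlus μ m z).isSamplingRule_and_risk_le hB hmeas
    hcont hzero hμ (fun i hi him => measurable_paramsPlus m z i)
      (fun x hx => ((paramsPlus_bounds m z).2 x hx).1) ha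
  refine ⟨fun a ha => (hpol a ha).1, fun ε hε => ?_⟩
  obtain ⟨η, hη0, hη⟩ : ∃ η : ℝ, 0 < η ∧ η * (Del z * hazard z) ≤ ε / 2 := by
    refine ⟨ε / 2 / (Del z * hazard z + 1), by positivity, ?_⟩
    rw [div_mul_eq_mul_div, div_le_iff₀ (by positivity)]
    nlinarith
  filter_upwards [eventually_policyBound_paramsPlus_le hμ m z (Q / (1 + η)) (ε / 2) (by positivity)
      (by positivity), eventually_gt_atTop 1,
    hlim.eventually (lt_mem_nhds (show Q / (1 + η) < Q from div_lt_self hQ (by linarith)))]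
    with a h1 ha hcr
  have ha0 : 0 < a := by linarith
  have hha := hh a ha0
  rw [lt_div_iff₀ (crit_pos (by omega) ha)] at hcr
  have e : kap μ (m + 1) / (Q / (1 + η)) = (1 + η) * hazard z := by rw [hz]; field_simp
  refine (hpol a ha0).2 _ _ hha.le (by positivity) ((h1 _ hcr.le).trans (ENNReal.ofReal_le_ofReal
    (mul_le_mul_of_nonneg_right ?_ hha.le)))
  rw [e]
  linarith

theorem tendsto_kap_mul_crit_div (hm : 1 ≤ m) {Q : ℝ} (hQ : 0 < Q)
    (hlim : Tendsto (fun x => h x / crit m x) atTop (𝓝 Q)) :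
    Tendsto (fun x => kap μ m * crit m x / h x) atTop (𝓝 (kap μ m / Q)) := by
  refine (tendsto_const_nhds (x := kap μ m) |>.div hlim hQ.ne').congr' ?_
  filter_upwards [eventually_gt_atTop 1] with x hx
  have := crit_pos hm hx
  simp only [Pi.div_apply]
  field_simp

end Main

end

end MultistageSampling

/-! ### The theorem, assembled from the bounds for the optimal risk and for the samplers. -/

theorem theorem2p4 {Ω : Type*} [MeasurableSpace Ω] (P : Measure Ω)
    (B : ℝ≥0 → Ω → ℝ) (hB : IsBrownianReal B P) (hmeas : ∀ t, Measurable (B t))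
    (hzero : ∀ ω, B 0 ω = 0) (hcont : ∀ ω, Continuous (fun t => B t ω))
    (μ : ℝ) (hμ : 0 < μ) (X : ℝ≥0 → Ω → ℝ) (hX : X = drifted μ B)
    (m : ℕ) (hm : 1 ≤ m) (h : ℝ → ℝ) :
    (h ∈ bandO m →
      (fun a => (optRisk P X μ (h a) a).toReal)
        ~[atTop] (fun a => (m : ℝ) * h a) ∧
      (∀ g ∈ bandO m,
        (m = 1 ∨ (Measurable (fun x : Ioi (0 : ℝ) => g x) ∧ ∃ x₀ : ℝ, MonotoneOn g (Ici x₀))) →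
        (∀ᶠ x in atTop, g x ≤ h x) →
        (∀ a, 0 < a → IsSamplingRule X
          (applied (samplerO μ m g) a X)) ∧
        (fun a => (risk P X μ (h a) a
            (applied (samplerO μ m g) a X)).toReal)
          ~[atTop] (fun a => (m : ℝ) * h a)) ∧
      (∃ g ∈ bandO m, MonotoneOn g (Ioi 0) ∧ ∀ᶠ x in atTop, g x ≤ h x)) ∧
    (h ∈ bandPlus m →
      (∃! z : ℝ, Tendsto (fun x => kap μ m * crit m x / h x)
        atTop (𝓝 (stdPdf z / (1 - stdCdf z)))) ∧
      ∀ z : ℝ, Tendsto (fun x => kap μ m * crit m x / h x)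
          atTop (𝓝 (stdPdf z / (1 - stdCdf z))) →
        (∀ a, 0 < a → IsSamplingRule X
          (applied (samplerPlus μ m z) a X)) ∧
        (fun a => (risk P X μ (h a) a
            (applied (samplerPlus μ m z) a X)).toReal)
          ~[atTop] (fun a => ((m : ℝ) + stdCdf z + Del z *
            (stdPdf z / (1 - stdCdf z))) * h a) ∧
        (fun a => (optRisk P X μ (h a) a).toReal)
          ~[atTop] (fun a => ((m : ℝ) + stdCdf z + Del z *
            (stdPdf z / (1 - stdCdf z))) * h a)) := by
  subst hX
  have hB' := hB.toIsPreBrownianReal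
  obtain ⟨m, rfl⟩ : ∃ k, m = k + 1 := ⟨m - 1, by omega⟩
  have hm0 : (0 : ℝ) < (m + 1 : ℕ) := by positivity
  refine ⟨fun hh => ⟨?_, fun g hg hreg hgh => ?_, exists_monotone_minorant hm hh⟩, fun hh => ?_⟩
  -- No regularity of `h` is assumed, so the upper bound for the optimal risk comes from the sampler
  -- built on a nondecreasing minorant, which is automatically measurable on `(0, ∞)`.
  · obtain ⟨g, hg, hmono, hgh⟩ := exists_monotone_minorant hm hh
    have hgm : Measurable fun x : Ioi (0 : ℝ) => g x :=
      Monotone.measurable fun x y hxy => hmono x.2 y.2 hxy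
    have hs := samplerO_rule_and_risk hB' hmeas hcont hzero hμ hh hg
      (.inr ⟨hgm, 1, hmono.mono (Ici_subset_Ioi.2 one_pos)⟩) hgh
    refine isEquivalent_toReal hh.1 hm0 (fun ε hε hε1 =>
      eventually_le_optRisk_bandO hB' hmeas hcont hzero hμ hh hε hε1) fun ε hε _ => ?_
    filter_upwards [hs.2 ε hε, eventually_gt_atTop 0] with a h1 ha
    exact (iInf₂_le _ (hs.1 a ha)).trans h1
  · have hs := samplerO_rule_and_risk hB' hmeas hcont hzero hμ hh hg hreg hgh
    refine ⟨hs.1, isEquivalent_toReal hh.1 hm0 (fun ε hε hε1 => ?_) fun ε hε _ => hs.2 ε hε⟩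
    filter_upwards [eventually_le_optRisk_bandO hB' hmeas hcont hzero hμ hh hε hε1,
      eventually_gt_atTop 0] with a h1 ha
    exact h1.trans (iInf₂_le _ (hs.1 a ha))
  · obtain ⟨hpos, Q, hQ, hlim⟩ := hh
    have hk := tendsto_kap_mul_crit_div (μ := μ) hm hQ hlim
    refine ⟨?_, fun z hz => ?_⟩
    · obtain ⟨z, hz⟩ := exists_hazard_eq (div_pos (kap_pos hμ (m := m + 1)) hQ)
      refine ⟨z, ?_, fun w hw => hazard_strictMono.injective ?_⟩
      · rw [← hz] at hk
        exact hk
      · exact (tendsto_nhds_unique hw hk).trans hz.symm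
    · have hz' : hazard z = kap μ (m + 1) / Q := tendsto_nhds_unique hz hk
      have hs := samplerPlus_rule_and_risk hB' hmeas hcont hzero hμ hpos hQ hlim hz'
      have hl := fun {ε} (hε : 0 < ε) (hε1 : ε < 1) => eventually_le_optRisk_bandPlus hB' hmeas hcont
        hzero hμ hm hpos hQ hlim hz' hε hε1
      have hV : 0 < (m + 1 : ℕ) + stdCdf z + Del z * hazard z := by
        have := stdCdf_nonneg z
        have := mul_nonneg (Del_nonneg z) (hazard_pos z).le
        linarith
      refine ⟨hs.1, isEquivalent_toReal hpos hV (fun ε hε hε1 => ?_) fun ε hε _ => hs.2 ε hε,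
        isEquivalent_toReal hpos hV (fun ε hε hε1 => hl hε hε1) fun ε hε _ => ?_⟩
      · filter_upwards [hl hε hε1, eventually_gt_atTop 0] with a h1 ha
        exact h1.trans (iInf₂_le _ (hs.1 a ha))
      · filter_upwards [hs.2 ε hε, eventually_gt_atTop 0] with a h1 ha
        exact (iInf₂_le _ (hs.1 a ha)).trans h1
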